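/- Let $k$ be a field of characteristic zero, let $n\ge 1$, let $h_0,\dots,h_{n-1}\in k(z)$ with $h_0\neq 0$, and consider the linear difference equation $$E:\quad \sigma^n(y)+h_{n-1}\sigma^{n-1}(y)+\cdots+h_0y=0$$ over $k(z)$, where $\sigma(h)(z)=h(z+1)$. Let $A=A(E)\in \mathrm{GL}_n(k(z))$ be the companion matrix of $E$, with ones above the diagonal, last row $(-h_0,\dots,-h_{n-1})$ and zeros elsewhere. **Notation.** $\mathbb N=\{0,1,2,\dots\}$. An *arithmetic progression of period $m\in\mathbb N$* is a set $j+\mathbb N m$ with $j\in\mathbb N$ (a single point if $m=0$). $\mathrm{Seq}_k$ is the ring of sequences $\mathbb N\to k$, two sequences being identified if they agree from some index on, with $\sigma$ the left shift; it is a $k(z)$-$\sigma$-algebra via $h\mapsto (h(0),h(1),\dots)$. A fundamental solution matrix in a $k(z)$-$\sigma$-algebra $R$ is a $Y\in\mathrm{GL}_n(R)$ with $\sigma(Y)=AY$. A *Picard–Vessiot ring* for $\sigma(y)=Ay$ is a $\sigma$-simple $k(z)$-$\sigma$-algebra of the form $R=k(z)[Y_{ij},1/\det Y]$ with $Y$ a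 fundamental solution matrix. Its *period* is the integer $l\ge1$ for which there are orthogonal idempotents $e_0,\dots,e_{l-1}\in R$ with $R=e_0R\oplus\cdots\oplus e_{l-1}R$, $\sigma(e_0)=e_1,\dots,\sigma(e_{l-1})=e_0$, and every $e_iR$ a $\sigma^l$-simple integral domain. A *$\sigma$-pseudo field* is a $\sigma$-ring $L=e_0L\oplus\cdots\oplus e_{l-1}L$ (for some $l\ge1$) with orthogonal idempotents $e_i$ permuted in the same cyclic way and every $e_iL$ a field. A *Picard–Vessiot extension* for $\sigma(y)=Ay$ is a $\sigma$-pseudo field $L\supseteq k(z)$ with $L^\sigma=k(z)^\sigma$ which is the total ring of fractions of $k(z)[Y_{ij}]$ for a fundamental solution matrix $Y\in\mathrm{GL}_n(L)$. Let $X=\mathbb A^1_k\times \mathrm{GL}_{n,k}$ with the rational map $\sigma(b,B)=(b+1,A(b)B)$, and consider the following three conditions. 1. For every $x=(b,B)\in X(k)$ with $b\in\mathbb N$ whose orbit $x,\sigma(x),\sigma^2(x),\dots$ is defined and every closed subvariety $Y\subseteq X$, the set $\{i\in\mathbb N\mid \sigma^i(x)\in Y\}$ is a finite union of arithmetic progressions.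 2. There exists $x=(b,B)\in X(k)$ with $b\in\mathbb N$ whose orbit is defined such that for every closed subvariety $Y\subseteq X$ the set $\{i\in\mathbb N\mid \sigma^i(x)\in Y\}$ is a finite union of arithmetic progressions. 3. There exists a Picard–Vessiot extension of $k(z)$ for $\sigma(y)=Ay$ inside $\mathrm{Seq}_k$. **Proposition.** (a) Suppose that at least one of the conditions 1, 2, 3 holds. Then $\mathrm{Seq}_k$ contains exactly one Picard–Vessiot ring $R$ for $\sigma(y)=Ay$, its period $l$ exists and is unique, and for every solution $f\in k^{\mathbb N}$ of $E$, that is, every $f$ with $f(i+n)+h_{n-1}(i)f(i+n-1)+\cdots+h_0(i)f(i)=0$ for all sufficiently large $i$, the set $\{i\in\mathbb N\mid f(i)=0\}$ is a finite union of arithmetic progressions each of period at most $l$. (b) If $h_{n-1},\dots,h_1\in k[z]$ and $h_0\in k\setminus\{0\}$, then all three conditions 1, 2, 3 hold (and hence so does the conclusion of (a)). -/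

import Mathlib

open Filter
open scoped Matrix Polynomial

noncomputable section

namespace SML

/-! ### Difference rings: a ring `R` with a ring endomorphism `σ : R →+* R` -/

/-- A `σ`-simple ring: a nonzero ring whose only `σ`-ideals (ideals `I` with `σ(I) ⊆ I`)
are `0` and the whole ring. -/
structure IsSigmaSimple {R : Type*} [CommRing R] (σ : R →+* R) : Prop where
  nontrivial : Nontrivial R
  eq_bot_or_eq_top : ∀ I : Ideal R, (∀ x ∈ I, σ x ∈ I) → I = ⊥ ∨ I = ⊤

/-- `Y ∈ GLₙ(R)` is a fundamental solution matrix for `σ(y) = A y`. -/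
def IsFundamentalMatrix {K R : Type*} [Field K] [CommRing R] [Algebra K R] (σ : R →+* R)
    {n : ℕ} (A : Matrix (Fin n) (Fin n) K) (Y : GL (Fin n) R) : Prop :=
  (Y : Matrix (Fin n) (Fin n) R).map σ =
    A.map (algebraMap K R) * (Y : Matrix (Fin n) (Fin n) R)

/-- The set of entries `Yᵢⱼ` of an invertible matrix. -/
def entries {R : Type*} [CommRing R] {n : ℕ} (Y : GL (Fin n) R) : Set R :=
  Set.range fun p : Fin n × Fin n => (Y : Matrix (Fin n) (Fin n) R) p.1 p.2

/-- A Picard-Vessiot ring for `σ(y) = A y` over the `σ`-field `(K, σK)`: a `σ`-simple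
`K`-`σ`-algebra `R` with `R = K[Yᵢⱼ, 1/det Y]` for a fundamental solution matrix `Y ∈ GLₙ(R)`. -/
structure IsPicardVessiotRing {K R : Type*} [Field K] [CommRing R] [Algebra K R]
    (σK : K →+* K) (σ : R →+* R) {n : ℕ} (A : Matrix (Fin n) (Fin n) K) : Prop where
  compat : ∀ a : K, σ (algebraMap K R a) = algebraMap K R (σK a)
  generated : ∃ Y : GL (Fin n) R, IsFundamentalMatrix σ A Y ∧
    Algebra.adjoin K
      (entries Y ∪ {(((Matrix.GeneralLinearGroup.det Y)⁻¹ : Rˣ) : R)}) = ⊤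
  simple : IsSigmaSimple σ

/-- `l ≥ 1` is the period of the (Noetherian `σ`-simple) `σ`-ring `R`: there are orthogonal
idempotents `e₀, …, e_{l-1}` with `R = e₀R ⊕ ⋯ ⊕ e_{l-1}R`, permuted cyclically by `σ`, such that
every ring `eᵢR` (with unit element `eᵢ`) is an integral domain and is `σˡ`-simple. The ideals of
the ring `eᵢR` are the ideals of `R` contained in `eᵢR`. -/
def IsPeriod {R : Type*} [CommRing R] (σ : R →+* R) (l : ℕ) : Prop :=
  0 < l ∧ ∃ e : Fin l → R, CompleteOrthogonalIdempotents e ∧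
    (∀ i, σ (e i) = e (finRotate l i)) ∧
    ∀ i, e i ≠ 0 ∧
      (∀ x y : R, (e i * x) * (e i * y) = 0 → e i * x = 0 ∨ e i * y = 0) ∧
      ∀ I : Ideal R, I ≤ Ideal.span {e i} → (∀ x ∈ I, σ^[l] x ∈ I) →
        I = ⊥ ∨ I = Ideal.span {e i}

/-- A `σ`-pseudo field: `L = e₀L ⊕ ⋯ ⊕ e_{l-1}L` with orthogonal idempotents permuted cyclically
by `σ`, where every ring `eᵢL` (with unit element `eᵢ`) is a field. -/
def IsPseudoField {L : Type*} [CommRing L] (σ : L →+* L) : Prop :=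
  ∃ l : ℕ, 0 < l ∧ ∃ e : Fin l → L, CompleteOrthogonalIdempotents e ∧
    (∀ i, σ (e i) = e (finRotate l i)) ∧
    ∀ i, e i ≠ 0 ∧ ∀ x : L, e i * x ≠ 0 → ∃ y : L, (e i * x) * (e i * y) = e i

/-- A Picard-Vessiot extension for `σ(y) = A y` over the `σ`-field `(K, σK)`: a `σ`-pseudo field
extension `L` of `K` without new constants such that `L` is the total ring of fractions of
`K[Yᵢⱼ]` for a fundamental solution matrix `Y ∈ GLₙ(L)`. -/
structure IsPicardVessiotExtension {K L : Type*} [Field K] [CommRing L] [Algebra K L]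
    (σK : K →+* K) (σ : L →+* L) {n : ℕ} (A : Matrix (Fin n) (Fin n) K) : Prop where
  compat : ∀ a : K, σ (algebraMap K L a) = algebraMap K L (σK a)
  pseudoField : IsPseudoField σ
  generated : ∃ Y : GL (Fin n) L, IsFundamentalMatrix σ A Y ∧
    IsFractionRing (Algebra.adjoin K (entries Y)) L
  constants : ∀ x : L, σ x = x → ∃ a : K, σK a = a ∧ algebraMap K L a = x

/-! ### The difference field `k(z)` and the difference ring of sequences -/

section Sequences

variable (k : Type*) [Field k]

/-- The automorphism `h(z) ↦ h(z + 1)` of `k(z)`. -/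
def ratShift : RatFunc k →+* RatFunc k :=
  RatFunc.mapRingHom (Polynomial.taylorEquiv (1 : k))
    (nonZeroDivisors_le_comap_nonZeroDivisors_of_injective _
      (Polynomial.taylorEquiv (1 : k)).injective)

/-- The ring `Seq_k` of `k`-valued sequences, two sequences being identified if they agree from
some index on; addition and multiplication are componentwise. -/
def SeqRing : Type _ := Germ (atTop : Filter ℕ) k

instance : CommRing (SeqRing k) := inferInstanceAs (CommRing (Germ (atTop : Filter ℕ) k))

variable {k}

/-- The class in `Seq_k` of a sequence. -/
def SeqRing.mk (f : ℕ → k) : SeqRing k := (f : Germ (atTop : Filter ℕ) k)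

theorem SeqRing.mk_eq_mk {k : Type*} [Field k] {f g : ℕ → k} : mk f = mk g ↔ ∀ᶠ i in atTop, f i = g i :=
  Germ.coe_eq

variable (k)

/-- The shift `(f(0), f(1), …) ↦ (f(1), f(2), …)` on `Seq_k`. -/
def seqShift : SeqRing k →+* SeqRing k where
  toFun f := Germ.compTendsto f (fun i : ℕ => i + 1) (tendsto_add_atTop_nat 1)
  map_one' := rfl
  map_zero' := rfl
  map_mul' f g := Germ.inductionOn₂ f g fun _ _ => rfl
  map_add' f g := Germ.inductionOn₂ f g fun _ _ => rfl

variable {k}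

theorem seqShift_mk (f : ℕ → k) : seqShift k (SeqRing.mk f) = SeqRing.mk fun i => f (i + 1) :=
  rfl

/-- The rational function `h` has no pole at `a`. -/
def RegularAt (h : RatFunc k) (a : k) : Prop := h.denom.eval a ≠ 0

/-- The value of `h ∈ k(z)` at `a` (only meaningful if `h` has no pole at `a`). -/
def ev (h : RatFunc k) (a : k) : k := RatFunc.eval (RingHom.id k) a h

theorem eventually_eval_ne_zero [CharZero k] {p : k[X]} (hp : p ≠ 0) :
    ∀ᶠ i : ℕ in atTop, p.eval (i : k) ≠ 0 := by
  classical
  have hfin : {i : ℕ | p.eval (i : k) = 0}.Finite := by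
    refine Set.Finite.of_finite_image (f := fun i : ℕ => (i : k)) ?_ Nat.cast_injective.injOn
    refine (p.roots.toFinset.finite_toSet).subset ?_
    rintro _ ⟨i, hi, rfl⟩
    exact Multiset.mem_toFinset.2 ((Polynomial.mem_roots hp).2 hi)
  have h := hfin.compl_mem_cofinite
  rw [Nat.cofinite_eq_atTop] at h
  exact h

theorem eventually_regularAt [CharZero k] (h : RatFunc k) :
    ∀ᶠ i : ℕ in atTop, RegularAt h (i : k) :=
  eventually_eval_ne_zero h.denom_ne_zero

/-- The embedding `k(z) → Seq_k`, `h ↦ (h(0), h(1), h(2), …)`. -/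
def ratToSeq [CharZero k] : RatFunc k →+* SeqRing k where
  toFun h := SeqRing.mk fun i => ev h (i : k)
  map_one' := congrArg SeqRing.mk (funext fun _ => RatFunc.eval_one _ _)
  map_zero' := congrArg SeqRing.mk (funext fun _ => RatFunc.eval_zero _ _)
  map_mul' x y := by
    refine SeqRing.mk_eq_mk.2 ?_
    filter_upwards [eventually_regularAt x, eventually_regularAt y] with i hx hy
    exact RatFunc.eval_mul _ _ hx hy
  map_add' x y := by
    refine SeqRing.mk_eq_mk.2 ?_
    filter_upwards [eventually_regularAt x, eventually_regularAt y] with i hx hy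
    exact RatFunc.eval_add _ _ hx hy

instance [CharZero k] : Algebra (RatFunc k) (SeqRing k) := ratToSeq.toAlgebra

theorem algebraMap_seq [CharZero k] (h : RatFunc k) :
    algebraMap (RatFunc k) (SeqRing k) h = SeqRing.mk fun i => ev h (i : k) := rfl

/-- `Seq_k` is a `k(z)`-`σ`-algebra. -/
theorem seqShift_algebraMap [CharZero k] (h : RatFunc k) :
    seqShift k (algebraMap (RatFunc k) (SeqRing k) h) =
      algebraMap (RatFunc k) (SeqRing k) (ratShift k h) := by
  have key : ∀ p : k[X], seqShift k (algebraMap (RatFunc k) (SeqRing k)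
      (algebraMap k[X] (RatFunc k) p)) =
      algebraMap (RatFunc k) (SeqRing k) (ratShift k (algebraMap k[X] (RatFunc k) p)) := by
    intro p
    have h1 : ratShift k (algebraMap k[X] (RatFunc k) p) =
        algebraMap k[X] (RatFunc k) (Polynomial.taylor 1 p) := by
      have := RatFunc.map_apply_div (Polynomial.taylorEquiv (1 : k))
        (nonZeroDivisors_le_comap_nonZeroDivisors_of_injective _
          (Polynomial.taylorEquiv (1 : k)).injective) p 1
      simp only [map_one, div_one] at this
      exact this
    rw [h1, algebraMap_seq, algebraMap_seq, seqShift_mk]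
    congr 1
    funext i
    simp [ev, Polynomial.taylor_eval]
  have : (seqShift k).comp (algebraMap (RatFunc k) (SeqRing k)) =
      (algebraMap (RatFunc k) (SeqRing k)).comp (ratShift k) :=
    IsLocalization.ringHom_ext (nonZeroDivisors k[X]) (RingHom.ext key)
  exact RingHom.congr_fun this h

/-- `R ⊆ Seq_k` is a `k(z)`-`σ`-subalgebra which is a Picard-Vessiot ring for `σ(y) = A y`. -/
def IsPicardVessiotRingInSeq [CharZero k] {n : ℕ} (A : Matrix (Fin n) (Fin n) (RatFunc k))
    (R : Subalgebra (RatFunc k) (SeqRing k)) : Prop :=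
  ∃ hR : ∀ x ∈ R, seqShift k x ∈ R,
    IsPicardVessiotRing (ratShift k) ((seqShift k).restrict R R hR) A

/-- `l` is the period of the `σ`-subring `R ⊆ Seq_k`. -/
def IsPeriodInSeq [CharZero k] (R : Subalgebra (RatFunc k) (SeqRing k)) (l : ℕ) : Prop :=
  ∃ hR : ∀ x ∈ R, seqShift k x ∈ R, IsPeriod ((seqShift k).restrict R R hR) l

/-- `L ⊆ Seq_k` is a `k(z)`-`σ`-subalgebra which is a Picard-Vessiot extension for
`σ(y) = A y`. -/
def IsPicardVessiotExtensionInSeq [CharZero k] {n : ℕ}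
    (A : Matrix (Fin n) (Fin n) (RatFunc k))
    (L : Subalgebra (RatFunc k) (SeqRing k)) : Prop :=
  ∃ hL : ∀ x ∈ L, seqShift k x ∈ L,
    IsPicardVessiotExtension (ratShift k) ((seqShift k).restrict L L hL) A

end Sequences

/-! ### Arithmetic progressions -/

/-- The arithmetic progression `j + ℕ m` of period `m`; for `m = 0` it is `{j}`. -/
def arithProg (j m : ℕ) : Set ℕ := {i | ∃ t : ℕ, i = j + t * m}

/-- `S` is a finite union of arithmetic progressions. -/
def IsFiniteUnionAP (S : Set ℕ) : Prop :=
  ∃ s : Finset (ℕ × ℕ), S = ⋃ p ∈ s, arithProg p.1 p.2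

/-- `S` is a finite union of arithmetic progressions of period at most `l`. -/
def IsFiniteUnionAPOfPeriodLE (l : ℕ) (S : Set ℕ) : Prop :=
  ∃ s : Finset (ℕ × ℕ), (∀ p ∈ s, p.2 ≤ l) ∧ S = ⋃ p ∈ s, arithProg p.1 p.2

/-! ### The rational map `(b, B) ↦ (b + 1, A(b) B)` on `X = 𝔸¹ × GLₙ` -/

section Dynamics

variable {k : Type*} [Field k]

/-- The set `X(k)` of rational points of `X = 𝔸¹ × GLₙ`. -/
abbrev Point (k : Type*) [Field k] (n : ℕ) : Type _ := k × GL (Fin n) k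

/-- The matrix `A(a)`. -/
def evMatrix {n : ℕ} (A : Matrix (Fin n) (Fin n) (RatFunc k)) (a : k) :
    Matrix (Fin n) (Fin n) k :=
  A.map fun h => ev h a

/-- The partial map on `X(k)` given by the rational map `σ(b, B) = (b + 1, A(b) B)`. It is defined
at `(b, B)` if the entries of `A` have no pole at `b` and `A(b)` is invertible. -/
def ratMap {n : ℕ} (A : Matrix (Fin n) (Fin n) (RatFunc k)) : Point k n →. Point k n :=
  fun x => ⟨(∀ i j, RegularAt (A i j) x.1) ∧ (evMatrix A x.1).det ≠ 0,
    fun h => (x.1 + 1, Matrix.GeneralLinearGroup.mkOfDetNeZero (evMatrix A x.1) h.2 * x.2)⟩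

/-- The orbit of `x` is defined and equals `o(0) = x, o(1) = σ(x), o(2) = σ²(x), …`. -/
def IsOrbit {n : ℕ} (A : Matrix (Fin n) (Fin n) (RatFunc k)) (x : Point k n)
    (o : ℕ → Point k n) : Prop :=
  o 0 = x ∧ ∀ i, o (i + 1) ∈ ratMap A (o i)

/-- The coordinates of a point `(b, B)`: `none` gives `b` and `some (i, j)` gives `Bᵢⱼ`. -/
def coord {n : ℕ} (x : Point k n) : Option (Fin n × Fin n) → k
  | none => x.1
  | some p => (x.2 : Matrix (Fin n) (Fin n) k) p.1 p.2

/-- `Y` is the set of `k`-points of a closed subvariety of `X`, i.e. the set of common zeros in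
`X(k)` of a set of polynomials in `z` and the `Zᵢⱼ` (negative powers of `det Z`, a unit on `X`,
do not yield more sets). -/
def IsClosedSubvariety {n : ℕ} (Y : Set (Point k n)) : Prop :=
  ∃ S : Set (MvPolynomial (Option (Fin n × Fin n)) k),
    Y = {x | ∀ p ∈ S, MvPolynomial.eval (coord x) p = 0}

/-- Every well-defined orbit of a point `(b, B) ∈ X(k)` with `b ∈ ℕ` meets every closed subvariety
in a finite union of arithmetic progressions. -/
def OrbitConditionAll {n : ℕ} (A : Matrix (Fin n) (Fin n) (RatFunc k)) : Prop :=
  ∀ (x : Point k n) (o : ℕ → Point k n), (∃ b : ℕ, x.1 = (b : k)) → IsOrbit A x o →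
    ∀ Y : Set (Point k n), IsClosedSubvariety Y → IsFiniteUnionAP {i | o i ∈ Y}

/-- Some point `(b, B) ∈ X(k)` with `b ∈ ℕ` has a well-defined orbit that meets every closed
subvariety in a finite union of arithmetic progressions. -/
def OrbitConditionExists {n : ℕ} (A : Matrix (Fin n) (Fin n) (RatFunc k)) : Prop :=
  ∃ (x : Point k n) (o : ℕ → Point k n), (∃ b : ℕ, x.1 = (b : k)) ∧ IsOrbit A x o ∧
    ∀ Y : Set (Point k n), IsClosedSubvariety Y → IsFiniteUnionAP {i | o i ∈ Y}

/-- There is a Picard-Vessiot extension of `k(z)` for `σ(y) = A y` inside `Seq_k`. -/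
def ExtensionCondition [CharZero k] {n : ℕ}
    (A : Matrix (Fin n) (Fin n) (RatFunc k)) : Prop :=
  ∃ L : Subalgebra (RatFunc k) (SeqRing k), IsPicardVessiotExtensionInSeq A L

/-! ### Scalar equations `σⁿ(y) + h_{n-1} σⁿ⁻¹(y) + ⋯ + h₀ y = 0` -/

/-- The matrix `A(E)`: ones above the diagonal, last row `-h₀, …, -h_{n-1}`, zeros elsewhere.
It is invertible if `h₀ ≠ 0`. -/
def systemMatrix {n : ℕ} (h : Fin n → RatFunc k) : Matrix (Fin n) (Fin n) (RatFunc k) :=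
  Matrix.of fun i j =>
    if (i : ℕ) + 1 = n then - h j else if (j : ℕ) = (i : ℕ) + 1 then 1 else 0

/-- The sequence `f` is a solution: `f(i+n) + h_{n-1}(i) f(i+n-1) + ⋯ + h₀(i) f(i) = 0` for all
sufficiently large `i`. -/
def IsSolution {n : ℕ} (h : Fin n → RatFunc k) (f : ℕ → k) : Prop :=
  ∀ᶠ i : ℕ in atTop, f (i + n) + ∑ j : Fin n, ev (h j) (i : k) * f (i + j) = 0

end Dynamics

end SML

end

noncomputable section

namespace SML

/-! Everything passes through one property: some fundamental matrix `Y` over `SeqRing k` has the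
feature that each element of R = k(z)[Yᵢⱼ, 1/det Y] (`pvRing Y`) has an eventually periodic zero
set, the period being allowed to depend on the element. Each of the three conditions gives this. The
idempotents of a pseudo field inside `SeqRing k` are the indicators of residue classes modulo l, so
each of its elements is eventually zero or eventually nonzero on every class. An orbit is itself a
fundamental matrix, and up to units the elements of R are polynomials evaluated along it.

For (a), the constants of `SeqRing k` are just k. Hence two fundamental matrices differ by a matrix
over k, they generate the same ring R, and R contains all solutions of E; only R can be a
Picard-Vessiot ring. Periodicity of zeros forces nonzerodivisors of R to be invertible in `SeqRing
k`, and makes the ring L of fractions of R a σ-simple ring (`isSigmaSimple_fractionSubalgebra`).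
Simplicity descends to R (`isSigmaSimple_of_generated`): in L ⊗ R/I the two images of `Y` differ by
a matrix of constants, constants are linearly disjoint from L, and a surjective endomorphism of a
Noetherian ring is injective, so R → R/I is injective. The minimal primes of R are permuted
cyclically by σ, which gives the period l (`exists_isPeriod`). Each eᵢR is a domain, so an element
with recurring zeros on the i-th class is zero there, because a product of its shifts is; the period
of the zero set therefore improves to l.

For (b), the companion matrix and its inverse are polynomial, so an orbit and the equations of a
subvariety live over a finitely generated domain D ⊆ k, which has a maximal ideal m with finite
residue field. Along progressions of a suitable step M the transition matrices are 1 modulo I =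
m^(c+1), so the i-th differences of the orbit entries, and of polynomials in them, lie in I^i. A
sequence of this kind with infinitely many zeros vanishes (`eq_zero_of_infinite_zeros`). This is the
Skolem-Mahler-Lech argument carried out inside D, with no completion: Artin-Rees bounds the loss in
dividing by p, and polynomial division replaces the count of zeros of an analytic function. -/

/-! ### Finite residue fields, division in the m-adic filtration, and vanishing from infinitely many
zeros -/

instance isJacobsonRing_int : IsJacobsonRing ℤ := by
  rw [isJacobsonRing_iff_sInf_maximal']
  intro I hI
  by_cases h0 : I = ⊥
  · refine ⟨{J | J.IsMaximal}, fun J hJ => (Ideal.isMaximal_def.1 hJ).2, ?_⟩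
    rw [h0, eq_comm, eq_bot_iff]
    intro x hx
    by_contra hx0
    rw [Ideal.mem_bot] at hx0
    obtain ⟨p, hp, hpp⟩ := Nat.exists_infinite_primes (x.natAbs + 1)
    have hp' : Prime (p : ℤ) := Nat.prime_iff_prime_int.1 hpp
    have hm : (Ideal.span {(p : ℤ)}).IsMaximal :=
      PrincipalIdealRing.isMaximal_of_irreducible hp'.irreducible
    have := (Submodule.mem_sInf.1 hx) _ hm
    rw [Ideal.mem_span_singleton, Int.natCast_dvd] at this
    have := Nat.le_of_dvd (Int.natAbs_pos.2 hx0) this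
    omega
  · refine ⟨{I}, fun J hJ => ?_, by simp⟩
    rw [Set.mem_singleton_iff.1 hJ]
    exact (hI.isMaximal h0).out.2

/-- A maximal ideal of a finitely generated commutative ring has finite residue field. -/
theorem finite_quotient_of_isMaximal {D : Type*} [CommRing D] [Algebra.FiniteType ℤ D]
    (m : Ideal D) [hm : m.IsMaximal] : Finite (D ⧸ m) := by
  let _ : Field (D ⧸ m) := Ideal.Quotient.field m
  have : Algebra.FiniteType ℤ (D ⧸ m) :=
    Algebra.FiniteType.of_surjective (Ideal.Quotient.mkₐ ℤ m) Ideal.Quotient.mk_surjective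
  have : Module.Finite ℤ (D ⧸ m) := finite_of_finite_type_of_isJacobsonRing ℤ (D ⧸ m)
  obtain ⟨p, hp⟩ := CharP.exists (D ⧸ m)
  rcases Nat.eq_zero_or_pos p with rfl | hpos
  · have : CharZero (D ⧸ m) := CharP.charP_to_charZero _
    have : IsField ℤ := isField_of_isIntegral_of_isField
      (FaithfulSMul.algebraMap_injective ℤ (D ⧸ m)) (Field.toIsField (D ⧸ m))
    exact absurd this Int.not_isField
  · have : NeZero p := ⟨hpos.ne'⟩
    let _ := ZMod.algebra (D ⧸ m) p
    have : Module.Finite (ZMod p) (D ⧸ m) := Module.Finite.of_restrictScalars_finite ℤ _ _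
    exact Module.finite_of_finite (ZMod p)

/-- A consequence of the Artin-Rees lemma: division by a nonzerodivisor loses a bounded power. -/
theorem exists_mem_pow_of_mul_mem_pow {D : Type*} [CommRing D] [IsNoetherianRing D] [IsDomain D]
    (m : Ideal D) {p : D} (hp : p ≠ 0) :
    ∃ c, ∀ (N : ℕ) (x : D), p * x ∈ m ^ (N + c) → x ∈ m ^ N := by
  obtain ⟨c, hc⟩ := m.exists_pow_inf_eq_pow_smul (Ideal.span {p} : Ideal D)
  refine ⟨c, fun N x hx => ?_⟩
  have h1 : p * x ∈ m ^ (N + c) • (⊤ : Ideal D) ⊓ Ideal.span {p} :=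
    ⟨by simpa using hx, Ideal.mul_mem_right _ _ (Ideal.mem_span_singleton_self p)⟩
  rw [hc _ (Nat.le_add_left _ _), Nat.add_sub_cancel] at h1
  have h2 : m ^ N • (m ^ c • (⊤ : Ideal D) ⊓ Ideal.span {p}) ≤ m ^ N * Ideal.span {p} :=
    Ideal.mul_mono_right inf_le_right
  have h3 := h2 h1
  rw [mul_comm (m ^ N), Ideal.mem_span_singleton_mul] at h3
  obtain ⟨z, hz, hzx⟩ := h3
  rwa [← mul_left_cancel₀ hp hzx]

/-- An element outside the maximal ideal m is a unit modulo every power of m. -/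
theorem mem_pow_of_coprime_mul_mem {D : Type*} [CommRing D] (m : Ideal D) [hm : m.IsMaximal]
    {q : D} (hq : q ∉ m) {N : ℕ} {x : D} (hx : q * x ∈ m ^ N) : x ∈ m ^ N := by
  have h : IsCoprime (Ideal.span {q}) (m ^ N) := by
    refine IsCoprime.pow_right ?_
    rw [Ideal.isCoprime_iff_sup_eq, sup_comm]
    exact hm.out.2 _ (lt_of_le_of_ne le_sup_left fun h => hq <|
      h ▸ (le_sup_right : _ ≤ m ⊔ Ideal.span {q}) (Ideal.mem_span_singleton_self q))
  obtain ⟨a, ha, b, hb, hab⟩ := Ideal.isCoprime_iff_exists.1 h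
  obtain ⟨c, rfl⟩ := Ideal.mem_span_singleton'.1 ha
  have : x = c * (q * x) + b * x := by rw [← mul_assoc, ← add_mul, hab, one_mul]
  rw [this]
  exact add_mem (Ideal.mul_mem_left _ _ hx) (Ideal.mul_mem_right _ _ hb)

/-- Division by a positive integer `q` in terms of its valuation at the residue characteristic. -/
theorem exists_mem_pow_of_natCast_mul_mem_pow {D : Type*} [CommRing D] [IsNoetherianRing D]
    [IsDomain D] [CharZero D] (m : Ideal D) [hm : m.IsMaximal] {p : ℕ} [hp : Fact p.Prime]
    (hpm : (p : D) ∈ m) :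
    ∃ c, ∀ q : ℕ, q ≠ 0 → ∀ (N : ℕ) (x : D), (q : D) * x ∈ m ^ (N + c * padicValNat p q) →
      x ∈ m ^ N := by
  obtain ⟨c, hc⟩ := exists_mem_pow_of_mul_mem_pow m (p := (p : D))
    (by exact_mod_cast hp.out.ne_zero)
  refine ⟨c, fun q hq => ?_⟩
  induction q using Nat.strong_induction_on with
  | _ q ih =>
    intro N x hx
    by_cases hd : p ∣ q
    · obtain ⟨r, rfl⟩ := hd
      have hr : r ≠ 0 := by rintro rfl; simp at hq
      rw [padicValNat.mul hp.out.ne_zero hr, padicValNat_self] at hx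
      refine ih r ?_ hr N x (hc _ _ ?_)
      · exact lt_mul_of_one_lt_left (Nat.pos_of_ne_zero hr) hp.out.one_lt
      · rw [← mul_assoc]
        push_cast at hx
        rwa [show N + c * padicValNat p r + c = N + c * (1 + padicValNat p r) by ring]
    · rw [padicValNat.eq_zero_of_not_dvd hd, mul_zero, add_zero] at hx
      refine mem_pow_of_coprime_mul_mem m (fun h => hm.ne_top ?_) hx
      have hcop : IsCoprime (p : ℤ) (q : ℤ) :=
        Nat.isCoprime_iff_coprime.2 ((Nat.Prime.coprime_iff_not_dvd hp.out).2 hd)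
      obtain ⟨a, b, hab⟩ := hcop
      rw [Ideal.eq_top_iff_one]
      have : (1 : D) = (a : D) * p + (b : D) * q := by exact_mod_cast hab.symm
      rw [this]
      exact add_mem (Ideal.mul_mem_left _ _ hpm) (Ideal.mul_mem_left _ _ h)

/-- Cancelling `L!` in an identity whose terms tend to zero fast. -/
theorem mem_pow_of_factorial_mul_eq {D : Type*} [CommRing D] (m : Ideal D) {p : ℕ}
    [hp : Fact p.Prime] {c : ℕ}
    (hc : ∀ q : ℕ, q ≠ 0 → ∀ (N : ℕ) (x : D), (q : D) * x ∈ m ^ (N + c * padicValNat p q) →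
      x ∈ m ^ N) (k : ℕ) (b : ℕ → D) (hb : ∀ i, b i ∈ m ^ (k + c * padicValNat p i.factorial))
    (u : D) : ∀ L : ℕ,
      (L.factorial : D) * u - ∑ i ∈ Finset.range (L + 1), ((L.descFactorial (L - i) : ℕ) : D) * b i
        ∈ m ^ (k + c * padicValNat p L.factorial) → u ∈ m ^ k := by
  intro L
  induction L with
  | zero =>
    intro h
    have h0 := hb 0
    simp only [Nat.factorial_zero, Nat.cast_one, one_mul, zero_add, Finset.sum_range_one,
      Nat.sub_zero, Nat.descFactorial_zero, padicValNat_one_right, mul_zero, add_zero] at h h0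
    simpa using add_mem h h0
  | succ L ih =>
    intro h
    apply ih
    -- Descending from (L+1)! to L! divides by L + 1 alone, and its cost c·v_p(L+1) is exactly the
    -- difference of the two exponents. The top term b (L+1) is absorbed by `hb`, so each b i only
    -- has to compensate for i!.
    apply hc (L + 1) L.succ_ne_zero
    rw [Finset.sum_range_succ] at h
    have h' := add_mem h (hb (L + 1))
    rw [Nat.factorial_succ, padicValNat.mul L.succ_ne_zero L.factorial_ne_zero] at h'
    rw [show k + c * padicValNat p L.factorial + c * padicValNat p (L + 1) =
      k + c * (padicValNat p (L + 1) + padicValNat p L.factorial) by ring]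
    convert h' using 1
    rw [mul_sub, Finset.mul_sum]
    have : ∀ i ∈ Finset.range (L + 1), ((L + 1 : ℕ) : D) * (((L.descFactorial (L - i) : ℕ) : D) * b i)
        = (((L + 1).descFactorial (L + 1 - i) : ℕ) : D) * b i := by
      intro i hi
      rw [Nat.succ_sub (Nat.lt_succ_iff.1 (Finset.mem_range.1 hi)), Nat.succ_descFactorial_succ]
      push_cast; ring
    rw [Finset.sum_congr rfl this]
    simp
    ring

/-- A sequence whose iterated differences at `0` tend to zero fast and which has infinitely many
zeros vanishes. -/
theorem eq_zero_of_infinite_zeros {D : Type*} [CommRing D] [IsNoetherianRing D] [IsDomain D]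
    [CharZero D] (m : Ideal D) [hm : m.IsMaximal] {p : ℕ} [hp : Fact p.Prime] {c : ℕ}
    (hc : ∀ q : ℕ, q ≠ 0 → ∀ (N : ℕ) (x : D), (q : D) * x ∈ m ^ (N + c * padicValNat p q) →
      x ∈ m ^ N) (g : ℕ → D) (hg : ∀ i, (fwdDiff 1)^[i] g 0 ∈ (m ^ (c + 1)) ^ i)
    (hinf : {j | g j = 0}.Infinite) (x : ℕ) : g x = 0 := by
  have key : ∀ k, g x ∈ m ^ k := by
    intro k
    obtain ⟨Z, hZ, hZk⟩ := hinf.exists_subset_card_eq k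
    -- L bounds x and the k chosen zeros, so Newton's formula truncated at L is exact at all these
    -- points.
    obtain ⟨L, hL⟩ := (insert x Z).exists_le
    set d : ℕ → D := fun i => (fwdDiff 1)^[i] g 0 with hd
    -- Newton's formula times L!, with L!/i! written as a descending factorial, so that no division
    -- occurs in D.
    have hnewton : ∀ t ≤ L, (L.factorial : D) * g t = ∑ i ∈ Finset.range (L + 1),
        ((L.descFactorial (L - i) : ℕ) : D) * (d i * (((descPochhammer ℤ i).eval (t : ℤ) : ℤ) : D)) := by
      intro t ht
      have h1 : g t = ∑ i ∈ Finset.range (L + 1), t.choose i • d i := by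
        have := shift_eq_sum_fwdDiff_iter 1 g t 0
        rw [zero_add, smul_eq_mul, mul_one] at this
        rw [this]
        refine Finset.sum_subset (by simpa using ht) fun i _ hi => ?_
        rw [Nat.choose_eq_zero_of_lt (by simpa using hi), zero_smul]
      rw [h1, Finset.mul_sum]
      refine Finset.sum_congr rfl fun i hi => ?_
      have hiL : i ≤ L := Nat.lt_succ_iff.1 (Finset.mem_range.1 hi)
      have h2 : (descPochhammer ℤ i).eval (t : ℤ) = ((i.factorial * t.choose i : ℕ) : ℤ) := by
        rw [descPochhammer_eval_eq_descFactorial, Nat.descFactorial_eq_factorial_mul_choose]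
      have h3 : i.factorial * L.descFactorial (L - i) = L.factorial := by
        have := Nat.factorial_mul_descFactorial (Nat.sub_le L i)
        rwa [Nat.sub_sub_self hiL] at this
      rw [h2, ← h3, nsmul_eq_mul]
      push_cast; ring
    set P : ℤ[X] := ∏ t ∈ Z, (Polynomial.X - Polynomial.C (t : ℤ)) with hP
    have hPm : P.Monic := Polynomial.monic_prod_of_monic _ _ fun t _ => Polynomial.monic_X_sub_C _
    have hPd : P.natDegree = k := by
      rw [hP, Polynomial.natDegree_prod_of_monic _ _ fun t _ => Polynomial.monic_X_sub_C _]
      simp only [Polynomial.natDegree_X_sub_C, Finset.sum_const, hZk, smul_eq_mul, mul_one]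
    have hdiv : ∀ i, descPochhammer ℤ i = descPochhammer ℤ i %ₘ P + P * (descPochhammer ℤ i /ₘ P) :=
      fun i => (Polynomial.modByMonic_add_div _ _).symm
    -- Reducing each Newton polynomial modulo P leaves a polynomial of degree below k that agrees
    -- with L!·g at the k roots of P. There g is zero, so R = 0 and only multiples of P contribute
    -- to L!·g(x).
    set R : D[X] := ∑ i ∈ Finset.range (L + 1), Polynomial.C (((L.descFactorial (L - i) : ℕ) : D) * d i)
        * (descPochhammer ℤ i %ₘ P).map (Int.castRingHom D) with hR
    have hReval : ∀ t : ℕ, R.eval (t : D) = ∑ i ∈ Finset.range (L + 1),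
        ((L.descFactorial (L - i) : ℕ) : D) *
          (d i * (((descPochhammer ℤ i %ₘ P).eval (t : ℤ) : ℤ) : D)) := by
      intro t
      rw [hR, Polynomial.eval_finsetSum]
      refine Finset.sum_congr rfl fun i _ => ?_
      rw [Polynomial.eval_mul, Polynomial.eval_C, mul_assoc]
      have := Polynomial.eval_intCast_map (Int.castRingHom D) (descPochhammer ℤ i %ₘ P) (t : ℤ)
      simp only [Int.cast_natCast, eq_intCast] at this
      rw [this]
    have hR0 : R = 0 := by
      refine Polynomial.eq_zero_of_degree_lt_of_eval_finset_eq_zero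
        (Z.map ⟨((↑) : ℕ → D), Nat.cast_injective⟩) ?_ ?_
      · rw [Finset.card_map, hZk, hR]
        refine lt_of_le_of_lt (Polynomial.degree_sum_le _ _) ?_
        rw [Finset.sup_lt_iff (WithBot.bot_lt_coe _)]
        intro i _
        rw [← Polynomial.smul_eq_C_mul]
        refine lt_of_le_of_lt (Polynomial.degree_smul_le _ _) ?_
        refine lt_of_le_of_lt Polynomial.degree_map_le ?_
        have := Polynomial.degree_modByMonic_lt (descPochhammer ℤ i) hPm
        rwa [Polynomial.degree_eq_natDegree hPm.ne_zero, hPd] at this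
      · intro t' ht'
        obtain ⟨t, ht, rfl⟩ := Finset.mem_map.1 ht'
        have h0 := hnewton t (hL t (Finset.mem_insert_of_mem ht))
        have hgt : g t = 0 := hZ ht
        rw [hgt, mul_zero] at h0
        change R.eval (t : D) = 0
        rw [hReval, h0]
        refine Finset.sum_congr rfl fun i _ => ?_
        have hPt : P.eval (t : ℤ) = 0 := by
          rw [hP, Polynomial.eval_prod]
          exact Finset.prod_eq_zero ht (by simp)
        conv_rhs => rw [hdiv i]
        rw [Polynomial.eval_add, Polynomial.eval_mul, hPt, zero_mul, add_zero]
    refine mem_pow_of_factorial_mul_eq m hc k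
      (fun i => d i * (((P * (descPochhammer ℤ i /ₘ P)).eval (x : ℤ) : ℤ) : D)) ?_ (g x) L ?_
    · intro i
      -- For i < k the quotient by P is zero. For i ≥ k, v_p(i!) ≤ i gives (c+1)i ≥ k + c·v_p(i!):
      -- this is where decay in powers of m^(c+1) is needed.
      by_cases hik : i < k
      · have : descPochhammer ℤ i /ₘ P = 0 := by
          rw [Polynomial.divByMonic_eq_zero_iff hPm]
          rw [Polynomial.degree_eq_natDegree hPm.ne_zero, hPd,
            Polynomial.degree_eq_natDegree (monic_descPochhammer ℤ i).ne_zero,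
            descPochhammer_natDegree]
          exact_mod_cast hik
        simp [this]
      · refine Ideal.mul_mem_right _ _ (Ideal.pow_le_pow_right ?_ (pow_mul m (c + 1) i ▸ hg i))
        have := padicValNat_factorial_le (p := p) i
        nlinarith [Nat.mul_le_mul_left c this]
    · rw [hnewton x (hL x (Finset.mem_insert_self _ _))]
      have hRx := hReval x
      rw [hR0, Polynomial.eval_zero] at hRx
      convert Ideal.zero_mem _ using 1
      rw [← Finset.sum_sub_distrib, hRx]
      refine Finset.sum_congr rfl fun i _ => ?_
      conv_lhs => enter [1]; rw [hdiv i]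
      rw [Polynomial.eval_add]
      push_cast; ring
  -- Krull's intersection theorem.
  have := Ideal.iInf_pow_eq_bot_of_isDomain m hm.ne_top
  rw [← Ideal.mem_bot, ← this]
  simpa using key

/-! ### Sequences with rapidly decreasing differences -/

/-- `IsDecaying I b s g`: the iterated differences `Δⁱ g` for `i ≤ b` have values in `I ^ (i + s)`. -/
def IsDecaying {D : Type*} [CommRing D] (I : Ideal D) : ℕ → ℕ → (ℕ → D) → Prop
  | 0, s, g => ∀ j, g j ∈ I ^ s
  | b + 1, s, g => (∀ j, g j ∈ I ^ s) ∧ IsDecaying I b (s + 1) (fwdDiff 1 g)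

namespace IsDecaying

variable {D : Type*} [CommRing D] {I : Ideal D}

theorem weaken {b s t : ℕ} {g : ℕ → D} (hst : t ≤ s) (h : IsDecaying I b s g) :
    IsDecaying I b t g := by
  induction b generalizing s t g with
  | zero => exact fun j => Ideal.pow_le_pow_right hst (h j)
  | succ b ih => exact ⟨fun j => Ideal.pow_le_pow_right hst (h.1 j), ih (Nat.succ_le_succ hst) h.2⟩

theorem of_succ {b s : ℕ} {g : ℕ → D} (h : IsDecaying I (b + 1) s g) : IsDecaying I b s g := by
  induction b generalizing s g with
  | zero => exact h.1
  | succ b ih => exact ⟨h.1, ih h.2⟩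

theorem zero (b s : ℕ) : IsDecaying I b s (0 : ℕ → D) := by
  induction b generalizing s with
  | zero => exact fun j => Ideal.zero_mem _
  | succ b ih =>
    refine ⟨fun j => Ideal.zero_mem _, ?_⟩
    have : fwdDiff 1 (0 : ℕ → D) = 0 := by ext; simp [fwdDiff]
    rw [this]
    exact ih _

theorem const {s : ℕ} {d : D} (hd : d ∈ I ^ s) (b : ℕ) : IsDecaying I b s (fun _ => d) := by
  cases b with
  | zero => exact fun _ => hd
  | succ b =>
    refine ⟨fun _ => hd, ?_⟩
    rw [fwdDiff_const]
    exact zero _ _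

theorem add {b s : ℕ} {g h : ℕ → D} (hg : IsDecaying I b s g) (hh : IsDecaying I b s h) :
    IsDecaying I b s (g + h) := by
  induction b generalizing s g h with
  | zero => exact fun j => add_mem (hg j) (hh j)
  | succ b ih =>
    refine ⟨fun j => add_mem (hg.1 j) (hh.1 j), ?_⟩
    rw [fwdDiff_add]
    exact ih hg.2 hh.2

theorem shift {b s : ℕ} {g : ℕ → D} (hg : IsDecaying I b s g) :
    IsDecaying I b s (fun j => g (j + 1)) := by
  induction b generalizing s g with
  | zero => exact fun j => hg (j + 1)
  | succ b ih => exact ⟨fun j => hg.1 (j + 1), ih hg.2⟩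

/-- Leibniz rule Δ(gh) = Δg · (shift of h) + g · Δh: in each summand the differenced factor
contributes the extra power of I. -/
theorem mul {b s t : ℕ} {g h : ℕ → D} (hg : IsDecaying I b s g) (hh : IsDecaying I b t h) :
    IsDecaying I b (s + t) (g * h) := by
  induction b generalizing s t g h with
  | zero => exact fun j => pow_add I s t ▸ Ideal.mul_mem_mul (hg j) (hh j)
  | succ b ih =>
    refine ⟨fun j => pow_add I s t ▸ Ideal.mul_mem_mul (hg.1 j) (hh.1 j), ?_⟩
    have : fwdDiff 1 (g * h) = fwdDiff 1 g * (fun j => h (j + 1)) + g * fwdDiff 1 h := by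
      ext j; simp [fwdDiff]; ring
    rw [this]
    refine add ?_ ?_
    · rw [show s + t + 1 = s + 1 + t by ring]
      exact ih hg.2 (of_succ hh).shift
    · exact ih (t := t + 1) (of_succ hg) hh.2

theorem sum {ι : Type*} {b s : ℕ} (S : Finset ι) {g : ι → ℕ → D}
    (h : ∀ i ∈ S, IsDecaying I b s (g i)) : IsDecaying I b s (∑ i ∈ S, g i) :=
  Finset.sum_induction g (IsDecaying I b s) (fun _ _ => add) (zero b s) h

theorem fwdDiff_iter_mem {b s : ℕ} {g : ℕ → D} (h : IsDecaying I b s g) (j : ℕ) :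
    (fwdDiff 1)^[b] g j ∈ I ^ (b + s) := by
  induction b generalizing s g with
  | zero => simpa using h j
  | succ b ih =>
    rw [Function.iterate_succ_apply, show b + 1 + s = b + (s + 1) by ring]
    exact ih h.2

end IsDecaying

section Decaying

variable {D : Type*} [CommRing D] (I : Ideal D)

/-- The ring of sequences `g` with `Δⁱ g` valued in `Iⁱ` for all `i`. -/
def decayingSubring : Subring (ℕ → D) where
  carrier := {g | ∀ b, IsDecaying I b 0 g}
  zero_mem' b := IsDecaying.zero b 0
  one_mem' b := IsDecaying.const (by simp) b
  add_mem' hg hh b := (hg b).add (hh b)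
  mul_mem' hg hh b := (hg b).mul (hh b)
  neg_mem' {g} hg b := by
    have := (IsDecaying.const (I := I) (s := 0) (d := -1) (by simp) b).mul (hg b)
    convert this using 1
    ext; simp

/-- The ring of sequences `g` with `Δⁱ g` valued in `Iⁱ⁺¹` for all `i > 0`. -/
def strictlyDecayingSubring : Subring (ℕ → D) where
  carrier := {g | g ∈ decayingSubring I ∧ ∀ b, IsDecaying I b 2 (fwdDiff 1 g)}
  zero_mem' := ⟨zero_mem _, fun b => by
    have : fwdDiff 1 (0 : ℕ → D) = 0 := by ext; simp [fwdDiff]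
    rw [this]; exact IsDecaying.zero b 2⟩
  one_mem' := ⟨one_mem _, fun b => by
    have : fwdDiff 1 (1 : ℕ → D) = 0 := by ext; simp [fwdDiff]
    rw [this]; exact IsDecaying.zero b 2⟩
  add_mem' hg hh := ⟨add_mem hg.1 hh.1, fun b => by rw [fwdDiff_add]; exact (hg.2 b).add (hh.2 b)⟩
  mul_mem' {g h} hg hh := ⟨mul_mem hg.1 hh.1, fun b => by
    have : fwdDiff 1 (g * h) = fwdDiff 1 g * (fun j => h (j + 1)) + g * fwdDiff 1 h := by
      ext j; simp [fwdDiff]; ring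
    rw [this]
    refine IsDecaying.add ?_ ?_
    · exact (hg.2 b).mul (hh.1 b).shift
    · simpa using (hg.1 b).mul (hh.2 b)⟩
  neg_mem' {g} hg := ⟨neg_mem hg.1, fun b => by
    have := (IsDecaying.const (I := I) (s := 0) (d := -1) (by simp) b).mul (hg.2 b)
    rw [zero_add] at this
    convert this using 1
    ext; simp [fwdDiff]; ring⟩

theorem const_mem_decayingSubring (d : D) : (fun _ => d) ∈ decayingSubring I :=
  fun b => IsDecaying.const (by simp) b

theorem const_mem_strictlyDecayingSubring (d : D) : (fun _ => d) ∈ strictlyDecayingSubring I :=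
  ⟨const_mem_decayingSubring I d, fun b => by rw [fwdDiff_const]; exact IsDecaying.zero b 2⟩

/-- The first difference is the constant M and the later ones vanish. Strict decay asks the first
difference to lie in I², which explains the hypothesis on M. -/
theorem linear_mem_strictlyDecayingSubring {M : ℕ} (hM : (M : D) ∈ I ^ 2) (r : ℕ) :
    (fun j : ℕ => ((r + M * j : ℕ) : D)) ∈ strictlyDecayingSubring I := by
  have h : fwdDiff 1 (fun j : ℕ => ((r + M * j : ℕ) : D)) = fun _ => (M : D) := by
    ext j; simp [fwdDiff]; ring
  refine ⟨fun b => ?_, fun b => by rw [h]; exact IsDecaying.const hM b⟩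
  cases b with
  | zero => exact fun j => by simp
  | succ b =>
    refine ⟨fun j => by simp, ?_⟩
    rw [h]
    exact (IsDecaying.const hM b).weaken (by norm_num)

theorem eval_mem_subring (W : Subring (ℕ → D)) (hW : ∀ d : D, (fun _ => d) ∈ W) {x : ℕ → D}
    (hx : x ∈ W) (P : D[X]) : (fun j => P.eval (x j)) ∈ W := by
  induction P using Polynomial.induction_on' with
  | add p q hp hq =>
    convert add_mem hp hq using 1
    ext j; simp
  | monomial n a =>
    have := mul_mem (hW a) (pow_mem hx n)
    convert this using 1
    ext j; simp

theorem mvEval_mem_subring {ι : Type*} (W : Subring (ℕ → D)) (hW : ∀ d : D, (fun _ => d) ∈ W)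
    {x : ι → ℕ → D} (hx : ∀ i, x i ∈ W) (P : MvPolynomial ι D) :
    (fun j => MvPolynomial.eval (fun i => x i j) P) ∈ W := by
  induction P using MvPolynomial.induction_on with
  | C a => simpa using hW a
  | add p q hp hq =>
    convert add_mem hp hq using 1
    ext j; simp
  | mul_X p i hp =>
    convert mul_mem hp (hx i) using 1
    ext j; simp

end Decaying


/-! ### Transition matrices along progressions and a Skolem-Mahler-Lech theorem -/

/-- The product `u (a + q - 1) ⋯ u (a + 1) u a`. -/
def intervalProd {G : Type*} [Monoid G] (u : ℕ → G) (a : ℕ) : ℕ → G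
  | 0 => 1
  | q + 1 => u (a + q) * intervalProd u a q

theorem map_intervalProd {G H : Type*} [Monoid G] [Monoid H] (φ : G →* H) (u : ℕ → G) (a q : ℕ) :
    φ (intervalProd u a q) = intervalProd (fun i => φ (u i)) a q := by
  induction q with
  | zero => exact map_one φ
  | succ q ih => rw [intervalProd, map_mul, ih, intervalProd]

theorem intervalProd_add {G : Type*} [Monoid G] (u : ℕ → G) (a q r : ℕ) :
    intervalProd u a (q + r) = intervalProd u (a + q) r * intervalProd u a q := by
  induction r with
  | zero => simp [intervalProd]
  | succ r ih => rw [← add_assoc, intervalProd, ih, intervalProd, mul_assoc, add_assoc]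

/-- The product over e full periods from 0 is the e-th power of the product over one, so the order
of the latter serves as e. A product of the same length from another start is conjugate to it. -/
theorem exists_intervalProd_eq_one {G : Type*} [Group G] [Finite G] {u : ℕ → G} {N : ℕ}
    (hu : ∀ a, u (a + N) = u a) : ∃ e, 0 < e ∧ ∀ a, intervalProd u a (N * e) = 1 := by
  have h1 : ∀ a q, intervalProd u (a + N) q = intervalProd u a q := by
    intro a q
    induction q with
    | zero => rfl
    | succ q ih => rw [intervalProd, intervalProd, ih, show a + N + q = a + q + N by ring, hu]
  have h2 : ∀ a e, intervalProd u a (N * e) = intervalProd u a N ^ e := by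
    intro a e
    induction e with
    | zero => simp [intervalProd]
    | succ e ih => rw [mul_add_one, add_comm, intervalProd_add, h1, ih, pow_succ]
  have h3 : ∀ a e, intervalProd u (0 + a) (N * e) * intervalProd u 0 a
      = intervalProd u 0 a * intervalProd u 0 (N * e) := by
    intro a e
    have h4 : intervalProd u (0 + N * e) a = intervalProd u 0 a := by
      induction e with
      | zero => rfl
      | succ e ih => rw [mul_add_one, ← add_assoc, h1, ih]
    rw [← intervalProd_add, add_comm, intervalProd_add, h4]
  refine ⟨orderOf (intervalProd u 0 N), orderOf_pos _, fun a => ?_⟩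
  have := h3 a (orderOf (intervalProd u 0 N))
  rw [h2 0, pow_orderOf_eq_one, mul_one, zero_add] at this
  exact mul_eq_right.1 this

section Core

variable {D : Type*} [CommRing D] {n : ℕ}

/-- The value of a matrix of polynomials at a natural number. -/
def matEval (A : Matrix (Fin n) (Fin n) D[X]) (a : ℕ) : Matrix (Fin n) (Fin n) D :=
  A.map (Polynomial.eval (a : D))

theorem matEval_mul (A B : Matrix (Fin n) (Fin n) D[X]) (a : ℕ) :
    matEval (A * B) a = matEval A a * matEval B a :=
  Matrix.map_mul (f := Polynomial.evalRingHom (a : D))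

theorem matEval_one (a : ℕ) : matEval (1 : Matrix (Fin n) (Fin n) D[X]) a = 1 :=
  Matrix.map_one _ (by simp) (by simp)

/-- Modulo I the value of A at a depends only on a modulo N = |D/I²|, and it is invertible since A
has a polynomial inverse. The finite group GLₙ(D/I) then makes products over suitable multiples of N
trivial. -/
theorem exists_intervalProd_matEval_map_eq_one (I : Ideal D) [Finite (D ⧸ I)] [Finite (D ⧸ I ^ 2)]
    {A A' : Matrix (Fin n) (Fin n) D[X]} (hA : A * A' = 1) :
    ∃ M : ℕ, 0 < M ∧ (M : D) ∈ I ^ 2 ∧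
      ∀ a, (intervalProd (matEval A) a M).map (Ideal.Quotient.mk I) = 1 := by
  set φ : Matrix (Fin n) (Fin n) D →+* Matrix (Fin n) (Fin n) (D ⧸ I) :=
    (Ideal.Quotient.mk I).mapMatrix
  have hinv : ∀ a, φ (matEval A a) * φ (matEval A' a) = 1 := by
    intro a
    rw [← map_mul, ← matEval_mul, hA, matEval_one, map_one]
  set u : ℕ → (Matrix (Fin n) (Fin n) (D ⧸ I))ˣ := fun a =>
    ⟨φ (matEval A a), φ (matEval A' a), hinv a, mul_eq_one_comm.1 (hinv a)⟩ with hu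
  -- The cardinality of D/I², not of D/I, since the step M must lie in I².
  set N := Nat.card (D ⧸ I ^ 2) with hN
  have hNpos : 0 < N := Nat.card_pos
  have hNI : (N : D) ∈ I ^ 2 := by
    rw [← Ideal.Quotient.eq_zero_iff_mem, map_natCast]
    have := card_nsmul_eq_zero' (G := D ⧸ I ^ 2) (x := 1)
    rwa [nsmul_eq_mul, mul_one] at this
  have hper : ∀ a, u (a + N) = u a := by
    intro a
    ext i j
    have hcast : Ideal.Quotient.mk I ((a + N : ℕ) : D) = Ideal.Quotient.mk I (a : D) := by
      rw [Ideal.Quotient.eq]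
      simpa using Ideal.pow_le_self two_ne_zero hNI
    change Ideal.Quotient.mk I ((A i j).eval ((a + N : ℕ) : D)) =
      Ideal.Quotient.mk I ((A i j).eval (a : D))
    rw [← Polynomial.eval₂_at_apply, ← Polynomial.eval₂_at_apply, hcast]
  obtain ⟨e, he, h⟩ := exists_intervalProd_eq_one hper
  refine ⟨N * e, Nat.mul_pos hNpos he, ?_, fun a => ?_⟩
  · push_cast
    exact Ideal.mul_mem_right _ _ hNI
  · have h1 := congrArg (Units.coeHom _) (h a)
    rw [map_intervalProd, map_one] at h1
    have h2 := map_intervalProd φ.toMonoidHom (matEval A) a (N * e)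
    exact h2.trans h1

/-- As a function of t the entry is a polynomial in linear sequences of step M, so the subring
property suffices. -/
theorem intervalProd_matEval_mem (I : Ideal D) (A : Matrix (Fin n) (Fin n) D[X]) {M : ℕ}
    (hM : (M : D) ∈ I ^ 2) (r q : ℕ) (i j : Fin n) :
    (fun t => intervalProd (matEval A) (r + M * t) q i j) ∈ strictlyDecayingSubring I := by
  induction q generalizing i j with
  | zero => exact const_mem_strictlyDecayingSubring I ((1 : Matrix (Fin n) (Fin n) D) i j)
  | succ q ih =>
    have h1 : ∀ l, (fun t : ℕ => (A i l).eval (((r + q) + M * t : ℕ) : D)) ∈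
        strictlyDecayingSubring I := fun l =>
      eval_mem_subring _ (const_mem_strictlyDecayingSubring I)
        (linear_mem_strictlyDecayingSubring I hM (r + q)) (A i l)
    have := sum_mem (S := strictlyDecayingSubring I) (t := Finset.univ)
      fun l _ => mul_mem (h1 l) (ih l j)
    convert this using 1
    ext t
    simp [intervalProd, Matrix.mul_apply, matEval, add_right_comm]

/-- The entries of a solution of a difference system along a suitable arithmetic progression have
rapidly decreasing differences. -/
theorem solution_mem_decayingSubring (I : Ideal D) (A : Matrix (Fin n) (Fin n) D[X]) {M : ℕ}
    (hM : (M : D) ∈ I ^ 2)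
    (hA : ∀ a, (intervalProd (matEval A) a M).map (Ideal.Quotient.mk I) = 1) (b : ℕ)
    {B : ℕ → Matrix (Fin n) (Fin n) D} (hB : ∀ i, B (i + 1) = matEval A (b + i) * B i)
    (r : ℕ) (i j : Fin n) : (fun t => B (r + M * t) i j) ∈ decayingSubring I := by
  have hBq : ∀ i q, B (i + q) = intervalProd (matEval A) (b + i) q * B i := by
    intro i q
    induction q with
    | zero => simp [intervalProd]
    | succ q ih => rw [← add_assoc, hB, ih, intervalProd, mul_assoc, add_assoc]
  -- With E the M-step transition matrix minus 1, the differences along the progression satisfy ΔB =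
  -- E·B. Since E is zero modulo I and its differences decay strictly, E decays one power faster
  -- than required.
  set E : Fin n → Fin n → ℕ → D := fun i j t =>
    intervalProd (matEval A) (b + r + M * t) M i j - (1 : Matrix (Fin n) (Fin n) D) i j with hE
  have hEdec : ∀ i j c, IsDecaying I c 1 (E i j) := by
    intro i j c
    have hmem : E i j ∈ strictlyDecayingSubring I :=
      sub_mem (intervalProd_matEval_mem I A hM (b + r) M i j)
        (const_mem_strictlyDecayingSubring I _)
    have hI : ∀ t, E i j t ∈ I ^ 1 := by
      intro t
      rw [pow_one, ← Ideal.Quotient.eq_zero_iff_mem]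
      have := congrFun (congrFun (hA (b + r + M * t)) i) j
      rw [Matrix.map_apply] at this
      simp only [hE, map_sub, this, Matrix.one_apply]
      split_ifs <;> simp
    cases c with
    | zero => exact hI
    | succ c => exact ⟨hI, hmem.2 c⟩
  have hdiff : ∀ i j, fwdDiff 1 (fun t => B (r + M * t) i j) =
      ∑ l, E i l * fun t => B (r + M * t) l j := by
    intro i j
    ext t
    have h1 : B (r + M * (t + 1)) = intervalProd (matEval A) (b + r + M * t) M * B (r + M * t) := by
      rw [mul_add_one, ← add_assoc, hBq, add_assoc b]
    simp only [fwdDiff, Finset.sum_apply, Pi.mul_apply, hE, sub_mul, Finset.sum_sub_distrib]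
    rw [h1, Matrix.mul_apply, ← Matrix.mul_apply (M := 1), Matrix.one_mul]
  -- Every further difference brings in a factor E, hence one more power of I.
  intro c
  induction c generalizing i j with
  | zero => exact fun t => by simp
  | succ c ih =>
    refine ⟨fun t => by simp, ?_⟩
    rw [hdiff]
    refine IsDecaying.sum _ fun l _ => ?_
    simpa using (hEdec i l c).mul (ih l j)

/-- A Skolem-Mahler-Lech theorem over a finitely generated domain of characteristic zero. -/
theorem exists_period_of_isDomain [IsDomain D] [CharZero D] [Algebra.FiniteType ℤ D]
    {A A' : Matrix (Fin n) (Fin n) D[X]} (hA : A * A' = 1) (b : ℕ)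
    {B : ℕ → Matrix (Fin n) (Fin n) D} (hB : ∀ i, B (i + 1) = matEval A (b + i) * B i) :
    ∃ M : ℕ, 0 < M ∧ ∀ P : MvPolynomial (Option (Fin n × Fin n)) D, ∃ N, ∀ i ≥ N,
      (MvPolynomial.eval (fun o => o.elim ((b + i : ℕ) : D) fun p => B i p.1 p.2) P = 0 ↔
      MvPolynomial.eval (fun o => o.elim ((b + (i + M) : ℕ) : D) fun p => B (i + M) p.1 p.2) P
        = 0) := by
  have : IsNoetherianRing D := Algebra.FiniteType.isNoetherianRing ℤ D
  obtain ⟨m, hm⟩ := Ideal.exists_maximal D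
  have hfin := finite_quotient_of_isMaximal m
  obtain ⟨p, hp⟩ := CharP.exists (D ⧸ m)
  have hp0 : p ≠ 0 := by
    rintro rfl
    have : CharZero (D ⧸ m) := CharP.charP_to_charZero _
    exact not_injective_infinite_finite _ (Nat.cast_injective (R := D ⧸ m))
  have hpp : Fact p.Prime := ⟨(CharP.char_is_prime_or_zero (D ⧸ m) p).resolve_right hp0⟩
  have hpm : (p : D) ∈ m := by
    rw [← Ideal.Quotient.eq_zero_iff_mem, map_natCast, CharP.cast_eq_zero]
  obtain ⟨c, hc⟩ := exists_mem_pow_of_natCast_mul_mem_pow m hpm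
  -- The exponent c + 1 outweighs the loss c·v_p(i!) caused by the denominators of Newton's formula.
  obtain ⟨I, hI⟩ : ∃ I, I = m ^ (c + 1) := ⟨_, rfl⟩
  have : Finite (D ⧸ I) := by
    rw [hI]
    exact Ideal.finite_quotient_pow (IsNoetherian.noetherian m) _
  have : Finite (D ⧸ I ^ 2) := by
    rw [hI, ← pow_mul]
    exact Ideal.finite_quotient_pow (IsNoetherian.noetherian m) _
  obtain ⟨M, hM0, hM, hone⟩ := exists_intervalProd_matEval_map_eq_one I hA
  refine ⟨M, hM0, fun P => ?_⟩
  set f : ℕ → D := fun i =>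
    MvPolynomial.eval (fun o => o.elim ((b + i : ℕ) : D) fun p => B i p.1 p.2) P with hf
  have hdec : ∀ r, (fun t => f (r + M * t)) ∈ decayingSubring I := by
    intro r
    have key : ∀ o : Option (Fin n × Fin n), (fun t : ℕ => (o.elim ((b + (r + M * t) : ℕ) : D)
        fun p => B (r + M * t) p.1 p.2 : D)) ∈ decayingSubring I := by
      rintro (_ | ⟨i, j⟩)
      · have := (linear_mem_strictlyDecayingSubring I hM (b + r)).1
        simpa only [Option.elim, add_assoc] using this
      · exact solution_mem_decayingSubring I A hM hone b hB r i j
    exact mvEval_mem_subring _ (const_mem_decayingSubring I) key P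
  -- On each progression f has only finitely many zeros or vanishes identically. M comes from A
  -- alone, so it serves all P.
  have hdich : ∀ r, ∃ N, ∀ t ≥ N, (f (r + M * t) = 0 ↔ f (r + M * (t + 1)) = 0) := by
    intro r
    by_cases hinf : {t | f (r + M * t) = 0}.Infinite
    · have := eq_zero_of_infinite_zeros m hc (fun t => f (r + M * t))
        (fun i => hI ▸ (hdec r i).fwdDiff_iter_mem 0) hinf
      exact ⟨0, fun t _ => by simp only [this]⟩
    · rw [Set.not_infinite] at hinf
      obtain ⟨N, hN⟩ := hinf.bddAbove
      refine ⟨N + 1, fun t ht => ?_⟩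
      constructor
      · intro h; have := hN h; omega
      · intro h; have := hN h; omega
  choose N hN using hdich
  refine ⟨M * (∑ r ∈ Finset.range M, N r + 1), fun i hi => ?_⟩
  have hr := Nat.mod_lt i hM0
  have hle : N (i % M) ≤ i / M := by
    rw [Nat.le_div_iff_mul_le hM0, mul_comm]
    refine le_trans (Nat.mul_le_mul_left M ?_) hi
    exact (Finset.single_le_sum (fun _ _ => Nat.zero_le _) (Finset.mem_range.2 hr)).trans
      (Nat.le_succ _)
  have := hN (i % M) (i / M) hle
  rwa [mul_add_one, ← add_assoc, Nat.mod_add_div] at this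

end Core

/-! ### Eventually periodic sets -/

/-- Membership in `S` of large numbers is invariant under adding `m`. -/
def IsEventuallyPeriodic (m : ℕ) (S : Set ℕ) : Prop := ∃ N, ∀ i ≥ N, (i ∈ S ↔ i + m ∈ S)

namespace IsEventuallyPeriodic

theorem add_mul {m : ℕ} {S : Set ℕ} {N : ℕ} (h : ∀ i ≥ N, (i ∈ S ↔ i + m ∈ S)) {i : ℕ}
    (hi : N ≤ i) (t : ℕ) : i ∈ S ↔ i + t * m ∈ S := by
  induction t with
  | zero => simp
  | succ t ih => rw [ih, h _ (by omega), add_one_mul, add_assoc]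

theorem mul {m : ℕ} {S : Set ℕ} (h : IsEventuallyPeriodic m S) (t : ℕ) :
    IsEventuallyPeriodic (t * m) S :=
  let ⟨N, hN⟩ := h
  ⟨N, fun _ hi => add_mul hN hi t⟩

theorem union {m : ℕ} {S T : Set ℕ} (hS : IsEventuallyPeriodic m S)
    (hT : IsEventuallyPeriodic m T) : IsEventuallyPeriodic m (S ∪ T) := by
  obtain ⟨N, hN⟩ := hS
  obtain ⟨N', hN'⟩ := hT
  exact ⟨max N N', fun i hi => or_congr (hN i (le_of_max_le_left hi))
    (hN' i (le_of_max_le_right hi))⟩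

/-- Below the threshold N the members of S are single points, of period 0; above it, the members in
[N, N + m) start progressions of period m. -/
theorem isFiniteUnionAPOfPeriodLE {m : ℕ} (hm : 0 < m) {S : Set ℕ}
    (h : IsEventuallyPeriodic m S) : IsFiniteUnionAPOfPeriodLE m S := by
  classical
  obtain ⟨N, hN⟩ := h
  refine ⟨((Finset.range N).filter (· ∈ S)).image (fun i => (i, 0)) ∪
    ((Finset.Ico N (N + m)).filter (· ∈ S)).image (fun i => (i, m)), ?_, ?_⟩
  · intro p hp
    simp only [Finset.mem_union, Finset.mem_image] at hp
    rcases hp with ⟨_, _, rfl⟩ | ⟨_, _, rfl⟩ <;> simp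
  · ext i
    simp only [Set.mem_iUnion, exists_prop, Finset.mem_union, Finset.mem_image, Finset.mem_filter,
      Finset.mem_range, Finset.mem_Ico]
    constructor
    · intro hi
      by_cases hiN : i < N
      · exact ⟨(i, 0), Or.inl ⟨i, ⟨hiN, hi⟩, rfl⟩, 0, by simp⟩
      · have hlt := Nat.mod_lt (i - N) hm
        have heq : i = N + (i - N) % m + (i - N) / m * m := by
          have := Nat.mod_add_div' (i - N) m
          omega
        refine ⟨(N + (i - N) % m, m), Or.inr ⟨_, ⟨⟨by omega, by omega⟩, ?_⟩, rfl⟩,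
          (i - N) / m, heq⟩
        rw [heq] at hi
        exact (add_mul hN (by omega) _).2 hi
    · rintro ⟨p, ⟨j, ⟨hj, hjS⟩, rfl⟩ | ⟨j, ⟨hj, hjS⟩, rfl⟩, t, rfl⟩
      · simpa using hjS
      · exact (add_mul hN hj.1 t).1 hjS

end IsEventuallyPeriodic

theorem IsFiniteUnionAPOfPeriodLE.isFiniteUnionAP {m : ℕ} {S : Set ℕ}
    (h : IsFiniteUnionAPOfPeriodLE m S) : IsFiniteUnionAP S :=
  let ⟨s, _, hs⟩ := h
  ⟨s, hs⟩

theorem IsFiniteUnionAP.exists_isEventuallyPeriodic {S : Set ℕ} (h : IsFiniteUnionAP S) :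
    ∃ m, 0 < m ∧ IsEventuallyPeriodic m S := by
  classical
  obtain ⟨s, rfl⟩ := h
  induction s using Finset.induction_on with
  | empty => exact ⟨1, one_pos, 0, by simp⟩
  | insert p s _ ih =>
    obtain ⟨m, hm, h⟩ := ih
    rw [Finset.set_biUnion_insert]
    obtain ⟨j, q⟩ := p
    have hq : ∃ q', 0 < q' ∧ IsEventuallyPeriodic q' (arithProg j q) := by
      rcases Nat.eq_zero_or_pos q with rfl | hq
      · refine ⟨1, one_pos, j + 1, fun i hi => ?_⟩
        simp only [arithProg, Set.mem_ofPred_eq, mul_zero, add_zero, exists_const]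
        omega
      · refine ⟨q, hq, j, fun i hi => ⟨?_, ?_⟩⟩
        · rintro ⟨t, rfl⟩
          exact ⟨t + 1, by ring⟩
        · rintro ⟨t, ht⟩
          cases t with
          | zero => omega
          | succ t => exact ⟨t, by rw [add_one_mul] at ht; omega⟩
    obtain ⟨q', hq', h'⟩ := hq
    have h2 := h.mul q'
    rw [mul_comm] at h2
    exact ⟨m * q', Nat.mul_pos hm hq', (h'.mul m).union h2⟩

/-! ### Orbits of polynomial systems with polynomial inverse -/

theorem IsClosedSubvariety.exists_finset {k : Type*} [Field k] {n : ℕ} {Y : Set (Point k n)}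
    (hY : IsClosedSubvariety Y) : ∃ T : Finset (MvPolynomial (Option (Fin n × Fin n)) k),
      Y = {x | ∀ p ∈ T, MvPolynomial.eval (coord x) p = 0} := by
  obtain ⟨S, rfl⟩ := hY
  obtain ⟨T, hTS, hT⟩ := (Submodule.fg_span_iff_fg_span_finset_subset S).1
    (IsNoetherian.noetherian (Ideal.span S))
  refine ⟨T, Set.ext fun x => ⟨fun h p hp => h p (hTS hp), fun h p hp => ?_⟩⟩
  have h1 : Ideal.span (T : Set (MvPolynomial (Option (Fin n × Fin n)) k)) ≤
      RingHom.ker (MvPolynomial.eval (coord x)) := Ideal.span_le.2 h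
  have h2 : p ∈ Submodule.span _ S := Ideal.subset_span hp
  rw [hT] at h2
  exact h1 h2

theorem ev_algebraMap {k : Type*} [Field k] (p : k[X]) (a : k) :
    ev (algebraMap k[X] (RatFunc k) p) a = p.eval a := by
  simp [ev]

theorem exists_map_matrix_eq {k : Type*} [Field k] {D : Subalgebra ℤ k} {n : ℕ}
    {A : Matrix (Fin n) (Fin n) k[X]} (hA : ∀ i j c, (A i j).coeff c ∈ D) :
    ∃ A' : Matrix (Fin n) (Fin n) D[X], A'.map (Polynomial.map (algebraMap D k)) = A := by
  have : ∀ i j, ∃ q : D[X], q.map (algebraMap D k) = A i j := fun i j => by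
    rw [← Polynomial.mem_lifts, Polynomial.lifts_iff_coeff_lifts]
    exact fun c => ⟨⟨_, hA i j c⟩, rfl⟩
  choose A' hA' using this
  exact ⟨Matrix.of A', by ext1 i j; exact hA' i j⟩

/-- If `A` and its inverse have polynomial entries, every orbit meets every closed subvariety in a
finite union of arithmetic progressions. -/
theorem orbitConditionAll_of_polynomial {k : Type*} [Field k] [CharZero k] {n : ℕ}
    {A : Matrix (Fin n) (Fin n) (RatFunc k)} {A₁ A₂ : Matrix (Fin n) (Fin n) k[X]}
    (hA : A = A₁.map (algebraMap k[X] (RatFunc k))) (h12 : A₁ * A₂ = 1) :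
    OrbitConditionAll A := by
  classical
  rintro x o ⟨b, hb⟩ ⟨ho0, ho⟩ Y hY
  obtain ⟨T, rfl⟩ := hY.exists_finset
  -- All the finitely many scalars involved: the coefficients of the matrix and its inverse, those
  -- of the equations of Y, and the entries of the initial matrix.
  set s : Set k := ((⋃ i, ⋃ j, ((A₁ i j).coeffs : Set k)) ∪ (⋃ i, ⋃ j, ((A₂ i j).coeffs : Set k))) ∪
    ((⋃ p ∈ T, (p.coeffs : Set k)) ∪
      Set.range fun q : Fin n × Fin n => (x.2 : Matrix (Fin n) (Fin n) k) q.1 q.2) with hs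
  have hsfin : s.Finite := by
    refine ((Set.finite_iUnion fun i => Set.finite_iUnion fun j => Finset.finite_toSet _).union
      (Set.finite_iUnion fun i => Set.finite_iUnion fun j => Finset.finite_toSet _)).union
      ((T.finite_toSet.biUnion fun p _ => Finset.finite_toSet _).union (Set.finite_range _))
  set D : Subalgebra ℤ k := Algebra.adjoin ℤ s with hD
  have hsD : s ⊆ D := Algebra.subset_adjoin
  have : Algebra.FiniteType ℤ D := by
    rw [← Subalgebra.fg_iff_finiteType]
    exact Subalgebra.fg_def.2 ⟨s, hsfin, rfl⟩
  have hpoly : ∀ (P : Matrix (Fin n) (Fin n) k[X]),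
      (⋃ i, ⋃ j, ((P i j).coeffs : Set k)) ⊆ s → ∀ i j c, (P i j).coeff c ∈ D := by
    intro P hP i j c
    by_cases h0 : (P i j).coeff c = 0
    · rw [h0]; exact zero_mem _
    · exact hsD (hP (Set.mem_iUnion₂.2 ⟨i, j, Polynomial.coeff_mem_coeffs h0⟩))
  obtain ⟨A₁', hA₁'⟩ := exists_map_matrix_eq (hpoly A₁ fun _ h => Or.inl (Or.inl h))
  obtain ⟨A₂', hA₂'⟩ := exists_map_matrix_eq (hpoly A₂ fun _ h => Or.inl (Or.inr h))
  have hinj : Function.Injective (algebraMap D k) := Subtype.val_injective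
  have h12' : A₁' * A₂' = 1 := by
    have hφ : Function.Injective (Polynomial.mapRingHom (algebraMap D k)).mapMatrix :=
      Matrix.map_injective (m := Fin n) (n := Fin n) (Polynomial.map_injective _ hinj)
    apply hφ
    rw [map_mul, map_one]
    exact (congrArg₂ (· * ·) hA₁' hA₂').trans h12
  have hT' : ∀ p ∈ T, ∃ p' : MvPolynomial (Option (Fin n × Fin n)) D,
      MvPolynomial.map (algebraMap D k) p' = p := by
    intro p hp
    refine MvPolynomial.mem_range_map_iff_coeffs_subset.2 fun c hc => ⟨⟨c, hsD ?_⟩, rfl⟩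
    exact Or.inr (Or.inl (Set.mem_iUnion₂.2 ⟨p, hp, hc⟩))
  have hstep : ∀ i, (o (i + 1)).1 = (o i).1 + 1 ∧
      ((o (i + 1)).2 : Matrix (Fin n) (Fin n) k) = evMatrix A (o i).1 * (o i).2 := by
    intro i
    obtain ⟨_, h⟩ := ho i
    rw [← h]
    exact ⟨rfl, rfl⟩
  have ho1 : ∀ i, (o i).1 = ((b + i : ℕ) : k) := by
    intro i
    induction i with
    | zero => rw [ho0, hb, add_zero]
    | succ i ih => rw [(hstep i).1, ih]; push_cast; ring
  set B₀ : Matrix (Fin n) (Fin n) D := Matrix.of fun i j =>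
    ⟨(x.2 : Matrix (Fin n) (Fin n) k) i j, hsD (Or.inr (Or.inr ⟨(i, j), rfl⟩))⟩ with hB₀
  set B : ℕ → Matrix (Fin n) (Fin n) D := fun i =>
    Nat.rec B₀ (fun i Bi => matEval A₁' (b + i) * Bi) i with hB
  have hBo : ∀ i, (B i).map (algebraMap D k) = (o i).2 := by
    intro i
    induction i with
    | zero => rw [ho0]; rfl
    | succ i ih =>
      rw [(hstep i).2, ← ih]
      change (matEval A₁' (b + i) * B i).map (algebraMap D k) = _
      rw [Matrix.map_mul]
      congr 1
      ext i' j'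
      rw [ho1]
      simp only [matEval, evMatrix, Matrix.map_apply, hA, ev_algebraMap]
      rw [← hA₁', Matrix.map_apply, ← map_natCast (algebraMap D k), Polynomial.eval_map_algebraMap,
        Polynomial.aeval_algebraMap_apply]
      simp
  obtain ⟨M, hM, hper⟩ := exists_period_of_isDomain h12' b (B := B) fun i => rfl
  have heval : ∀ (p' : MvPolynomial (Option (Fin n × Fin n)) D) (i : ℕ),
      MvPolynomial.eval (coord (o i)) (MvPolynomial.map (algebraMap D k) p') = algebraMap D k
        (MvPolynomial.eval (fun o => o.elim ((b + i : ℕ) : D) fun p => B i p.1 p.2) p') := by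
    intro p' i
    rw [MvPolynomial.eval_map]
    refine Eq.trans ?_ (MvPolynomial.eval₂_comp_left (algebraMap D k) (RingHom.id D) _ p').symm
    rw [RingHom.comp_id]
    congr 1
    funext q
    rcases q with _ | ⟨i', j'⟩
    · simp [coord, ho1]
    · simp only [coord, ← hBo, Matrix.map_apply, Option.elim]
      rfl
  refine (IsEventuallyPeriodic.isFiniteUnionAPOfPeriodLE hM ?_).isFiniteUnionAP
  have : ∀ p ∈ T, ∃ N, ∀ i ≥ N, (MvPolynomial.eval (coord (o i)) p = 0 ↔
      MvPolynomial.eval (coord (o (i + M))) p = 0) := by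
    intro p hp
    obtain ⟨p', rfl⟩ := hT' p hp
    obtain ⟨N, hN⟩ := hper p'
    refine ⟨N, fun i hi => ?_⟩
    rw [heval, heval, map_eq_zero_iff _ hinj, map_eq_zero_iff _ hinj]
    exact hN i hi
  choose! N hN using this
  refine ⟨∑ p ∈ T, N p, fun i hi => ?_⟩
  refine forall₂_congr fun p hp => hN p hp i ?_
  exact (Finset.single_le_sum (f := N) (fun _ _ => Nat.zero_le _) hp).trans hi

/-! ### Difference algebra -/

open scoped TensorProduct

/-- The kernels of the powers of f stabilise at some n. An element of ker f has the form fⁿ(y), so y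
lies in ker fⁿ⁺¹ = ker fⁿ. -/
theorem injective_of_surjective_of_isNoetherianRing {R : Type*} [CommRing R] [IsNoetherianRing R]
    (f : R →+* R) (hf : Function.Surjective f) : Function.Injective f := by
  have hmono : Monotone fun n : ℕ => RingHom.ker (f ^ n) := by
    refine monotone_nat_of_le_succ fun n x hx => ?_
    rw [RingHom.mem_ker] at hx ⊢
    rw [pow_succ', RingHom.mul_def, RingHom.comp_apply, hx, map_zero]
  obtain ⟨n, hn⟩ := monotone_stabilizes_iff_noetherian.2 ‹IsNoetherianRing R› ⟨_, hmono⟩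
  rw [injective_iff_map_eq_zero]
  intro x hx
  have hsurj : Function.Surjective (f ^ n) := by
    rw [RingHom.coe_pow]
    exact hf.iterate n
  obtain ⟨y, rfl⟩ := hsurj x
  have h1 : y ∈ RingHom.ker (f ^ (n + 1)) := by
    rw [RingHom.mem_ker, pow_succ', RingHom.mul_def, RingHom.comp_apply, hx]
  have h2 := hn (n + 1) (Nat.le_succ n)
  exact (SetLike.ext_iff.1 h2 y).2 h1

/-- Constants that are linearly independent over the field of constants `k` of a `σ`-simple ring
`L` are linearly independent over `L`. -/
theorem linearIndependent_of_isSigmaSimple {k L S ι : Type*} [Field k] [CommRing L] [CommRing S]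
    [Algebra k L] [Algebra L S] [Algebra k S] [IsScalarTower k L S] {σ : L →+* L} {σS : S →+* S}
    (hσS : ∀ a, σS (algebraMap L S a) = algebraMap L S (σ a)) (hσ : IsSigmaSimple σ)
    (hconst : ∀ x : L, σ x = x → ∃ c : k, algebraMap k L c = x) {v : ι → S}
    (hv : LinearIndependent k v) (hvσ : ∀ i, σS (v i) = v i) : LinearIndependent L v := by
  classical
  have hsmul : ∀ (a : L) (s : S), σS (a • s) = σ a • σS s := by
    intro a s
    rw [Algebra.smul_def, map_mul, hσS, ← Algebra.smul_def]
  rw [linearIndependent_iff']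
  intro s
  induction s using Finset.induction_on with
  | empty => simp
  | insert i₀ s hi₀ ih =>
    intro c hc
    rw [Finset.sum_insert hi₀] at hc
    -- The possible coefficients of v i₀ in relations supported on the finite set. They form a
    -- σ-ideal because the v i are constants, so σ-simplicity leaves two cases.
    let J : Ideal L :=
      { carrier := {a | ∃ c : ι → L, a • v i₀ + ∑ i ∈ s, c i • v i = 0}
        zero_mem' := ⟨0, by simp⟩
        add_mem' := by
          rintro a b ⟨c, hc⟩ ⟨d, hd⟩
          refine ⟨c + d, ?_⟩
          simp only [Pi.add_apply, add_smul, Finset.sum_add_distrib]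
          linear_combination hc + hd
        smul_mem' := by
          rintro a b ⟨c, hc⟩
          refine ⟨fun i => a * c i, ?_⟩
          simp only [smul_eq_mul, mul_smul, ← Finset.smul_sum, ← smul_add, hc, smul_zero] }
    have hJσ : ∀ x ∈ J, σ x ∈ J := by
      rintro a ⟨c, hc⟩
      refine ⟨fun i => σ (c i), ?_⟩
      have := congrArg σS hc
      simpa [hsmul, hvσ] using this
    rcases hσ.eq_bot_or_eq_top J hJσ with h | h
    · have h0 : c i₀ ∈ J := ⟨c, hc⟩
      rw [h, Ideal.mem_bot] at h0
      rw [h0, zero_smul, zero_add] at hc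
      intro i hi
      rcases Finset.mem_insert.1 hi with rfl | hi
      · exact h0
      · exact ih c hc i hi
    · obtain ⟨d, hd⟩ : (1 : L) ∈ J := by rw [h]; trivial
      have hd' := congrArg σS hd
      simp only [map_add, hsmul, hvσ, map_one, map_sum, map_zero] at hd'
      -- When the coefficient of v i₀ is normalised to 1, subtracting a relation from its σ-image
      -- shortens it. By induction all coefficients are then constants, against independence over k.
      have hsub : ∑ i ∈ s, (σ (d i) - d i) • v i = 0 := by
        simp only [sub_smul, Finset.sum_sub_distrib]
        linear_combination hd' - hd
      have hfix := ih _ hsub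
      have : ∀ i ∈ s, ∃ e : k, algebraMap k L e = d i := fun i hi =>
        hconst _ (sub_eq_zero.1 (hfix i hi))
      choose! e he using this
      exfalso
      have h1 := linearIndependent_iff'.1 hv (insert i₀ s) (fun i => if i = i₀ then 1 else e i) ?_ i₀
        (Finset.mem_insert_self _ _)
      · simp at h1
      · rw [Finset.sum_insert hi₀, if_pos rfl, ← hd]
        congr 1
        · simp
        · refine Finset.sum_congr rfl fun i hi => ?_
          rw [if_neg (ne_of_mem_of_not_mem hi hi₀), ← he i hi, algebraMap_smul]

universe u in
-- A k-basis of T is an R-basis of R ⊗ T, so a kernel element is an R-linear relation among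
-- k-independent elements of T.
theorem injective_productMap_of_linearIndependent {k R : Type*} {S : Type u} [Field k] [CommRing R] [CommRing S]
    [Algebra k R] [Algebra k S] (f : R →ₐ[k] S) (T : Subalgebra k S)
    (h : ∀ (ι : Type u) (v : ι → S), LinearIndependent k v → (∀ i, v i ∈ T) →
      ∀ (s : Finset ι) (c : ι → R), ∑ i ∈ s, f (c i) * v i = 0 → ∀ i ∈ s, c i = 0) :
    Function.Injective (Algebra.TensorProduct.productMap f T.val) := by
  obtain ⟨ι, ⟨b⟩⟩ : ∃ ι : Type u, Nonempty (Module.Basis ι k T) :=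
    ⟨_, ⟨Module.Basis.ofVectorSpace k T⟩⟩
  set B := Algebra.TensorProduct.basis R b with hB
  rw [injective_iff_map_eq_zero]
  intro x hx
  have hx' := B.linearCombination_repr x
  rw [Finsupp.linearCombination_apply, Finsupp.sum] at hx'
  rw [← hx', map_sum] at hx
  have hv : LinearIndependent k fun i => (b i : S) :=
    b.linearIndependent.map' T.val.toLinearMap (LinearMap.ker_eq_bot.2 Subtype.val_injective)
  have := h _ _ hv (fun i => (b i).2) (B.repr x).support (B.repr x) ?_
  · apply B.repr.injective
    rw [map_zero]
    ext i
    by_cases hi : i ∈ (B.repr x).support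
    · exact this i hi
    · exact Finsupp.notMem_support_iff.1 hi
  · rw [← hx]
    refine Finset.sum_congr rfl fun i _ => ?_
    rw [hB, Algebra.TensorProduct.basis_apply, TensorProduct.smul_tmul', smul_eq_mul, mul_one,
      Algebra.TensorProduct.productMap_apply_tmul]
    rfl

/-- If `S` contains two copies of a Noetherian ring `R` which generate each other over a
subalgebra `T`, and `T` is linearly disjoint from the first, then the second is faithful. -/
theorem injective_of_injective_productMap {k R S : Type*} [Field k] [CommRing R] [CommRing S]
    [Nontrivial S] [Algebra k R] [Algebra k S] [IsNoetherianRing R] (f g : R →ₐ[k] S)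
    (T : Subalgebra k S) [Algebra.FiniteType k T]
    (hinj : Function.Injective (Algebra.TensorProduct.productMap f T.val))
    (hg : ∀ r, g r ∈ (Algebra.TensorProduct.productMap f T.val).range)
    (hf : ∀ r, f r ∈ (Algebra.TensorProduct.productMap g T.val).range) :
    Function.Injective g := by
  set F := Algebra.TensorProduct.productMap f T.val
  set G := Algebra.TensorProduct.productMap g T.val
  have hTF : T ≤ F.range := fun t ht => ⟨1 ⊗ₜ ⟨t, ht⟩, by simp [F]⟩
  have hTG : T ≤ G.range := fun t ht => ⟨1 ⊗ₜ ⟨t, ht⟩, by simp [G]⟩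
  have hGF : ∀ x, G x ∈ F.range := by
    intro x
    induction x using TensorProduct.induction_on with
    | zero => rw [map_zero]; exact zero_mem _
    | tmul r t =>
      rw [Algebra.TensorProduct.productMap_apply_tmul]
      exact mul_mem (hg r) (hTF t.2)
    | add x y hx hy => rw [map_add]; exact add_mem hx hy
  have hFG : ∀ x, F x ∈ G.range := by
    intro x
    induction x using TensorProduct.induction_on with
    | zero => rw [map_zero]; exact zero_mem _
    | tmul r t =>
      rw [Algebra.TensorProduct.productMap_apply_tmul]
      exact mul_mem (hf r) (hTG t.2)
    | add x y hx hy => rw [map_add]; exact add_mem hx hy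
  let e := AlgEquiv.ofInjective F hinj
  -- Identifying R ⊗ T with the image of F turns G into an endomorphism of R ⊗ T, surjective because
  -- F and G have the same image. The Noetherian property makes it injective.
  let h : R ⊗[k] T →ₐ[k] R ⊗[k] T := e.symm.toAlgHom.comp (G.codRestrict F.range hGF)
  have hsurj : Function.Surjective h := by
    intro y
    obtain ⟨x, hx⟩ := hFG y
    refine ⟨x, e.injective (Subtype.ext ?_)⟩
    simp only [h, AlgHom.comp_apply]
    exact (congrArg Subtype.val (e.apply_symm_apply _)).trans hx
  have : IsNoetherianRing (R ⊗[k] T) := Algebra.FiniteType.isNoetherianRing R _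
  have hh : Function.Injective h :=
    injective_of_surjective_of_isNoetherianRing h.toRingHom hsurj
  have hGinj : Function.Injective G := by
    intro x y hxy
    apply hh
    simp only [h, AlgHom.comp_apply]
    congr 1
    exact Subtype.ext hxy
  have : Nontrivial T := ⟨⟨0, 1, fun h => zero_ne_one (congrArg Subtype.val h)⟩⟩
  intro x y hxy
  have h1 : G (x ⊗ₜ 1) = G (y ⊗ₜ 1) := by simp [G, hxy]
  exact Algebra.TensorProduct.includeLeft_injective (S := k)
    (FaithfulSMul.algebraMap_injective k T) (hGinj h1)

/-- Ring homomorphisms out of a tensor product. -/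
theorem exists_tensorProduct_ringHom {K L Q C : Type*} [CommRing K] [CommRing L] [CommRing Q]
    [CommRing C] [Algebra K L] [Algebra K Q] (f : L →+* C) (g : Q →+* C)
    (hfg : ∀ a, f (algebraMap K L a) = g (algebraMap K Q a)) :
    ∃ h : L ⊗[K] Q →+* C, ∀ a b, h (a ⊗ₜ b) = f a * g b := by
  let _ : Algebra K C := (f.comp (algebraMap K L)).toAlgebra
  let f' : L →ₐ[K] C := { f with commutes' := fun _ => rfl }
  let g' : Q →ₐ[K] C := { g with commutes' := fun a => (hfg a).symm }
  exact ⟨(Algebra.TensorProduct.productMap f' g').toRingHom, fun a b =>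
    Algebra.TensorProduct.productMap_apply_tmul f' g' a b⟩


/-! ### Rings generated by a fundamental matrix and descent of σ-simplicity -/

section Simple

/-- The entries of `Y` and the inverse of its determinant. -/
def glGenerators {R : Type*} [CommRing R] {n : ℕ} (Y : GL (Fin n) R) : Set R :=
  entries Y ∪ {(((Matrix.GeneralLinearGroup.det Y)⁻¹ : Rˣ) : R)}

theorem finite_glGenerators {R : Type*} [CommRing R] {n : ℕ} (Y : GL (Fin n) R) :
    (glGenerators Y).Finite := (Set.finite_range _).union (Set.finite_singleton _)

theorem image_glGenerators {R S : Type*} [CommRing R] [CommRing S] {n : ℕ} (f : R →+* S)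
    (Y : GL (Fin n) R) :
    f '' glGenerators Y = glGenerators (Matrix.GeneralLinearGroup.map f Y) := by
  have hdet : f (((Matrix.GeneralLinearGroup.det Y)⁻¹ : Rˣ) : R) =
      (((Matrix.GeneralLinearGroup.det (Matrix.GeneralLinearGroup.map f Y))⁻¹ : Sˣ) : S) := by
    have h : Units.map f.toMonoidHom (Matrix.GeneralLinearGroup.det Y) =
        Matrix.GeneralLinearGroup.det (Matrix.GeneralLinearGroup.map f Y) := by
      ext
      exact RingHom.map_det f _
    rw [← h, ← map_inv]
    rfl
  rw [glGenerators, glGenerators, Set.image_union, Set.image_singleton, hdet]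
  congr 1
  rw [entries, entries, ← Set.range_comp]
  rfl

theorem entry_mem_glGenerators {R : Type*} [CommRing R] {n : ℕ} (Y : GL (Fin n) R) (i j : Fin n) :
    (Y : Matrix (Fin n) (Fin n) R) i j ∈ glGenerators Y := Or.inl ⟨(i, j), rfl⟩

theorem glGenerators_mul_subset {R : Type*} [CommRing R] {n : ℕ} (X Y : GL (Fin n) R)
    (B : Subring R) (hX : glGenerators X ⊆ B) (hY : glGenerators Y ⊆ B) :
    glGenerators (X * Y) ⊆ B := by
  rintro _ (⟨⟨i, j⟩, rfl⟩ | rfl)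
  · simp only [Units.val_mul, Matrix.mul_apply]
    exact sum_mem fun l _ => mul_mem (hX (entry_mem_glGenerators X i l))
      (hY (entry_mem_glGenerators Y l j))
  · rw [map_mul, mul_inv, Units.val_mul]
    exact mul_mem (hX (Or.inr rfl)) (hY (Or.inr rfl))

/-- An entry of `Y⁻¹` is a cofactor of `Y` divided by the determinant. -/
theorem glGenerators_inv_subset {R : Type*} [CommRing R] {n : ℕ} (Y : GL (Fin n) R)
    (B : Subring R) (hY : glGenerators Y ⊆ B) : glGenerators Y⁻¹ ⊆ B := by
  have hent : ∀ i j, (Y : Matrix (Fin n) (Fin n) R) i j ∈ B :=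
    fun i j => hY (entry_mem_glGenerators Y i j)
  let Y' : Matrix (Fin n) (Fin n) B := fun i j => ⟨_, hent i j⟩
  have hY' : Y'.map B.subtype = (Y : Matrix (Fin n) (Fin n) R) := rfl
  rintro _ (⟨⟨i, j⟩, rfl⟩ | rfl)
  · have hadj : ((Y⁻¹ : GL (Fin n) R) : Matrix (Fin n) (Fin n) R) =
        (((Matrix.GeneralLinearGroup.det Y)⁻¹ : Rˣ) : R) •
          (Y : Matrix (Fin n) (Fin n) R).adjugate := by
      rw [Matrix.coe_units_inv, Matrix.inv_def]
      congr 1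
      rw [← Matrix.GeneralLinearGroup.val_det_apply, Ring.inverse_unit]
    change ((Y⁻¹ : GL (Fin n) R) : Matrix (Fin n) (Fin n) R) i j ∈ B
    rw [hadj]
    refine mul_mem (hY (Or.inr rfl)) ?_
    have := congrFun (congrFun (RingHom.map_adjugate B.subtype Y') i) j
    change B.subtype (Y'.adjugate i j) = (Y'.map B.subtype).adjugate i j at this
    rw [hY'] at this
    rw [← this]
    exact (Y'.adjugate i j).2
  · rw [map_inv, inv_inv]
    have := RingHom.map_det B.subtype Y'
    change B.subtype Y'.det = (Y'.map B.subtype).det at this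
    rw [hY'] at this
    change (Y : Matrix (Fin n) (Fin n) R).det ∈ B
    rw [← this]
    exact Y'.det.2

/-- Two fundamental matrices of the same system differ by a matrix of constants. -/
theorem map_inv_mul_eq_of_fundamental {S : Type*} [CommRing S] {n : ℕ} {σ : S →+* S}
    {M : Matrix (Fin n) (Fin n) S} {Y Y' : GL (Fin n) S}
    (hY : (Y : Matrix (Fin n) (Fin n) S).map σ = M * (Y : Matrix (Fin n) (Fin n) S))
    (hY' : (Y' : Matrix (Fin n) (Fin n) S).map σ = M * (Y' : Matrix (Fin n) (Fin n) S)) :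
    Matrix.GeneralLinearGroup.map σ (Y⁻¹ * Y') = Y⁻¹ * Y' := by
  let W := Matrix.GeneralLinearGroup.map σ Y * Y⁻¹
  have hWY : Matrix.GeneralLinearGroup.map σ Y = W * Y := by simp [W]
  have hW : (W : Matrix (Fin n) (Fin n) S) = M := by
    have : (W : Matrix (Fin n) (Fin n) S) * Y = M * Y := by
      rw [← Units.val_mul, ← hWY]; exact hY
    exact Y.isUnit.mul_right_cancel this
  have hWY' : Matrix.GeneralLinearGroup.map σ Y' = W * Y' := by
    apply Units.ext
    rw [Units.val_mul, hW]
    exact hY'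
  rw [map_mul, map_inv, hWY, hWY']
  simp

theorem map_apply_of_mem_glGenerators {S : Type*} [CommRing S] {n : ℕ} {σ : S →+* S}
    {X : GL (Fin n) S} (hX : Matrix.GeneralLinearGroup.map σ X = X) {x : S}
    (hx : x ∈ glGenerators X) : σ x = x := by
  rcases hx with ⟨⟨i, j⟩, rfl⟩ | rfl
  · exact congrArg (fun W : GL (Fin n) S => (W : Matrix (Fin n) (Fin n) S) i j) hX
  · have h1 : Units.map σ.toMonoidHom (Matrix.GeneralLinearGroup.det X) =
        Matrix.GeneralLinearGroup.det (Matrix.GeneralLinearGroup.map σ X) := by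
      ext
      exact RingHom.map_det σ _
    rw [hX] at h1
    exact congrArg (fun u : Sˣ => ((u⁻¹ : Sˣ) : S)) h1

variable {k K L R : Type*} [Field k] [Field K] [CommRing L] [CommRing R] [Algebra k K]
  [Algebra K L] [Algebra k L] [IsScalarTower k K L] [Algebra K R] [Algebra k R]
  [IsScalarTower k K R]

/-- A `σ`-ring generated by a fundamental matrix and its inverse determinant inside a `σ`-simple
ring without new constants is `σ`-simple. -/
theorem isSigmaSimple_of_generated {σK : K →+* K} {σ : L →+* L} {σR : R →+* R}
    (hσK : ∀ c : k, σK (algebraMap k K c) = algebraMap k K c)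
    (hσ : ∀ a, σ (algebraMap K L a) = algebraMap K L (σK a))
    (hσR : ∀ a, σR (algebraMap K R a) = algebraMap K R (σK a))
    (hconst : ∀ x : L, σ x = x → ∃ c : k, algebraMap k L c = x)
    (hsimple : IsSigmaSimple σ) (f : R →ₐ[K] L) (hf : Function.Injective f)
    (hfσ : ∀ x, f (σR x) = σ (f x)) {n : ℕ} {A : Matrix (Fin n) (Fin n) K} {Y : GL (Fin n) R}
    (hY : IsFundamentalMatrix σR A Y) (hgen : Algebra.adjoin K (glGenerators Y) = ⊤) :
    IsSigmaSimple σR := by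
  have hLnt := hsimple.nontrivial
  have hRnt : Nontrivial R := ⟨⟨0, 1, fun h => zero_ne_one (α := L) (by
    rw [← map_zero f, h, map_one])⟩⟩
  refine ⟨hRnt, fun I hI => or_iff_not_imp_right.2 fun hItop => ?_⟩
  have hQnt : Nontrivial (R ⧸ I) := Ideal.Quotient.nontrivial_iff.2 hItop
  have hRfin : Algebra.FiniteType K R :=
    ⟨Subalgebra.fg_def.2 ⟨_, finite_glGenerators Y, hgen⟩⟩
  have hRnoeth : IsNoetherianRing R := Algebra.FiniteType.isNoetherianRing K R
  let σQ : R ⧸ I →+* R ⧸ I := Ideal.quotientMap I σR (show I ≤ I.comap σR from hI)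
  -- S receives R in two ways: F through R ⊆ L, and G through R/I. The aim is injectivity of G,
  -- which forces I = 0.
  let S := L ⊗[K] (R ⧸ I)
  let iL : L →ₐ[K] S := Algebra.TensorProduct.includeLeft
  let iQ : R ⧸ I →ₐ[K] S := Algebra.TensorProduct.includeRight
  have hiQ : Function.Injective iQ := Algebra.TensorProduct.includeRight_injective
    (FaithfulSMul.algebraMap_injective K L)
  have hSnt : Nontrivial S := hiQ.nontrivial
  obtain ⟨σS, hσS⟩ := exists_tensorProduct_ringHom (K := K) (iL.toRingHom.comp σ)
    (iQ.toRingHom.comp σQ) (fun a => by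
      have h1 : σQ (algebraMap K (R ⧸ I) a) = algebraMap K (R ⧸ I) (σK a) := by
        change Ideal.Quotient.mk I (σR (algebraMap K R a)) = _
        rw [hσR]
        rfl
      change iL (σ (algebraMap K L a)) = iQ (σQ (algebraMap K (R ⧸ I) a))
      rw [hσ, h1, AlgHom.commutes, AlgHom.commutes])
  have hσL : ∀ a, σS (iL a) = iL (σ a) := fun a => by
    refine (hσS a 1).trans ?_
    rw [map_one, mul_one]; rfl
  have hσQ : ∀ a, σS (iQ a) = iQ (σQ a) := fun a => by
    refine (hσS 1 a).trans ?_
    rw [map_one, one_mul]; rfl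
  let F : R →ₐ[K] S := iL.comp f
  let G : R →ₐ[K] S := iQ.comp (Ideal.Quotient.mkₐ K I)
  have hF : ∀ r, σS (F r) = F (σR r) := fun r => (hσL _).trans (congrArg iL (hfσ r).symm)
  have hG : ∀ r, σS (G r) = G (σR r) := fun r => hσQ _
  let YF : GL (Fin n) S := Matrix.GeneralLinearGroup.map F.toRingHom Y
  let YG : GL (Fin n) S := Matrix.GeneralLinearGroup.map G.toRingHom Y
  let Z : GL (Fin n) S := YF⁻¹ * YG
  have hmap : ∀ H : R →ₐ[K] S, (∀ r, σS (H r) = H (σR r)) →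
      ((Matrix.GeneralLinearGroup.map H.toRingHom Y : GL (Fin n) S) : Matrix _ _ S).map σS =
        A.map (algebraMap K S) *
          ((Matrix.GeneralLinearGroup.map H.toRingHom Y : GL (Fin n) S) : Matrix _ _ S) := by
    intro H hH
    have h1 : (((Y : Matrix (Fin n) (Fin n) R).map H).map σS) =
        ((Y : Matrix (Fin n) (Fin n) R).map σR).map H := by
      ext i j; exact hH _
    have h2 : (A.map (algebraMap K R)).map H = A.map (algebraMap K S) := by
      ext i j; exact H.commutes _
    change (((Y : Matrix (Fin n) (Fin n) R).map H).map σS) = _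
    rw [h1, hY, Matrix.map_mul, h2]
    rfl
  have hZ : Matrix.GeneralLinearGroup.map σS Z = Z :=
    map_inv_mul_eq_of_fundamental (hmap F hF) (hmap G hG)
  -- The constants connecting the two copies. Z expresses G(R) through F(R), and its inverse is
  -- included to go back.
  let T : Subalgebra k S := Algebra.adjoin k (glGenerators Z ∪ glGenerators Z⁻¹)
  have hTZ : glGenerators Z ⊆ T.toSubring := fun x hx => Algebra.subset_adjoin (Or.inl hx)
  have hTZ' : glGenerators Z⁻¹ ⊆ T.toSubring := fun x hx => Algebra.subset_adjoin (Or.inr hx)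
  have hTfin : Algebra.FiniteType k T := by
    rw [← Subalgebra.fg_iff_finiteType]
    exact Subalgebra.fg_def.2 ⟨_, (finite_glGenerators Z).union (finite_glGenerators Z⁻¹), rfl⟩
  have hσSk : ∀ c : k, σS (algebraMap k S c) = algebraMap k S c := by
    intro c
    rw [IsScalarTower.algebraMap_apply k L S, IsScalarTower.algebraMap_apply k K L]
    exact (hσL _).trans (by rw [hσ, hσK]; rfl)
  have hTσ : ∀ t ∈ T, σS t = t := by
    intro t ht
    induction ht using Algebra.adjoin_induction with
    | mem x hx =>
      rcases hx with hx | hx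
      · exact map_apply_of_mem_glGenerators hZ hx
      · exact map_apply_of_mem_glGenerators (by rw [map_inv, hZ]) hx
    | algebraMap c => exact hσSk c
    | add x y _ _ hx hy => rw [map_add, hx, hy]
    | mul x y _ _ hx hy => rw [map_mul, hx, hy]
  have hmem : ∀ (H H' : R →ₐ[K] S) (B : Subring S) (V : GL (Fin n) S),
      Matrix.GeneralLinearGroup.map H.toRingHom Y =
        Matrix.GeneralLinearGroup.map H'.toRingHom Y * V → glGenerators V ⊆ B →
      (∀ r, H' r ∈ B) → ∀ r, H r ∈ B := by
    intro H H' B V hV hVB hH' r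
    have hr : r ∈ Algebra.adjoin K (glGenerators Y) := hgen ▸ Algebra.mem_top
    induction hr using Algebra.adjoin_induction with
    | mem x hx =>
      have h1 : H x ∈ H.toRingHom '' glGenerators Y := ⟨x, hx, rfl⟩
      rw [image_glGenerators, hV] at h1
      refine glGenerators_mul_subset _ _ B ?_ hVB h1
      rw [← image_glGenerators]
      rintro _ ⟨y, _, rfl⟩
      exact hH' y
    | algebraMap c =>
      rw [H.commutes, ← H'.commutes]
      exact hH' _
    | add x y _ _ hx hy => rw [map_add]; exact add_mem hx hy
    | mul x y _ _ hx hy => rw [map_mul]; exact mul_mem hx hy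
  have hGinj : Function.Injective (G.restrictScalars k) := by
    refine injective_of_injective_productMap (F.restrictScalars k) (G.restrictScalars k) T ?_ ?_ ?_
    · refine injective_productMap_of_linearIndependent _ T fun ι v hv hvT s c hc i hi => ?_
      have h1 := linearIndependent_of_isSigmaSimple (L := L) hσL hsimple hconst hv
        fun i => hTσ _ (hvT i)
      have h2 := linearIndependent_iff'.1 h1 s (fun i => f (c i)) ?_ i hi
      · exact (map_eq_zero_iff f hf).1 h2
      · rw [← hc]
        refine Finset.sum_congr rfl fun i _ => ?_
        rw [Algebra.smul_def]
        rfl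
    · refine hmem G F (Algebra.TensorProduct.productMap (F.restrictScalars k) T.val).range.toSubring
        Z (by simp [Z, YF, YG]) (fun z hz => ⟨1 ⊗ₜ ⟨z, hTZ hz⟩, by simp⟩)
        (fun r => ⟨r ⊗ₜ 1, by simp⟩)
    · refine hmem F G (Algebra.TensorProduct.productMap (G.restrictScalars k) T.val).range.toSubring
        Z⁻¹ (by simp [Z, YF, YG]) (fun z hz => ⟨1 ⊗ₜ ⟨z, hTZ' hz⟩, by simp⟩)
        (fun r => ⟨r ⊗ₜ 1, by simp⟩)
  rw [eq_bot_iff]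
  intro x hx
  apply hGinj
  rw [map_zero]
  change iQ (Ideal.Quotient.mk I x) = 0
  rw [Ideal.Quotient.eq_zero_iff_mem.2 hx, map_zero]

end Simple

/-! ### Existence and uniqueness of the period -/

theorem val_finRotate {l : ℕ} (i : Fin l) : ((finRotate l i : Fin l) : ℕ) = ((i : ℕ) + 1) % l := by
  cases l with
  | zero => exact i.elim0
  | succ l => rw [finRotate_apply, Fin.val_add, Fin.val_one']; simp

/-- A Noetherian `σ`-simple ring with bijective `σ` has a period. -/
theorem exists_isPeriod {R : Type*} [CommRing R] [IsNoetherianRing R] {σ : R →+* R}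
    (hbij : Function.Bijective σ) (hσ : IsSigmaSimple σ) : ∃ l, IsPeriod σ l := by
  have hnt := hσ.nontrivial
  obtain ⟨p, hp⟩ := Ideal.nonempty_minimalPrimes (I := (⊥ : Ideal R)) bot_ne_top
  -- The preimages of a minimal prime under powers of the automorphism σ are minimal primes. There
  -- are finitely many, so they form a cycle, and its length l is the period.
  let q : ℕ → Ideal R := fun j => p.comap (σ ^ j)
  have hpow : ∀ (j : ℕ) (x : R), (σ ^ (j + 1)) x = (σ ^ j) (σ x) := fun j x => by
    rw [pow_succ, RingHom.mul_def, RingHom.comp_apply]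
  have hpow_add : ∀ (i j : ℕ) (x : R), (σ ^ (i + j)) x = (σ ^ i) ((σ ^ j) x) := fun i j x => by
    rw [pow_add, RingHom.mul_def, RingHom.comp_apply]
  have hbijpow : ∀ j : ℕ, Function.Bijective (σ ^ j : R →+* R) := fun j => by
    rw [RingHom.coe_pow]; exact hbij.iterate j
  have hq_mem : ∀ j x, x ∈ q j ↔ (σ ^ j) x ∈ p := fun j x => Iff.rfl
  have hpprime : p.IsPrime := hp.1.1
  have hqprime : ∀ j, (q j).IsPrime := fun j => hpprime.comap _
  have hpmin : ∀ r : Ideal R, r.IsPrime → r ≤ p → r = p := fun r hr hrp =>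
    le_antisymm hrp (hp.2 ⟨hr, bot_le⟩ hrp)
  have hqmin : ∀ j, ∀ r : Ideal R, r.IsPrime → r ≤ q j → r = q j := by
    intro j r hr hrq
    let E := RingEquiv.ofBijective (σ ^ j) (hbijpow j)
    have h1 : r.comap (E.symm : R →+* R) = p := by
      refine hpmin _ (hr.comap _) fun x hx => ?_
      have := hrq hx
      rw [hq_mem] at this
      have h2 : (σ ^ j) (E.symm x) = x := E.apply_symm_apply x
      exact h2 ▸ this
    refine le_antisymm hrq fun x hx => ?_
    rw [hq_mem, ← h1, Ideal.mem_comap] at hx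
    have h2 : E.symm ((σ ^ j) x) = x := E.symm_apply_apply x
    exact h2 ▸ hx
  have hcancel : ∀ i j d, q (i + d) = q (j + d) → q i = q j := by
    intro i j d h
    ext x
    obtain ⟨y, rfl⟩ := (hbijpow d).2 x
    rw [hq_mem, hq_mem, ← hpow_add, ← hpow_add]
    exact SetLike.ext_iff.1 h y
  have hadd : ∀ i j d, q i = q j → q (i + d) = q (j + d) := by
    intro i j d h
    ext x
    rw [hq_mem, hq_mem, hpow_add, hpow_add]
    exact SetLike.ext_iff.1 h _
  have hex : ∃ l, 0 < l ∧ q l = q 0 := by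
    have hfin : (Set.range q).Finite := by
      refine (minimalPrimes.finite_of_isNoetherianRing R).subset ?_
      rintro _ ⟨j, rfl⟩
      exact ⟨⟨hqprime j, bot_le⟩, fun r hr hrq => (hqmin j r hr.1 hrq).ge⟩
    obtain ⟨i, j, hij, h⟩ : ∃ i j, i < j ∧ q i = q j := by
      have : Finite (Set.range q) := hfin
      obtain ⟨i, j, hne, h⟩ := Finite.exists_ne_map_eq_of_infinite (Set.rangeFactorization q)
      have h' : q i = q j := congrArg Subtype.val h
      rcases lt_or_gt_of_ne hne with hlt | hlt
      · exact ⟨i, j, hlt, h'⟩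
      · exact ⟨j, i, hlt, h'.symm⟩
    refine ⟨j - i, by omega, hcancel _ _ i ?_⟩
    rw [Nat.sub_add_cancel hij.le, zero_add, h]
  classical
  obtain ⟨l, ⟨hl0, hl⟩, hlmin⟩ : ∃ l, (0 < l ∧ q l = q 0) ∧ ∀ l' < l, ¬(0 < l' ∧ q l' = q 0) :=
    ⟨Nat.find hex, Nat.find_spec hex, fun _ h => Nat.find_min hex h⟩
  have hper : ∀ j, q (j + l) = q j := fun j => by
    have := hadd l 0 j hl
    rwa [zero_add, add_comm] at this
  have hqle : ∀ i j, q i ≤ q j → q i = q j := fun i j h => hqmin j _ (hqprime i) h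
  have hdist : ∀ i j, j < l → q (i + j) = q i → j = 0 := by
    intro i j hj h
    by_contra hj0
    refine hlmin j hj ⟨Nat.pos_of_ne_zero hj0, hcancel j 0 i ?_⟩
    rwa [zero_add, add_comm]
  -- The l preimages of a σˡ-stable proper ideal M intersect in a proper σ-ideal, hence in 0, so one
  -- of them lies in the prime q i. Minimality within the cycle shows that it is M itself. This
  -- gives both comaximality of the primes and σˡ-simplicity of the components.
  have hmax : ∀ (M : Ideal R) (i : ℕ), q i ≤ M → (∀ x ∈ M, (σ ^ l) x ∈ M) → M ≠ ⊤ → M = q i := by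
    intro M i hiM hM hMtop
    have hN : (Finset.range l).inf (fun j => M.comap (σ ^ j)) = ⊥ := by
      refine (hσ.eq_bot_or_eq_top _ fun x hx => ?_).resolve_right fun h => hMtop ?_
      · rw [Submodule.mem_finsetInf] at hx ⊢
        intro j hj
        rw [Ideal.mem_comap, ← hpow]
        by_cases hjl : j + 1 < l
        · exact hx (j + 1) (Finset.mem_range.2 hjl)
        · have : j + 1 = l := by have := Finset.mem_range.1 hj; omega
          rw [this]
          have h0 := hx 0 (Finset.mem_range.2 hl0)
          exact hM _ (by simpa using h0)
      · rw [eq_top_iff, ← h]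
        intro x hx
        have := (Submodule.mem_finsetInf.1 hx) 0 (Finset.mem_range.2 hl0)
        simpa using this
    have := (Ideal.IsPrime.inf_le' (hqprime i)).1 (hN.le.trans bot_le)
    obtain ⟨j, hj, hjM⟩ := this
    have h1 : q (i + j) ≤ q i := by
      intro x hx
      refine hjM (hiM ?_)
      rw [hq_mem, ← hpow_add]
      exact hx
    have hj0 : j = 0 := hdist i j (Finset.mem_range.1 hj) (hqle _ _ h1)
    subst hj0
    exact le_antisymm (fun x hx => hjM hx) hiM
  have hstab : ∀ i, ∀ x ∈ q i, (σ ^ l) x ∈ q i := by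
    intro i x hx
    rw [hq_mem, ← hpow_add, ← hq_mem, hper]
    exact hx
  have hcop : ∀ i j, q i ≠ q j → q i ⊔ q j = ⊤ := by
    intro i j hij
    by_contra h
    have := hmax (q i ⊔ q j) i le_sup_left (fun x hx => ?_) h
    · exact hij (hqle j i (this ▸ le_sup_right)).symm
    · obtain ⟨y, hy, z, hz, rfl⟩ := Submodule.mem_sup.1 hx
      rw [map_add]
      exact Submodule.add_mem_sup (hstab i y hy) (hstab j z hz)
  -- Taking preimages runs the cycle backwards; reversing the index makes σ send the i-th component
  -- to the next one.
  let P : Fin l → Ideal R := fun i => q (l - i)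
  have hPinj : ∀ i j, P i = P j → i = j := by
    intro i j h
    have key : ∀ i j : Fin l, i < j → P i ≠ P j := by
      intro i j hij h
      have := hdist (l - j) (j - i) (by omega) (by
        rw [show l - (j : ℕ) + (j - i) = l - i by omega]; exact h)
      omega
    by_contra hne
    rcases lt_or_gt_of_ne hne with hlt | hlt
    · exact key i j hlt h
    · exact key j i hlt h.symm
  have hPrime : ∀ i, (P i).IsPrime := fun i => hqprime _
  have hPcop : Pairwise (Function.onFun IsCoprime P) := fun i j hij =>
    Ideal.isCoprime_iff_sup_eq.2 (hcop _ _ fun h => hij (hPinj i j h))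
  have hProt : ∀ i x, σ x ∈ P (finRotate l i) ↔ x ∈ P i := by
    intro i x
    change σ x ∈ q _ ↔ x ∈ q _
    rw [hq_mem, ← hpow, ← hq_mem, val_finRotate]
    by_cases hi : (i : ℕ) + 1 < l
    · rw [Nat.mod_eq_of_lt hi, show l - ((i : ℕ) + 1) + 1 = l - i by omega]
    · have : (i : ℕ) + 1 = l := by omega
      rw [this, Nat.mod_self, Nat.sub_zero, show l - (i : ℕ) = 1 by omega, add_comm, hper]
  have hPzero : ∀ x, (∀ i, x ∈ P i) → x = 0 := by
    have : (⨅ i, P i) = ⊥ := by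
      refine (hσ.eq_bot_or_eq_top _ fun x hx => ?_).resolve_right fun h => ?_
      · rw [Ideal.mem_iInf] at hx ⊢
        intro i
        obtain ⟨j, rfl⟩ := (finRotate l).surjective i
        exact (hProt j x).2 (hx j)
      · exact (hPrime ⟨0, hl0⟩).ne_top (top_le_iff.1 (h ▸ iInf_le _ _))
    intro x hx
    rw [← Ideal.mem_bot, ← this, Ideal.mem_iInf]
    exact hx
  have hPeq : ∀ x y, (∀ i, x - y ∈ P i) → x = y := fun x y h => sub_eq_zero.1 (hPzero _ h)
  -- Chinese remainder theorem. The P j intersect in 0, so identities in R may be checked modulo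
  -- each of them.
  have hidem : ∀ i, ∃ r : R, ∀ j, r - (if i = j then 1 else 0) ∈ P j := fun i =>
    Ideal.exists_forall_sub_mem_ideal hPcop _
  choose ε hε using hidem
  have hεne : ∀ i j, i ≠ j → ε i ∈ P j := fun i j hij => by simpa [hij] using hε i j
  have hεone : ∀ i, ε i - 1 ∈ P i := fun i => by simpa using hε i i
  have hεzero : ∀ i x, x ∈ P i → ε i * x = 0 := fun i x hx => hPzero _ fun j => by
    by_cases hij : i = j
    · exact Ideal.mul_mem_left _ _ (hij ▸ hx)
    · exact Ideal.mul_mem_right _ _ (hεne i j hij)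
  have hεself : ∀ i, ε i ∉ P i := fun i h => (hPrime i).ne_top <| (Ideal.eq_top_iff_one _).2 <| by
    have := sub_mem h (hεone i)
    simpa using this
  refine ⟨l, hl0, ε, CompleteOrthogonalIdempotents.iff_ortho_complete.2 ⟨?_, ?_⟩, ?_, ?_⟩
  · exact fun i j hij => hεzero i _ (hεne j i hij.symm)
  · refine hPeq _ _ fun j => ?_
    rw [Finset.sum_eq_add_sum_sdiff_singleton_of_mem (Finset.mem_univ j), add_sub_right_comm]
    refine add_mem (hεone j) (sum_mem fun i hi => hεne i j ?_)
    simpa using hi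
  · refine fun i => hPeq _ _ fun j => ?_
    obtain ⟨j, rfl⟩ := (finRotate l).surjective j
    by_cases hij : i = j
    · subst hij
      rw [← sub_sub_sub_cancel_right _ _ 1]
      refine sub_mem ?_ (hεone _)
      have := (hProt i _).2 (hεone i)
      rwa [map_sub, map_one] at this
    · exact sub_mem ((hProt j _).2 (hεne i j hij)) (hεne _ _ fun h => hij ((finRotate l).injective h))
  · refine fun i => ⟨fun h => hεself i (h ▸ zero_mem _), fun x y hxy => ?_, fun I hI hIσ => ?_⟩
    · have h0 : (ε i * x) * (ε i * y) ∈ P i := hxy ▸ zero_mem _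
      have hone : ∀ z, ε i * z ∈ P i → ε i * z = 0 := fun z hz =>
        hεzero i z (((hPrime i).mem_or_mem hz).resolve_left (hεself i))
      exact ((hPrime i).mem_or_mem h0).imp (hone x) (hone y)
    · by_cases h : I ⊔ P i = ⊤
      · right
        refine le_antisymm hI ?_
        rw [Ideal.span_singleton_le_iff_mem]
        obtain ⟨x, hx, y, hy, hxy⟩ := Submodule.mem_sup.1 ((Ideal.eq_top_iff_one _).1 h)
        have : ε i = ε i * x + ε i * y := by rw [← mul_add, hxy, mul_one]
        rw [this, hεzero i y hy, add_zero]
        exact Ideal.mul_mem_left _ _ hx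
      · left
        have h1 : I ⊔ P i = P i := by
          refine hmax _ _ le_sup_right (fun x hx => ?_) h
          obtain ⟨y, hy, z, hz, rfl⟩ := Submodule.mem_sup.1 hx
          rw [map_add]
          refine Submodule.add_mem_sup ?_ (hstab _ z hz)
          rw [RingHom.coe_pow]
          exact hIσ y hy
        rw [eq_bot_iff]
        intro x hx
        obtain ⟨y, rfl⟩ := Ideal.mem_span_singleton'.1 (hI hx)
        have h2 : y * ε i ∈ P i := h1 ▸ (le_sup_left : I ≤ I ⊔ P i) hx
        rw [Ideal.mem_bot, mul_comm]
        exact hεzero i y (((hPrime i).mem_or_mem h2).resolve_right (hεself i))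

/-- An idempotent whose component is a domain is primitive. Hence each e i meets some e' j and must
equal it, and distinct indices i give distinct j. -/
theorem IsPeriod.le {R : Type*} [CommRing R] {σ : R →+* R} {l l' : ℕ} (h : IsPeriod σ l)
    (h' : IsPeriod σ l') : l ≤ l' := by
  obtain ⟨_, e, he, _, hd⟩ := h
  obtain ⟨_, e', he', _, hd'⟩ := h'
  have hdich : ∀ a b : R, b * b = b →
      (∀ x y : R, (a * x) * (a * y) = 0 → a * x = 0 ∨ a * y = 0) → a * b ≠ 0 → a * b = a := by
    intro a b hb ha hab
    have := (ha b (1 - b) (by linear_combination -(a * a) * hb)).resolve_left hab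
    linear_combination -this
  have hex : ∀ i, ∃ j, e i = e' j := by
    intro i
    obtain ⟨j, hj⟩ : ∃ j, e i * e' j ≠ 0 := by
      by_contra! hall
      apply (hd i).1
      rw [← mul_one (e i), ← he'.complete, Finset.mul_sum]
      exact Finset.sum_eq_zero fun j _ => hall j
    have h1 := hdich (e i) (e' j) (he'.idem j) (hd i).2.1 hj
    have h2 := hdich (e' j) (e i) (he.idem i) (hd' j).2.1 (by rwa [mul_comm])
    exact ⟨j, by rw [← h1, mul_comm, h2]⟩
  choose φ hφ using hex
  have hinj : Function.Injective φ := by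
    intro i j hij
    by_contra hne
    apply (hd i).1
    have h1 : e i * e j = 0 := he.ortho hne
    rw [hφ j, ← hij, ← hφ i] at h1
    rw [← he.idem i]
    exact h1
  simpa using Fintype.card_le_of_injective φ hinj

theorem IsPeriod.unique {R : Type*} [CommRing R] {σ : R →+* R} {l l' : ℕ} (h : IsPeriod σ l)
    (h' : IsPeriod σ l') : l = l' := le_antisymm (h.le h') (h'.le h)

/-! ### The ring of sequences -/

section Seq

theorem SeqRing.exists_mk {k : Type*} (x : SeqRing k) : ∃ f : ℕ → k, SeqRing.mk f = x :=
  Germ.inductionOn x fun f => ⟨f, rfl⟩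

variable {k : Type*} [Field k]

theorem SeqRing.mk_mul (f g : ℕ → k) : SeqRing.mk f * SeqRing.mk g = SeqRing.mk (f * g) := rfl

theorem SeqRing.mk_zero : SeqRing.mk (0 : ℕ → k) = 0 := rfl

theorem SeqRing.mk_one : SeqRing.mk (1 : ℕ → k) = 1 := rfl

/-- The ring homomorphism from sequences to their classes. -/
def SeqRing.mkHom : (ℕ → k) →+* SeqRing k where
  toFun := SeqRing.mk
  map_one' := rfl
  map_zero' := rfl
  map_mul' _ _ := rfl
  map_add' _ _ := rfl

theorem SeqRing.mk_eq_zero {f : ℕ → k} : SeqRing.mk f = 0 ↔ ∃ N, ∀ i ≥ N, f i = 0 := by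
  rw [← SeqRing.mk_zero, SeqRing.mk_eq_mk, eventually_atTop]
  rfl

instance : Nontrivial (SeqRing k) := ⟨⟨0, 1, fun h => by
  obtain ⟨N, hN⟩ := SeqRing.mk_eq_zero.1 ((SeqRing.mk_one (k := k)).trans h.symm)
  exact one_ne_zero (hN N le_rfl)⟩⟩

theorem SeqRing.isUnit_mk {f : ℕ → k} : IsUnit (SeqRing.mk f) ↔ ∃ N, ∀ i ≥ N, f i ≠ 0 := by
  constructor
  · intro h
    obtain ⟨y, hy⟩ := h.exists_right_inv
    obtain ⟨g, rfl⟩ := SeqRing.exists_mk y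
    rw [SeqRing.mk_mul, ← SeqRing.mk_one, SeqRing.mk_eq_mk, eventually_atTop] at hy
    obtain ⟨N, hN⟩ := hy
    refine ⟨N, fun i hi h0 => ?_⟩
    have := hN i hi
    simp [h0] at this
  · rintro ⟨N, hN⟩
    refine IsUnit.of_mul_eq_one (SeqRing.mk f⁻¹) ?_
    rw [SeqRing.mk_mul, ← SeqRing.mk_one, SeqRing.mk_eq_mk, eventually_atTop]
    exact ⟨N, fun i hi => mul_inv_cancel₀ (hN i hi)⟩

theorem seqShift_injective : Function.Injective (seqShift k) := by
  rw [injective_iff_map_eq_zero]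
  intro x hx
  obtain ⟨f, rfl⟩ := SeqRing.exists_mk x
  rw [seqShift_mk, SeqRing.mk_eq_zero] at hx
  obtain ⟨N, hN⟩ := hx
  refine SeqRing.mk_eq_zero.2 ⟨N + 1, fun i hi => ?_⟩
  have := hN (i - 1) (by omega)
  rwa [Nat.sub_add_cancel (by omega)] at this

theorem seqShift_pow_mk (t : ℕ) (f : ℕ → k) :
    (seqShift k ^ t) (SeqRing.mk f) = SeqRing.mk fun i => f (i + t) := by
  induction t with
  | zero => rfl
  | succ t ih =>
    rw [pow_succ', RingHom.mul_def, RingHom.comp_apply, ih, seqShift_mk]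
    congr 1
    funext i
    rw [add_right_comm, add_assoc]

theorem seqShift_eq_self {x : SeqRing k} (hx : seqShift k x = x) :
    ∃ c : k, SeqRing.mk (fun _ => c) = x := by
  obtain ⟨f, rfl⟩ := SeqRing.exists_mk x
  rw [seqShift_mk, SeqRing.mk_eq_mk, eventually_atTop] at hx
  obtain ⟨N, hN⟩ := hx
  refine ⟨f N, SeqRing.mk_eq_mk.2 (eventually_atTop.2 ⟨N, fun i hi => ?_⟩)⟩
  induction i, hi using Nat.le_induction with
  | base => rfl
  | succ i hi ih => rw [ih, hN i hi]

/-- The zeros of the sequences in the class `x` are eventually periodic with period `m`. -/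
def ZerosPeriodic (m : ℕ) (x : SeqRing k) : Prop :=
  ∀ f : ℕ → k, SeqRing.mk f = x → IsEventuallyPeriodic m {i | f i = 0}

theorem zerosPeriodic_mk {m : ℕ} {f : ℕ → k} (h : IsEventuallyPeriodic m {i | f i = 0}) :
    ZerosPeriodic m (SeqRing.mk f) := by
  intro g hg
  obtain ⟨N, hN⟩ := h
  obtain ⟨N', hN'⟩ := eventually_atTop.1 (SeqRing.mk_eq_mk.1 hg)
  refine ⟨max N N', fun i hi => ?_⟩
  have h1 := hN' i (le_of_max_le_right hi)
  have h2 := hN' (i + m) ((le_of_max_le_right hi).trans (Nat.le_add_right _ _))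
  simp only [Set.mem_ofPred_eq, h1, h2]
  exact hN i (le_of_max_le_left hi)

/-- If the zeros of `x * u` with a unit `u` are eventually periodic, so are those of `x`. -/
theorem ZerosPeriodic.of_mul_isUnit {m : ℕ} {x u : SeqRing k} (hu : IsUnit u)
    (h : ZerosPeriodic m (x * u)) : ZerosPeriodic m x := by
  intro f hf
  obtain ⟨g, rfl⟩ := SeqRing.exists_mk u
  obtain ⟨N', hN'⟩ := SeqRing.isUnit_mk.1 hu
  obtain ⟨N, hN⟩ := h (f * g) (by rw [← hf]; rfl)
  refine ⟨max N N', fun i hi => ?_⟩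
  have h1 := hN' i (le_of_max_le_right hi)
  have h2 := hN' (i + m) ((le_of_max_le_right hi).trans (Nat.le_add_right _ _))
  have := hN i (le_of_max_le_left hi)
  simpa [h1, h2] using this

/-- Turns zeros that recur with bounded gaps into an algebraic relation among the shifts of f, which
contradicts nonzerodivisor or domain hypotheses later on. -/
theorem prod_seqShift_pow_eq_zero {f : ℕ → k} {d m N : ℕ}
    (h : ∀ j ≥ N, ∃ t < m, f (j + d * t) = 0) :
    ∏ t ∈ Finset.range m, (seqShift k ^ (d * t)) (SeqRing.mk f) = 0 := by
  have : ∏ t ∈ Finset.range m, (seqShift k ^ (d * t)) (SeqRing.mk f) =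
      SeqRing.mkHom (∏ t ∈ Finset.range m, fun i => f (i + d * t)) := by
    rw [map_prod]
    exact Finset.prod_congr rfl fun t _ => seqShift_pow_mk _ _
  rw [this]
  refine SeqRing.mk_eq_zero.2 ⟨N, fun j hj => ?_⟩
  obtain ⟨t, ht, h0⟩ := h j hj
  rw [Finset.prod_apply]
  exact Finset.prod_eq_zero (Finset.mem_range.2 ht) h0

/-- A cyclic system of idempotents in the ring of sequences consists of the indicators of the
residue classes modulo `l`. -/
theorem exists_eq_indicator {l : ℕ} {e : Fin l → SeqRing k}
    (he : CompleteOrthogonalIdempotents e) (hσ : ∀ i, seqShift k (e i) = e (finRotate l i)) :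
    ∃ i₀, ∀ i : Fin l, e i = SeqRing.mk fun j => if ((i : ℕ) + j) % l = i₀ then 1 else 0 := by
  choose u hu using fun i => SeqRing.exists_mk (e i)
  have h1 : ∀ᶠ j in atTop, ∀ i i', i ≠ i' → u i j * u i' j = 0 := by
    rw [eventually_all]; intro i
    rw [eventually_all]; intro i'
    by_cases hne : i = i'
    · exact Eventually.of_forall fun _ h => absurd hne h
    · have := he.ortho hne
      simp only [← hu] at this
      obtain ⟨N, hN⟩ := SeqRing.mk_eq_zero.1 this
      exact eventually_atTop.2 ⟨N, fun j hj _ => hN j hj⟩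
  have h2 : ∀ᶠ j in atTop, ∑ i, u i j = 1 := by
    have := he.complete
    have h3 : ∑ i, e i = SeqRing.mkHom (∑ i, u i) := by
      rw [map_sum]; exact Finset.sum_congr rfl fun i _ => (hu i).symm
    rw [h3] at this
    have := SeqRing.mk_eq_mk.1 (this.trans SeqRing.mk_one.symm)
    simpa using this
  have h3 : ∀ᶠ j in atTop, ∀ i, u i (j + 1) = u (finRotate l i) j := by
    rw [eventually_all]; intro i
    have := hσ i
    rw [← hu, ← hu, seqShift_mk] at this
    exact SeqRing.mk_eq_mk.1 this
  obtain ⟨N, hN⟩ := eventually_atTop.1 (h1.and (h2.and h3))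
  -- At the index N exactly one of the orthogonal idempotents is nonzero, with value 1. The cyclic
  -- relation transports this to all later indices, and the residue i₀ corrects for starting at N.
  obtain ⟨i₁, hi₁⟩ : ∃ i, u i N ≠ 0 := by
    by_contra! h0
    have := (hN N le_rfl).2.1
    simp [h0] at this
  have hother : ∀ i, i ≠ i₁ → u i N = 0 := fun i hi =>
    (mul_eq_zero.1 ((hN N le_rfl).1 i i₁ hi)).resolve_right hi₁
  have hone : u i₁ N = 1 := by
    have := (hN N le_rfl).2.1
    rwa [Finset.sum_eq_single i₁ (fun i _ hi => hother i hi) (by simp)] at this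
  have hu' : ∀ t (i : Fin l), u i (N + t) = if ((i : ℕ) + t) % l = i₁ then 1 else 0 := by
    intro t
    induction t with
    | zero =>
      intro i
      rw [add_zero, add_zero, Nat.mod_eq_of_lt i.2]
      by_cases hi : i = i₁
      · rw [hi, if_pos rfl, hone]
      · rw [if_neg (fun h => hi (Fin.ext h)), hother i hi]
    | succ t ih =>
      intro i
      rw [← add_assoc, (hN (N + t) (Nat.le_add_right _ _)).2.2, ih, val_finRotate, Nat.mod_add_mod,
        add_right_comm, add_assoc]
  refine ⟨(i₁ + N) % l, fun i => ?_⟩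
  rw [← hu, SeqRing.mk_eq_mk]
  refine eventually_atTop.2 ⟨N, fun j hj => ?_⟩
  obtain ⟨t, rfl⟩ := Nat.exists_eq_add_of_le hj
  rw [hu']
  congr 1
  rw [eq_iff_iff]
  nth_rewrite 1 [← Nat.mod_eq_of_lt i₁.2]
  rw [show (i : ℕ) + (N + t) = i + t + N by ring]
  exact ⟨fun h => Nat.ModEq.add_right N h, fun h => Nat.ModEq.add_right_cancel' N h⟩

/-- An element that on each residue class is eventually zero or eventually nonzero. -/
theorem zerosPeriodic_of_dichotomy {l : ℕ} (hl : 0 < l) {e : Fin l → SeqRing k}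
    (he : CompleteOrthogonalIdempotents e) (hσ : ∀ i, seqShift k (e i) = e (finRotate l i))
    {x : SeqRing k} (hx : ∀ i, e i * x = 0 ∨ ∃ y, (e i * x) * y = e i) : ZerosPeriodic l x := by
  obtain ⟨i₀, hi₀⟩ := exists_eq_indicator he hσ
  intro f hf
  subst hf
  have key : ∀ i : Fin l, ∃ N, (∀ j ≥ N, ((i : ℕ) + j) % l = i₀ → f j = 0) ∨
      (∀ j ≥ N, ((i : ℕ) + j) % l = i₀ → f j ≠ 0) := by
    intro i
    rcases hx i with h | ⟨y, hy⟩
    · rw [hi₀, SeqRing.mk_mul] at h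
      obtain ⟨N, hN⟩ := SeqRing.mk_eq_zero.1 h
      refine ⟨N, Or.inl fun j hj hij => ?_⟩
      simpa [hij] using hN j hj
    · obtain ⟨g, rfl⟩ := SeqRing.exists_mk y
      rw [hi₀, SeqRing.mk_mul, SeqRing.mk_mul, SeqRing.mk_eq_mk] at hy
      obtain ⟨N, hN⟩ := eventually_atTop.1 hy
      refine ⟨N, Or.inr fun j hj hij h0 => ?_⟩
      have := hN j hj
      simp [hij, h0] at this
  choose N hN using key
  refine ⟨∑ i, N i, fun j hj => ?_⟩
  obtain ⟨i, hi⟩ : ∃ i : Fin l, ((i : ℕ) + j) % l = i₀ := by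
    have := he.complete
    simp only [hi₀] at this
    by_contra! hno
    have hno' : ∀ j' : ℕ, ∀ i : Fin l, ((i : ℕ) + j') % l ≠ i₀ := by
      intro j' i h
      refine hno ⟨(i + j' + (l - j % l)) % l, Nat.mod_lt _ hl⟩ ?_
      rw [← h]
      have hjl := (Nat.mod_lt j hl).le
      simp only [Nat.mod_add_mod]
      have h1 : (i : ℕ) + j' + (l - j % l) + j = i + j' + l * (j / l + 1) := by
        have := Nat.div_add_mod j l
        rw [mul_add_one]
        omega
      rw [h1, Nat.add_mul_mod_self_left]
    simp only [hno', if_false] at this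
    have h0 : SeqRing.mk (fun _ : ℕ => (0 : k)) = 0 := rfl
    simp [h0] at this
  have hle : N i ≤ j := (Finset.single_le_sum (f := N) (fun _ _ => Nat.zero_le _)
    (Finset.mem_univ i)).trans hj
  have hi' : ((i : ℕ) + (j + l)) % l = i₀ := by rw [← add_assoc, Nat.add_mod_right, hi]
  simp only [Set.mem_ofPred_eq]
  rcases hN i with h | h
  · simp [h j hle hi, h (j + l) (by omega) hi']
  · simp [h j hle hi, h (j + l) (by omega) hi']

end Seq

/-! ### Rings of fractions inside a ring -/

/-- The elements of `B` which are quotients of elements of `S₀` by elements of `S₀` that are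
invertible in `B`. -/
def fractionSubalgebra {K B : Type*} [Field K] [CommRing B] [Algebra K B] (S₀ : Subalgebra K B) :
    Subalgebra K B where
  carrier := {x | ∃ b ∈ S₀, IsUnit b ∧ x * b ∈ S₀}
  mul_mem' := by
    rintro x y ⟨b, hb, hbu, hxb⟩ ⟨c, hc, hcu, hyc⟩
    refine ⟨b * c, mul_mem hb hc, hbu.mul hcu, ?_⟩
    rw [mul_mul_mul_comm]
    exact mul_mem hxb hyc
  add_mem' := by
    rintro x y ⟨b, hb, hbu, hxb⟩ ⟨c, hc, hcu, hyc⟩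
    refine ⟨b * c, mul_mem hb hc, hbu.mul hcu, ?_⟩
    rw [show (x + y) * (b * c) = x * b * c + y * c * b by ring]
    exact add_mem (mul_mem hxb hc) (mul_mem hyc hb)
  algebraMap_mem' a := ⟨1, one_mem _, isUnit_one, by rw [mul_one]; exact S₀.algebraMap_mem a⟩

section Fractions

variable {K B : Type*} [Field K] [CommRing B] [Algebra K B] {S₀ : Subalgebra K B}

theorem le_fractionSubalgebra : S₀ ≤ fractionSubalgebra S₀ :=
  fun x hx => ⟨1, one_mem _, isUnit_one, by rwa [mul_one]⟩

theorem mem_fractionSubalgebra_of_mul_eq_one {x y : B} (hx : x ∈ fractionSubalgebra S₀)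
    (hxy : x * y = 1) : y ∈ fractionSubalgebra S₀ := by
  obtain ⟨b, hb, hbu, hxb⟩ := hx
  refine ⟨x * b, hxb, (IsUnit.of_mul_eq_one y hxy).mul hbu, ?_⟩
  rwa [show y * (x * b) = x * y * b by ring, hxy, one_mul]

theorem map_mem_fractionSubalgebra {σ : B →+* B} (hσ : ∀ x ∈ S₀, σ x ∈ S₀) {x : B}
    (hx : x ∈ fractionSubalgebra S₀) : σ x ∈ fractionSubalgebra S₀ := by
  obtain ⟨b, hb, hbu, hxb⟩ := hx
  exact ⟨σ b, hσ b hb, hbu.map σ, by rw [← map_mul]; exact hσ _ hxb⟩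

end Fractions

/-! ### The ring generated by a fundamental matrix in the ring of sequences -/

section PV

variable {k : Type*} [Field k]

theorem ratShift_algebraMap_poly (p : k[X]) :
    ratShift k (algebraMap k[X] (RatFunc k) p) =
      algebraMap k[X] (RatFunc k) (Polynomial.taylor 1 p) := by
  have := RatFunc.map_apply_div (Polynomial.taylorEquiv (1 : k))
    (nonZeroDivisors_le_comap_nonZeroDivisors_of_injective _
      (Polynomial.taylorEquiv (1 : k)).injective) p 1
  simp only [map_one, div_one] at this
  exact this

theorem ratShift_algebraMap (c : k) :
    ratShift k (algebraMap k (RatFunc k) c) = algebraMap k (RatFunc k) c := by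
  have h : algebraMap k (RatFunc k) c = algebraMap k[X] (RatFunc k) (Polynomial.C c) := by
    rw [RatFunc.algebraMap_eq_C, RatFunc.algebraMap_C]
  rw [h, ratShift_algebraMap_poly, Polynomial.taylor_C]

theorem ratShift_surjective : Function.Surjective (ratShift k) := by
  intro x
  have hp : ∀ p : k[X], ∃ q : k[X], ratShift k (algebraMap k[X] (RatFunc k) q) =
      algebraMap k[X] (RatFunc k) p := fun p => by
    obtain ⟨q, hq⟩ := (Polynomial.taylorEquiv (1 : k)).surjective p
    exact ⟨q, by rw [ratShift_algebraMap_poly]; exact congrArg _ hq⟩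
  induction x using RatFunc.induction_on with
  | f p q hq =>
    obtain ⟨p', hp'⟩ := hp p
    obtain ⟨q', hq'⟩ := hp q
    exact ⟨algebraMap k[X] (RatFunc k) p' / algebraMap k[X] (RatFunc k) q', by
      rw [map_div₀, hp', hq']⟩

variable [CharZero k]

instance : Algebra k (SeqRing k) :=
  ((algebraMap (RatFunc k) (SeqRing k)).comp (algebraMap k (RatFunc k))).toAlgebra

instance : IsScalarTower k (RatFunc k) (SeqRing k) := IsScalarTower.of_algebraMap_eq fun _ => rfl

theorem algebraMap_seq_const (c : k) : algebraMap k (SeqRing k) c = SeqRing.mk fun _ => c := by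
  change SeqRing.mk (fun i : ℕ => ev (algebraMap k (RatFunc k) c) (i : k)) = _
  congr 1
  funext i
  rw [RatFunc.algebraMap_eq_C]
  exact RatFunc.eval_C _ _

theorem exists_algebraMap_of_seqShift_eq {x : SeqRing k} (hx : seqShift k x = x) :
    ∃ c : k, algebraMap k (SeqRing k) c = x := by
  obtain ⟨c, rfl⟩ := seqShift_eq_self hx
  exact ⟨c, algebraMap_seq_const c⟩

variable {n : ℕ} {A : Matrix (Fin n) (Fin n) (RatFunc k)}

/-- The subalgebra `k(z)[Yᵢⱼ, 1 / det Y]`. -/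
def pvRing (Y : GL (Fin n) (SeqRing k)) : Subalgebra (RatFunc k) (SeqRing k) :=
  Algebra.adjoin (RatFunc k) (glGenerators Y)

/-- The subalgebra `k(z)[Yᵢⱼ]`. -/
def entryRing (Y : GL (Fin n) (SeqRing k)) : Subalgebra (RatFunc k) (SeqRing k) :=
  Algebra.adjoin (RatFunc k) (entries Y)

theorem entryRing_le_pvRing (Y : GL (Fin n) (SeqRing k)) : entryRing Y ≤ pvRing Y :=
  Algebra.adjoin_mono Set.subset_union_left

theorem glGenerators_subset_pvRing (Y : GL (Fin n) (SeqRing k)) : glGenerators Y ⊆ pvRing Y :=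
  Algebra.subset_adjoin

theorem entry_mem_entryRing (Y : GL (Fin n) (SeqRing k)) (i j : Fin n) :
    (Y : Matrix (Fin n) (Fin n) (SeqRing k)) i j ∈ entryRing Y :=
  Algebra.subset_adjoin ⟨(i, j), rfl⟩

theorem det_mem_entryRing (Y : GL (Fin n) (SeqRing k)) :
    (Y : Matrix (Fin n) (Fin n) (SeqRing k)).det ∈ entryRing Y := by
  rw [Matrix.det_apply']
  exact sum_mem fun τ _ => mul_mem (intCast_mem _ _)
    (prod_mem fun i _ => entry_mem_entryRing Y _ _)

/-- The determinant is a polynomial in the entries and invertible in `SeqRing k`, so adjoining its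
inverse does not enlarge the ring of fractions. -/
theorem pvRing_le_fractionSubalgebra (Y : GL (Fin n) (SeqRing k)) :
    pvRing Y ≤ fractionSubalgebra (entryRing Y) := by
  refine Algebra.adjoin_le ?_
  rintro _ (⟨⟨i, j⟩, rfl⟩ | rfl)
  · exact le_fractionSubalgebra (entry_mem_entryRing Y i j)
  · exact mem_fractionSubalgebra_of_mul_eq_one (le_fractionSubalgebra (det_mem_entryRing Y))
      (Matrix.GeneralLinearGroup.det Y).mul_inv

theorem pvRing_le_of_mul {Y Y' C : GL (Fin n) (SeqRing k)}
    (hC : ∀ x ∈ glGenerators C, x ∈ Set.range (algebraMap (RatFunc k) (SeqRing k)))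
    (h : Y' = Y * C) : pvRing Y' ≤ pvRing Y := by
  refine Algebra.adjoin_le ?_
  rw [h]
  refine glGenerators_mul_subset Y C (pvRing Y).toSubring (glGenerators_subset_pvRing Y) ?_
  intro x hx
  obtain ⟨a, rfl⟩ := hC x hx
  exact (pvRing Y).algebraMap_mem a

/-- All fundamental matrices generate the same ring. -/
theorem pvRing_eq {Y Y' : GL (Fin n) (SeqRing k)} (hY : IsFundamentalMatrix (seqShift k) A Y)
    (hY' : IsFundamentalMatrix (seqShift k) A Y') : pvRing Y = pvRing Y' := by
  have key : ∀ {Y Y' : GL (Fin n) (SeqRing k)}, IsFundamentalMatrix (seqShift k) A Y →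
      IsFundamentalMatrix (seqShift k) A Y' → pvRing Y' ≤ pvRing Y := by
    intro Y Y' hY hY'
    refine pvRing_le_of_mul (C := Y⁻¹ * Y') (fun x hx => ?_) (by simp)
    obtain ⟨c, hc⟩ := exists_algebraMap_of_seqShift_eq
      (map_apply_of_mem_glGenerators (map_inv_mul_eq_of_fundamental hY hY') hx)
    exact ⟨algebraMap k (RatFunc k) c, hc⟩
  exact le_antisymm (key hY' hY) (key hY hY')

theorem seqShift_mem_entryRing {Y : GL (Fin n) (SeqRing k)}
    (hY : IsFundamentalMatrix (seqShift k) A Y) {x : SeqRing k} (hx : x ∈ entryRing Y) :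
    seqShift k x ∈ entryRing Y := by
  induction hx using Algebra.adjoin_induction with
  | mem x hx =>
    obtain ⟨⟨i, j⟩, rfl⟩ := hx
    have := congrFun (congrFun hY i) j
    rw [Matrix.map_apply] at this
    change seqShift k ((Y : Matrix (Fin n) (Fin n) (SeqRing k)) i j) ∈ _
    rw [this, Matrix.mul_apply]
    exact sum_mem fun l _ => mul_mem ((entryRing Y).algebraMap_mem _) (entry_mem_entryRing Y l j)
  | algebraMap c => rw [seqShift_algebraMap]; exact (entryRing Y).algebraMap_mem _
  | add x y _ _ hx hy => rw [map_add]; exact add_mem hx hy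
  | mul x y _ _ hx hy => rw [map_mul]; exact mul_mem hx hy

theorem map_seqShift_eq {𝒜 : GL (Fin n) (RatFunc k)} {Y : GL (Fin n) (SeqRing k)}
    (hY : IsFundamentalMatrix (seqShift k) (𝒜 : Matrix (Fin n) (Fin n) (RatFunc k)) Y) :
    Matrix.GeneralLinearGroup.map (seqShift k) Y =
      Matrix.GeneralLinearGroup.map (algebraMap (RatFunc k) (SeqRing k)) 𝒜 * Y :=
  Units.ext hY

theorem glGenerators_map_algebraMap_subset (𝒜 : GL (Fin n) (RatFunc k)) :
    glGenerators (Matrix.GeneralLinearGroup.map (algebraMap (RatFunc k) (SeqRing k)) 𝒜) ⊆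
      Set.range (algebraMap (RatFunc k) (SeqRing k)) := by
  rw [← image_glGenerators]
  exact Set.image_subset_range _ _

theorem seqShift_mem_pvRing {𝒜 : GL (Fin n) (RatFunc k)} {Y : GL (Fin n) (SeqRing k)}
    (hY : IsFundamentalMatrix (seqShift k) (𝒜 : Matrix (Fin n) (Fin n) (RatFunc k)) Y)
    {x : SeqRing k} (hx : x ∈ pvRing Y) : seqShift k x ∈ pvRing Y := by
  induction hx using Algebra.adjoin_induction with
  | mem x hx =>
    have h1 : seqShift k x ∈ seqShift k '' glGenerators Y := ⟨x, hx, rfl⟩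
    rw [image_glGenerators, map_seqShift_eq hY] at h1
    refine glGenerators_mul_subset _ _ (pvRing Y).toSubring ?_ (glGenerators_subset_pvRing Y) h1
    intro y hy
    obtain ⟨a, rfl⟩ := glGenerators_map_algebraMap_subset 𝒜 hy
    exact (pvRing Y).algebraMap_mem a
  | algebraMap c => rw [seqShift_algebraMap]; exact (pvRing Y).algebraMap_mem _
  | add x y _ _ hx hy => rw [map_add]; exact add_mem hx hy
  | mul x y _ _ hx hy => rw [map_mul]; exact mul_mem hx hy

/-- σ is onto k(z), and Y = A⁻¹σ(Y) recovers the generators from their shifts. So σ is an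
automorphism of this ring. -/
theorem exists_seqShift_eq_of_mem_pvRing {𝒜 : GL (Fin n) (RatFunc k)} {Y : GL (Fin n) (SeqRing k)}
    (hY : IsFundamentalMatrix (seqShift k) (𝒜 : Matrix (Fin n) (Fin n) (RatFunc k)) Y)
    {x : SeqRing k} (hx : x ∈ pvRing Y) : ∃ y ∈ pvRing Y, seqShift k y = x := by
  change x ∈ (pvRing Y).toSubring.map (seqShift k)
  set B := (pvRing Y).toSubring.map (seqShift k)
  have hK : ∀ a, algebraMap (RatFunc k) (SeqRing k) a ∈ B := fun a => by
    obtain ⟨b, rfl⟩ := ratShift_surjective a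
    exact ⟨_, (pvRing Y).algebraMap_mem b, seqShift_algebraMap b⟩
  have hgen : glGenerators Y ⊆ B := by
    have h1 : Y = Matrix.GeneralLinearGroup.map (algebraMap (RatFunc k) (SeqRing k)) 𝒜⁻¹ *
        Matrix.GeneralLinearGroup.map (seqShift k) Y := by
      rw [map_seqShift_eq hY, map_inv, inv_mul_cancel_left]
    rw [h1]
    refine glGenerators_mul_subset _ _ B ?_ ?_
    · intro y hy
      obtain ⟨a, rfl⟩ := glGenerators_map_algebraMap_subset 𝒜⁻¹ hy
      exact hK a
    · rw [← image_glGenerators]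
      rintro _ ⟨y, hy, rfl⟩
      exact ⟨y, glGenerators_subset_pvRing Y hy, rfl⟩
  induction hx using Algebra.adjoin_induction with
  | mem x hx => exact hgen hx
  | algebraMap c => exact hK c
  | add x y _ _ hx hy => exact add_mem hx hy
  | mul x y _ _ hx hy => exact mul_mem hx hy

instance isNoetherianRing_pvRing (Y : GL (Fin n) (SeqRing k)) : IsNoetherianRing (pvRing Y) := by
  have : Algebra.FiniteType (RatFunc k) (pvRing Y) :=
    (Subalgebra.fg_iff_finiteType _).1 (Subalgebra.fg_def.2 ⟨_, finite_glGenerators Y, rfl⟩)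
  exact Algebra.FiniteType.isNoetherianRing (RatFunc k) _

theorem seqShift_pow_mem {R : Subalgebra (RatFunc k) (SeqRing k)}
    (hR : ∀ x ∈ R, seqShift k x ∈ R) (t : ℕ) {x : SeqRing k} (hx : x ∈ R) :
    (seqShift k ^ t) x ∈ R := by
  induction t with
  | zero => exact hx
  | succ t ih =>
    rw [pow_succ', RingHom.mul_def, RingHom.comp_apply]
    exact hR _ ih

/-- Nonzerodivisors of the ring `k(z)[Yᵢⱼ, 1 / det Y]` vanish only finitely often. -/
theorem isUnit_of_nonzerodivisor {R : Subalgebra (RatFunc k) (SeqRing k)}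
    (hR : ∀ x ∈ R, seqShift k x ∈ R) (hRsurj : ∀ x ∈ R, ∃ y ∈ R, seqShift k y = x)
    {s : SeqRing k} (hs : s ∈ R) (hnzd : ∀ y ∈ R, s * y = 0 → y = 0) {m : ℕ} (hm : 0 < m)
    (hper : ZerosPeriodic m s) : IsUnit s := by
  obtain ⟨f, rfl⟩ := SeqRing.exists_mk s
  obtain ⟨N, hN⟩ := hper f rfl
  rw [SeqRing.isUnit_mk]
  by_contra! hcon
  obtain ⟨j₀, hj₀, h0⟩ := hcon N
  -- One zero beyond the threshold of periodicity propagates along a progression, so the product of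
  -- m consecutive shifts of f is 0. These shifts are nonzerodivisors because σ is bijective on R, a
  -- contradiction.
  have hzero : ∀ t, f (j₀ + t * m) = 0 := fun t =>
    (IsEventuallyPeriodic.add_mul hN hj₀ t).1 h0
  have hpow : ∀ t, ∀ y ∈ R, (seqShift k ^ t) (SeqRing.mk f) * y = 0 → y = 0 := by
    intro t
    induction t with
    | zero => exact hnzd
    | succ t ih =>
      intro y hy hty
      obtain ⟨z, hz, rfl⟩ := hRsurj y hy
      rw [pow_succ', RingHom.mul_def, RingHom.comp_apply, ← map_mul] at hty
      rw [ih z hz (seqShift_injective (hty.trans (map_zero _).symm)), map_zero]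
  have hprod : ∀ S : Finset ℕ, ∀ y ∈ R,
      (∏ t ∈ S, (seqShift k ^ (1 * t)) (SeqRing.mk f)) * y = 0 → y = 0 := by
    intro S
    induction S using Finset.induction_on with
    | empty => intro y _ h; simpa using h
    | insert t S ht ih =>
      intro y hy h
      rw [Finset.prod_insert ht, mul_assoc] at h
      refine ih y hy (hpow _ _ (mul_mem (prod_mem fun t _ => seqShift_pow_mem hR _ hs) hy) h)
  have := hprod (Finset.range m) 1 (one_mem _) ?_
  · exact one_ne_zero this
  · rw [mul_one]
    refine prod_seqShift_pow_eq_zero (N := j₀) fun j hj => ?_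
    have hlt := Nat.mod_lt (j - j₀) hm
    have hdm := Nat.div_add_mod (j - j₀) m
    by_cases hz : (j - j₀) % m = 0
    · refine ⟨0, hm, ?_⟩
      rw [mul_zero, add_zero, show j = j₀ + (j - j₀) / m * m by rw [mul_comm]; omega]
      exact hzero _
    · refine ⟨m - (j - j₀) % m, by omega, ?_⟩
      rw [one_mul, show j + (m - (j - j₀) % m) = j₀ + ((j - j₀) / m + 1) * m by
        rw [add_one_mul, mul_comm]; omega]
      exact hzero _

end PV

/-! ### σ-simplicity, uniqueness and period of the Picard-Vessiot ring -/

section PV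

variable {k : Type*} [Field k] [CharZero k] {n : ℕ} {𝒜 : GL (Fin n) (RatFunc k)}
  {Y : GL (Fin n) (SeqRing k)}

theorem seqShift_mem_fractionSubalgebra {A : Matrix (Fin n) (Fin n) (RatFunc k)}
    (hY : IsFundamentalMatrix (seqShift k) A Y) :
    ∀ x ∈ fractionSubalgebra (entryRing Y), seqShift k x ∈ fractionSubalgebra (entryRing Y) :=
  fun _ hx => map_mem_fractionSubalgebra (fun _ h => seqShift_mem_entryRing hY h) hx

/-- A nonzero σ-ideal is contracted to R. If the contraction contains a nonzerodivisor, this is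
invertible by periodicity of its zeros. Otherwise, R being Noetherian, the contraction is killed by
some g ≠ 0, and the shifts of one nonzero element, which never vanish simultaneously, force g = 0.
-/
theorem isSigmaSimple_fractionSubalgebra
    (hY : IsFundamentalMatrix (seqShift k) (𝒜 : Matrix (Fin n) (Fin n) (RatFunc k)) Y)
    (hP : ∀ x ∈ pvRing Y, ∃ m, 0 < m ∧ ZerosPeriodic m x)
    (hL : ∀ x ∈ fractionSubalgebra (entryRing Y), seqShift k x ∈ fractionSubalgebra (entryRing Y)) :
    IsSigmaSimple ((seqShift k).restrict (fractionSubalgebra (entryRing Y))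
      (fractionSubalgebra (entryRing Y)) hL) := by
  have hRL := pvRing_le_fractionSubalgebra Y
  refine ⟨inferInstance, fun N hN => or_iff_not_imp_left.2 fun hbot => ?_⟩
  let I : Ideal (pvRing Y) := N.comap (Subalgebra.inclusion hRL)
  have hmemI : ∀ x : pvRing Y, x ∈ I ↔ Subalgebra.inclusion hRL x ∈ N := fun _ => Iff.rfl
  by_cases hdisj : Disjoint (I : Set (pvRing Y)) (nonZeroDivisors (pvRing Y))
  · exfalso
    obtain ⟨g, hgann, hg0⟩ := Submodule.exists_mem_ne_zero_of_ne_bot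
      (Ideal.bot_lt_annihilator_of_disjoint_nonZeroDivisors hdisj).ne'
    have hgI : ∀ x ∈ I, (g : SeqRing k) * x = 0 := fun x hx => by
      have := Module.mem_annihilator.1 hgann ⟨x, hx⟩
      exact congrArg (fun y : I => ((y : pvRing Y) : SeqRing k)) this
    obtain ⟨⟨f, hfL⟩, hfN, hf0⟩ := Submodule.exists_mem_ne_zero_of_ne_bot hbot
    obtain ⟨b, hb, hbu, hfb⟩ := hfL
    have hbL := le_fractionSubalgebra hb
    have haR : f * b ∈ pvRing Y := entryRing_le_pvRing Y hfb
    have ha0 : f * b ≠ 0 := fun h => hf0 (Subtype.ext (hbu.mul_left_eq_zero.1 h))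
    have haN : (⟨f * b, hRL haR⟩ : fractionSubalgebra (entryRing Y)) ∈ N := by
      have := N.mul_mem_right ⟨b, hbL⟩ hfN
      exact this
    have hpowN : ∀ t, ∃ h, (⟨(seqShift k ^ t) (f * b), h⟩ : fractionSubalgebra (entryRing Y)) ∈ N := by
      intro t
      induction t with
      | zero => exact ⟨hRL haR, haN⟩
      | succ t ih =>
        obtain ⟨h, hN'⟩ := ih
        have := hN _ hN'
        rw [pow_succ']
        exact ⟨_, this⟩
    have hkill : ∀ t, (g : SeqRing k) * (seqShift k ^ t) (f * b) = 0 := by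
      intro t
      obtain ⟨h, hN'⟩ := hpowN t
      exact hgI ⟨_, seqShift_pow_mem (fun _ h => seqShift_mem_pvRing hY h) t haR⟩ hN'
    obtain ⟨m, hm, hper⟩ := hP _ haR
    obtain ⟨α, hα⟩ := SeqRing.exists_mk (f * b)
    obtain ⟨γ, hγ⟩ := SeqRing.exists_mk (g : SeqRing k)
    obtain ⟨N₀, hN₀⟩ := hper α hα
    rw [← hα] at ha0
    obtain ⟨j₀, hj₀, hαj₀⟩ : ∃ j₀ ≥ N₀, α j₀ ≠ 0 := by
      by_contra! h
      exact ha0 (SeqRing.mk_eq_zero.2 ⟨N₀, h⟩)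
    have hne : ∀ t, α (j₀ + t * m) ≠ 0 := fun t h =>
      hαj₀ ((IsEventuallyPeriodic.add_mul hN₀ hj₀ t).2 h)
    -- The next index of the form j₀ + t·m strictly after j lies at distance between 1 and m, hence
    -- m + 1 shifts counted from 0.
    have hev : ∀ᶠ j in atTop, ∀ t : Fin (m + 1), γ j * α (j + t) = 0 := by
      rw [eventually_all]
      intro t
      have := hkill t
      rw [← hα, ← hγ, seqShift_pow_mk, SeqRing.mk_mul] at this
      exact eventually_atTop.2 (SeqRing.mk_eq_zero.1 this)
    obtain ⟨N₁, hN₁⟩ := eventually_atTop.1 hev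
    apply hg0
    refine Subtype.ext ?_
    rw [← hγ]
    refine SeqRing.mk_eq_zero.2 ⟨max j₀ N₁, fun j hj => ?_⟩
    have hjj : j₀ ≤ j := le_of_max_le_left hj
    have hlt := Nat.mod_lt (j - j₀) hm
    have hdm := Nat.div_add_mod (j - j₀) m
    have := hN₁ j (le_of_max_le_right hj) ⟨m - (j - j₀) % m, by omega⟩
    refine (mul_eq_zero.1 this).resolve_right ?_
    rw [show j + (m - (j - j₀) % m) = j₀ + ((j - j₀) / m + 1) * m by
      rw [add_one_mul, mul_comm]; omega]
    exact hne _
  · obtain ⟨s, hsI, hsnzd⟩ := Set.not_disjoint_iff.1 hdisj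
    obtain ⟨m, hm, hper⟩ := hP _ s.2
    have hu : IsUnit (s : SeqRing k) := by
      refine isUnit_of_nonzerodivisor (fun _ h => seqShift_mem_pvRing hY h)
        (fun _ h => exists_seqShift_eq_of_mem_pvRing hY h) s.2 (fun y hy hsy => ?_) hm hper
      have := (mem_nonZeroDivisors_iff.1 hsnzd).1 ⟨y, hy⟩ (Subtype.ext hsy)
      exact congrArg Subtype.val this
    obtain ⟨u, hu⟩ := hu.exists_right_inv
    have huL := mem_fractionSubalgebra_of_mul_eq_one (hRL s.2) hu
    rw [Ideal.eq_top_iff_one]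
    have := N.mul_mem_right ⟨u, huL⟩ hsI
    convert this using 1
    exact Subtype.ext hu.symm

/-- The fundamental matrix as a matrix over the ring it generates. -/
theorem exists_gl_lift {R : Subalgebra (RatFunc k) (SeqRing k)} (hR : glGenerators Y ⊆ R) :
    ∃ Y' : GL (Fin n) R, Matrix.GeneralLinearGroup.map (R.val : R →+* SeqRing k) Y' = Y := by
  have h1 : ∀ i j, (Y : Matrix (Fin n) (Fin n) (SeqRing k)) i j ∈ R :=
    fun i j => hR (entry_mem_glGenerators Y i j)
  have h2 : ∀ i j, ((Y⁻¹ : GL (Fin n) (SeqRing k)) : Matrix (Fin n) (Fin n) (SeqRing k)) i j ∈ R :=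
    fun i j => glGenerators_inv_subset Y R.toSubring hR (entry_mem_glGenerators Y⁻¹ i j)
  let M : Matrix (Fin n) (Fin n) R := fun i j => ⟨_, h1 i j⟩
  let M' : Matrix (Fin n) (Fin n) R := fun i j => ⟨_, h2 i j⟩
  have hinj : Function.Injective (R.val : R →+* SeqRing k).mapMatrix :=
    Matrix.map_injective (m := Fin n) (n := Fin n) Subtype.val_injective
  have hMM' : M * M' = 1 := by
    apply hinj
    rw [map_mul, map_one]
    exact Y.mul_inv
  refine ⟨⟨M, M', hMM', mul_eq_one_comm.1 hMM'⟩, ?_⟩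
  ext i j
  rfl

theorem adjoin_glGenerators_eq_top {R : Subalgebra (RatFunc k) (SeqRing k)} {Y' : GL (Fin n) R} :
    Algebra.adjoin (RatFunc k) (glGenerators Y') = ⊤ ↔
      R = pvRing (Matrix.GeneralLinearGroup.map (R.val : R →+* SeqRing k) Y') := by
  rw [pvRing, ← image_glGenerators]
  have h1 : Algebra.adjoin (RatFunc k) ((R.val : R →+* SeqRing k) '' glGenerators Y') =
      (Algebra.adjoin (RatFunc k) (glGenerators Y')).map R.val :=
    (AlgHom.map_adjoin R.val _).symm
  rw [h1]
  have h2 : R = (⊤ : Subalgebra (RatFunc k) R).map R.val := by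
    rw [Algebra.map_top, Subalgebra.range_val]
  constructor
  · intro h; rw [h]; exact h2
  · intro h
    have h3 := h.symm.trans h2
    exact Subalgebra.map_injective Subtype.val_injective h3

theorem IsFundamentalMatrix.restrict {A : Matrix (Fin n) (Fin n) (RatFunc k)}
    {R : Subalgebra (RatFunc k) (SeqRing k)} (hR : ∀ x ∈ R, seqShift k x ∈ R) {Y' : GL (Fin n) R} :
    IsFundamentalMatrix ((seqShift k).restrict R R hR) A Y' ↔ IsFundamentalMatrix (seqShift k) A
      (Matrix.GeneralLinearGroup.map (R.val : R →+* SeqRing k) Y') := by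
  have hinj : Function.Injective (fun M : Matrix (Fin n) (Fin n) R => M.map R.val) :=
    Matrix.map_injective Subtype.val_injective
  have h1 : ((Y' : Matrix (Fin n) (Fin n) R).map ((seqShift k).restrict R R hR)).map R.val =
      ((Y' : Matrix (Fin n) (Fin n) R).map R.val).map (seqShift k) := rfl
  have h2 : (A.map (algebraMap (RatFunc k) R) * (Y' : Matrix (Fin n) (Fin n) R)).map R.val =
      A.map (algebraMap (RatFunc k) (SeqRing k)) * (Y' : Matrix (Fin n) (Fin n) R).map R.val := by
    rw [Matrix.map_mul]; rfl
  constructor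
  · intro h
    have := congrArg (fun M : Matrix (Fin n) (Fin n) R => M.map R.val) h
    simp only [h1, h2] at this
    exact this
  · intro h
    apply hinj
    simp only [h1, h2]
    exact h

theorem isPicardVessiotRingInSeq_pvRing
    (hY : IsFundamentalMatrix (seqShift k) (𝒜 : Matrix (Fin n) (Fin n) (RatFunc k)) Y)
    (hP : ∀ x ∈ pvRing Y, ∃ m, 0 < m ∧ ZerosPeriodic m x) :
    IsPicardVessiotRingInSeq (𝒜 : Matrix (Fin n) (Fin n) (RatFunc k)) (pvRing Y) := by
  have hR : ∀ x ∈ pvRing Y, seqShift k x ∈ pvRing Y := fun _ h => seqShift_mem_pvRing hY h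
  have hL := seqShift_mem_fractionSubalgebra hY
  obtain ⟨Y', hY'⟩ := exists_gl_lift (glGenerators_subset_pvRing Y)
  have hfund : IsFundamentalMatrix ((seqShift k).restrict (pvRing Y) (pvRing Y) hR)
      (𝒜 : Matrix (Fin n) (Fin n) (RatFunc k)) Y' := by
    rw [IsFundamentalMatrix.restrict, hY']; exact hY
  have hgen : Algebra.adjoin (RatFunc k) (glGenerators Y') = ⊤ := by
    rw [adjoin_glGenerators_eq_top, hY']
  have hcompat : ∀ (S : Subalgebra (RatFunc k) (SeqRing k)) (hS : ∀ x ∈ S, seqShift k x ∈ S) (a),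
      (seqShift k).restrict S S hS (algebraMap (RatFunc k) S a) =
        algebraMap (RatFunc k) S (ratShift k a) := fun S hS a => Subtype.ext (seqShift_algebraMap a)
  refine ⟨hR, hcompat _ hR, ⟨Y', hfund, hgen⟩, ?_⟩
  refine isSigmaSimple_of_generated (k := k) (K := RatFunc k)
    (L := fractionSubalgebra (entryRing Y)) ratShift_algebraMap (hcompat _ hL) (hcompat _ hR) ?_
    (isSigmaSimple_fractionSubalgebra hY hP hL)
    (Subalgebra.inclusion (pvRing_le_fractionSubalgebra Y)) (Subalgebra.inclusion_injective _)
    (fun x => rfl) hfund hgen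
  intro x hx
  obtain ⟨c, hc⟩ := exists_algebraMap_of_seqShift_eq (congrArg Subtype.val hx)
  exact ⟨c, Subtype.ext hc⟩

/-- Uniqueness: inside `SeqRing k` the ring generated does not depend on the fundamental matrix. -/
theorem IsPicardVessiotRingInSeq.eq_pvRing {A : Matrix (Fin n) (Fin n) (RatFunc k)}
    (hY : IsFundamentalMatrix (seqShift k) A Y) {R : Subalgebra (RatFunc k) (SeqRing k)}
    (h : IsPicardVessiotRingInSeq A R) : R = pvRing Y := by
  obtain ⟨hR, _, ⟨Y', hY', hgen⟩, _⟩ := h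
  rw [IsFundamentalMatrix.restrict] at hY'
  rw [pvRing_eq hY hY']
  exact adjoin_glGenerators_eq_top.1 hgen

theorem exists_isPeriodInSeq
    (hY : IsFundamentalMatrix (seqShift k) (𝒜 : Matrix (Fin n) (Fin n) (RatFunc k)) Y)
    (hP : ∀ x ∈ pvRing Y, ∃ m, 0 < m ∧ ZerosPeriodic m x) : ∃ l, IsPeriodInSeq (pvRing Y) l := by
  obtain ⟨hR, hPV⟩ := isPicardVessiotRingInSeq_pvRing hY hP
  have hbij : Function.Bijective ((seqShift k).restrict (pvRing Y) (pvRing Y) hR) := by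
    refine ⟨fun x y h => Subtype.ext (seqShift_injective (congrArg Subtype.val h)), fun x => ?_⟩
    obtain ⟨y, hy, h⟩ := exists_seqShift_eq_of_mem_pvRing hY x.2
    exact ⟨⟨y, hy⟩, Subtype.ext h⟩
  obtain ⟨l, hl⟩ := exists_isPeriod hbij hPV.simple
  exact ⟨l, hR, hl⟩

/-- The idempotents of a period decomposition, as elements of the ring of sequences. -/
theorem IsPeriodInSeq.exists_idempotents {R : Subalgebra (RatFunc k) (SeqRing k)} {l : ℕ}
    (h : IsPeriodInSeq R l) : 0 < l ∧ ∃ e : Fin l → SeqRing k, CompleteOrthogonalIdempotents e ∧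
      (∀ i, seqShift k (e i) = e (finRotate l i)) ∧ ∀ i, e i ∈ R ∧ e i ≠ 0 ∧
        ∀ x ∈ R, ∀ y ∈ R, (e i * x) * (e i * y) = 0 → e i * x = 0 ∨ e i * y = 0 := by
  obtain ⟨hR, hl, e, he, hσ, hd⟩ := h
  refine ⟨hl, fun i => e i, he.map (R.val : R →+* SeqRing k), fun i => ?_, fun i => ⟨(e i).2,
    fun h => (hd i).1 (Subtype.ext h), fun x hx y hy hxy => ?_⟩⟩
  · exact congrArg Subtype.val (hσ i)
  · exact ((hd i).2.1 ⟨x, hx⟩ ⟨y, hy⟩ (Subtype.ext hxy)).imp (congrArg Subtype.val)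
      (congrArg Subtype.val)

/-- If the ring `R` splits into domains along the residue classes modulo `l`, an element of `R` that
is not zero on a residue class has only finitely many zeros there. -/
theorem isUnit_add_one_sub_of_mul_ne_zero {R : Subalgebra (RatFunc k) (SeqRing k)}
    (hR : ∀ x ∈ R, seqShift k x ∈ R) {l : ℕ} {e : Fin l → SeqRing k}
    (he : CompleteOrthogonalIdempotents e) (hσ : ∀ i, seqShift k (e i) = e (finRotate l i))
    (hd : ∀ i, e i ∈ R ∧ e i ≠ 0 ∧
        ∀ x ∈ R, ∀ y ∈ R, (e i * x) * (e i * y) = 0 → e i * x = 0 ∨ e i * y = 0)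
    {x : SeqRing k} (hx : x ∈ R) {m : ℕ} (hm : 0 < m) (hper : ZerosPeriodic m x) (i : Fin l)
    (hix : e i * x ≠ 0) : IsUnit (e i * x + (1 - e i)) := by
  obtain ⟨i₀, hi₀⟩ := exists_eq_indicator he hσ
  obtain ⟨f, rfl⟩ := SeqRing.exists_mk x
  obtain ⟨N, hN⟩ := hper f rfl
  set u : ℕ → k := fun j => if ((i : ℕ) + j) % l = i₀ then 1 else 0 with hu
  have hei : e i = SeqRing.mk u := hi₀ i
  have huf : e i * SeqRing.mk f + (1 - e i) = SeqRing.mk (u * f + (1 - u)) := by rw [hei]; rfl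
  rw [huf, SeqRing.isUnit_mk]
  by_contra! hcon
  obtain ⟨j₀, hj₀, h0⟩ := hcon N
  have hij₀ : ((i : ℕ) + j₀) % l = i₀ := by
    by_contra hne
    simp [hu, hne] at h0
  have hfj₀ : f j₀ = 0 := by simpa [hu, hij₀] using h0
  have hzero : ∀ t, f (j₀ + t * m) = 0 := fun t => (IsEventuallyPeriodic.add_mul hN hj₀ t).1 hfj₀
  -- A zero j₀ on the i-th class gives zeros on j₀ + ℕ·lm, so among m shifts by multiples of l one
  -- vanishes at any given index of the class.
  have hprod : ∏ t ∈ Finset.range m, (seqShift k ^ (l * t)) (SeqRing.mk (u * f)) = 0 := by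
    refine prod_seqShift_pow_eq_zero (N := j₀) fun j hj => ?_
    by_cases hij : ((i : ℕ) + j) % l = i₀
    · obtain ⟨q, hq⟩ : l ∣ j - j₀ := by
        have h1 : (i : ℕ) + j ≡ i + j₀ [MOD l] := hij.trans hij₀.symm
        exact (Nat.modEq_iff_dvd' hj).1 (Nat.ModEq.add_left_cancel' _ h1).symm
      have hlt := Nat.mod_lt q hm
      have hdm := Nat.div_add_mod q m
      by_cases hz : q % m = 0
      · refine ⟨0, hm, ?_⟩
        have : j = j₀ + (l * (q / m)) * m := by
          rw [mul_assoc, mul_comm (q / m), show m * (q / m) = q by omega]; omega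
        rw [mul_zero, add_zero, Pi.mul_apply, this, hzero, mul_zero]
      · refine ⟨m - q % m, by omega, ?_⟩
        have : j + l * (m - q % m) = j₀ + (l * (q / m + 1)) * m := by
          have h2 : (q / m + 1) * m = q + (m - q % m) := by rw [add_one_mul, mul_comm]; omega
          rw [mul_assoc, h2, mul_add]; omega
        rw [Pi.mul_apply, this, hzero, mul_zero]
    · exact ⟨0, hm, by simp [hu, hij]⟩
  -- The idempotent e i is fixed by σˡ, so all factors lie in the domain e i R and the product
  -- cannot be zero.
  have hshift : ∀ t, (seqShift k ^ (l * t)) (SeqRing.mk (u * f)) =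
      e i * (seqShift k ^ (l * t)) (SeqRing.mk f) := by
    intro t
    rw [hei, seqShift_pow_mk, seqShift_pow_mk, SeqRing.mk_mul]
    congr 1
    funext j
    simp only [Pi.mul_apply, hu, ← add_assoc, Nat.add_mul_mod_self_left]
  have hnz : ∀ S : Finset ℕ, e i * ∏ t ∈ S, (e i * (seqShift k ^ (l * t)) (SeqRing.mk f)) ≠ 0 := by
    intro S
    induction S using Finset.induction_on with
    | empty => simpa using (hd i).2.1
    | insert t S ht ih =>
      intro h
      have hidem : e i * e i = e i := he.idem i
      have hxt := seqShift_pow_mem hR (l * t) hx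
      rw [Finset.prod_insert ht] at h
      have h' : (e i * (seqShift k ^ (l * t)) (SeqRing.mk f)) *
          (e i * ∏ t ∈ S, (e i * (seqShift k ^ (l * t)) (SeqRing.mk f))) = 0 := by
        rw [← h]; ring
      rcases (hd i).2.2 _ hxt _ (prod_mem fun t _ =>
        mul_mem (hd i).1 (seqShift_pow_mem hR (l * t) hx)) h' with h1 | h1
      · rw [← hshift] at h1
        apply hix
        rw [hei, SeqRing.mk_mul]
        have hinj : Function.Injective (seqShift k ^ (l * t)) := by
          rw [RingHom.coe_pow]; exact seqShift_injective.iterate _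
        exact hinj (h1.trans (map_zero _).symm)
      · exact ih h1
  refine hnz (Finset.range m) ?_
  rw [← Finset.prod_congr rfl fun t _ => hshift t, hprod, mul_zero]

end PV

/-! ### Orbits and companion matrices -/

section Orbits

variable {k : Type*} [Field k] {n : ℕ} {A : Matrix (Fin n) (Fin n) (RatFunc k)}

theorem IsOrbit.fst {x : Point k n} {o : ℕ → Point k n} (ho : IsOrbit A x o) {b : ℕ}
    (hb : x.1 = (b : k)) (i : ℕ) : (o i).1 = ((b + i : ℕ) : k) := by
  induction i with
  | zero => rw [ho.1, hb, add_zero]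
  | succ i ih =>
    obtain ⟨_, h⟩ := ho.2 i
    rw [← h]
    change (o i).1 + 1 = _
    rw [ih]; push_cast; ring

theorem IsOrbit.snd {x : Point k n} {o : ℕ → Point k n} (ho : IsOrbit A x o) (i : ℕ) :
    ((o (i + 1)).2 : Matrix (Fin n) (Fin n) k) = evMatrix A (o i).1 * (o i).2 := by
  obtain ⟨_, h⟩ := ho.2 i
  rw [← h]
  rfl

theorem exists_orbit {b : ℕ}
    (h : ∀ i : ℕ, (∀ i' j', RegularAt (A i' j') ((b + i : ℕ) : k)) ∧
      (evMatrix A ((b + i : ℕ) : k)).det ≠ 0) : ∃ o, IsOrbit A ((b : k), 1) o := by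
  let B : ℕ → GL (Fin n) k := fun i => Nat.rec 1 (fun i Bi =>
    Matrix.GeneralLinearGroup.mkOfDetNeZero (evMatrix A ((b + i : ℕ) : k)) (h i).2 * Bi) i
  refine ⟨fun i => (((b + i : ℕ) : k), B i), rfl, fun i => ⟨h i, ?_⟩⟩
  refine Prod.ext ?_ rfl
  change ((b + i : ℕ) : k) + 1 = ((b + (i + 1) : ℕ) : k)
  push_cast; ring

/-- The companion matrix with last row `-h`. -/
def companionMatrix {R : Type*} [CommRing R] {n : ℕ} (h : Fin n → R) : Matrix (Fin n) (Fin n) R :=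
  Matrix.of fun i j => if (i : ℕ) + 1 = n then - h j else if (j : ℕ) = (i : ℕ) + 1 then 1 else 0

/-- The system with companion matrix is solved explicitly: all rows but the last prescribe the
coordinates after the first, and the last row gives the first one on division by h₀. Stated over a
ring so as to apply to both k(z) and k[z]. -/
theorem exists_companionMatrix_mul_eq_one {R : Type*} [CommRing R] {n : ℕ} (hn : 0 < n)
    (h : Fin n → R) (h0 : IsUnit (h ⟨0, hn⟩)) :
    ∃ B : Matrix (Fin n) (Fin n) R, companionMatrix h * B = 1 := by
  rw [← Matrix.mulVec_surjective_iff_exists_right_inverse]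
  intro w
  obtain ⟨m, rfl⟩ := Nat.exists_eq_succ_of_ne_zero hn.ne'
  obtain ⟨c, hc⟩ := h0.exists_right_inv
  refine ⟨Fin.cons (-c * (w (Fin.last m) + ∑ j : Fin m, h j.succ * w j.castSucc))
    fun j => w j.castSucc, ?_⟩
  funext i
  rw [Matrix.mulVec, dotProduct, Fin.sum_univ_succ]
  induction i using Fin.lastCases with
  | last =>
    simp only [companionMatrix, Matrix.of_apply, Fin.val_last, if_true, Fin.cons_zero, Fin.cons_succ,
      neg_mul, Finset.sum_neg_distrib]
    change -(h 0 * -(c * _)) + _ = _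
    have hc' : h 0 * c = 1 := hc
    linear_combination (w (Fin.last m) + ∑ j : Fin m, h j.succ * w j.castSucc) * hc'
  | cast i =>
    have hi : ¬ ((i.castSucc : ℕ) + 1 = m.succ) := by
      have := i.2
      simp only [Fin.val_castSucc]; omega
    simp only [companionMatrix, Matrix.of_apply]
    have h00 : ¬ (((0 : Fin m.succ) : ℕ) = (i.castSucc : ℕ) + 1) := by simp
    simp only [if_neg hi, if_neg h00, zero_mul, zero_add, Fin.cons_succ]
    rw [Finset.sum_eq_single i]
    · simp
    · intro j _ hji
      have : ¬ ((j.succ : ℕ) = (i.castSucc : ℕ) + 1) := by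
        simp only [Fin.val_succ, Fin.val_castSucc]
        intro h; exact hji (Fin.ext (by omega))
      rw [if_neg this, zero_mul]
    · simp

theorem exists_coe_eq_systemMatrix (hn : 0 < n) (h : Fin n → RatFunc k) (h0 : h ⟨0, hn⟩ ≠ 0) :
    ∃ 𝒜 : GL (Fin n) (RatFunc k), (𝒜 : Matrix (Fin n) (Fin n) (RatFunc k)) = systemMatrix h := by
  obtain ⟨B, hB⟩ := exists_companionMatrix_mul_eq_one hn h (IsUnit.mk0 _ h0)
  exact ⟨⟨systemMatrix h, B, hB, mul_eq_one_comm.1 hB⟩, rfl⟩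

end Orbits

/-! ### Zeros of period l and the Picard-Vessiot extension -/

section PV

variable {k : Type*} [Field k] [CharZero k] {n : ℕ} {𝒜 : GL (Fin n) (RatFunc k)}
  {Y : GL (Fin n) (SeqRing k)}

theorem mul_mul_eq_of_add_one_sub {B : Type*} [CommRing B] {e x z : B} (he : e * e = e)
    (hz : (e * x + (1 - e)) * z = 1) : (e * x) * z = e := by
  linear_combination e * hz - (x * z - z) * he

/-- Replaces the period m, which varies with the element, by the period l of the ring: on each
residue class modulo l an element is zero or eventually without zeros. -/
theorem zerosPeriodic_of_isPeriodInSeq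
    (hY : IsFundamentalMatrix (seqShift k) (𝒜 : Matrix (Fin n) (Fin n) (RatFunc k)) Y)
    (hP : ∀ x ∈ pvRing Y, ∃ m, 0 < m ∧ ZerosPeriodic m x) {l : ℕ} (hl : IsPeriodInSeq (pvRing Y) l)
    {x : SeqRing k} (hx : x ∈ pvRing Y) : ZerosPeriodic l x := by
  obtain ⟨hl0, e, he, hσ, hd⟩ := hl.exists_idempotents
  refine zerosPeriodic_of_dichotomy hl0 he hσ fun i => or_iff_not_imp_left.2 fun hix => ?_
  obtain ⟨m, hm, hper⟩ := hP x hx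
  obtain ⟨z, hz⟩ := (isUnit_add_one_sub_of_mul_ne_zero (fun _ h => seqShift_mem_pvRing hY h) he hσ
    hd hx hm hper i hix).exists_right_inv
  exact ⟨z, mul_mul_eq_of_add_one_sub (he.idem i) hz⟩

theorem mem_adjoin_entries_iff {L : Subalgebra (RatFunc k) (SeqRing k)} {Y' : GL (Fin n) L} (x : L) :
    x ∈ Algebra.adjoin (RatFunc k) (entries Y') ↔
      (x : SeqRing k) ∈ entryRing (Matrix.GeneralLinearGroup.map (L.val : L →+* SeqRing k) Y') := by
  have h1 : entryRing (Matrix.GeneralLinearGroup.map (L.val : L →+* SeqRing k) Y') =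
      (Algebra.adjoin (RatFunc k) (entries Y')).map L.val := by
    rw [AlgHom.map_adjoin, entryRing]
    congr 1
    rw [entries, entries, ← Set.range_comp]
    rfl
  rw [h1]
  constructor
  · intro h; exact ⟨x, h, rfl⟩
  · rintro ⟨y, hy, hyx⟩
    rwa [← Subtype.ext (a1 := y) (a2 := x) hyx]

/-- If the zeros of the elements of `k(z)[Yᵢⱼ, 1 / det Y]` are eventually periodic, the ring of
fractions of `k(z)[Yᵢⱼ]` is a Picard-Vessiot extension. -/
theorem isPicardVessiotExtensionInSeq_fractionSubalgebra
    (hY : IsFundamentalMatrix (seqShift k) (𝒜 : Matrix (Fin n) (Fin n) (RatFunc k)) Y)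
    (hP : ∀ x ∈ pvRing Y, ∃ m, 0 < m ∧ ZerosPeriodic m x) :
    IsPicardVessiotExtensionInSeq (𝒜 : Matrix (Fin n) (Fin n) (RatFunc k))
      (fractionSubalgebra (entryRing Y)) := by
  obtain ⟨l, hl⟩ := exists_isPeriodInSeq hY hP
  obtain ⟨hl0, e, he, hσ, hd⟩ := hl.exists_idempotents
  have hR : ∀ x ∈ pvRing Y, seqShift k x ∈ pvRing Y := fun _ h => seqShift_mem_pvRing hY h
  have hL := seqShift_mem_fractionSubalgebra hY
  have hRL := pvRing_le_fractionSubalgebra Y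
  have hSR := entryRing_le_pvRing Y
  set L := fractionSubalgebra (entryRing Y) with hLdef
  -- Padding with 1 - e i makes a nonzero component a unit of `SeqRing k`; the padded element lies
  -- in R, so its inverse lies in L.
  have hinv : ∀ x ∈ pvRing Y, ∀ i, e i * x ≠ 0 → ∃ z ∈ L, (e i * x) * z = e i := by
    intro x hx i hix
    obtain ⟨m, hm, hper⟩ := hP x hx
    obtain ⟨z, hz⟩ := (isUnit_add_one_sub_of_mul_ne_zero hR he hσ hd hx hm hper i
      hix).exists_right_inv
    refine ⟨z, mem_fractionSubalgebra_of_mul_eq_one (hRL ?_) hz,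
      mul_mul_eq_of_add_one_sub (he.idem i) hz⟩
    exact add_mem (mul_mem (hd i).1 hx) (sub_mem (one_mem _) (hd i).1)
  obtain ⟨Y', hY'⟩ := exists_gl_lift (R := L) ((glGenerators_subset_pvRing Y).trans hRL)
  refine ⟨hL, fun a => Subtype.ext (seqShift_algebraMap a), ?_, ⟨Y', ?_, ?_⟩, fun x hx => ?_⟩
  · refine ⟨l, hl0, fun i => ⟨e i, hRL (hd i).1⟩,
      CompleteOrthogonalIdempotents.iff_ortho_complete.2 ⟨?_, ?_⟩, ?_, ?_⟩
    · exact fun i j hij => Subtype.ext (he.ortho hij)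
    · refine Subtype.ext ?_
      rw [AddSubmonoidClass.coe_finsetSum]
      exact he.complete
    · exact fun i => Subtype.ext (hσ i)
    · refine fun i => ⟨fun h => (hd i).2.1 (congrArg Subtype.val h), ?_⟩
      rintro ⟨x, hx⟩ hix
      obtain ⟨b, hb, hbu, hxb⟩ := hx
      have hne : e i * (x * b) ≠ 0 := fun h => hix <| Subtype.ext <| by
        rw [← mul_assoc] at h
        exact hbu.mul_left_eq_zero.1 h
      obtain ⟨z, hz, hxz⟩ := hinv _ (hSR hxb) i hne
      refine ⟨⟨b * z, mul_mem (le_fractionSubalgebra hb) hz⟩, Subtype.ext ?_⟩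
      have hidem : e i * e i = e i := he.idem i
      change e i * x * (e i * (b * z)) = e i
      linear_combination hxz + (x * b * z) * hidem
  · rw [IsFundamentalMatrix.restrict, hY']; exact hY
  · have hmem : ∀ x : L, x ∈ Algebra.adjoin (RatFunc k) (entries Y') ↔
        (x : SeqRing k) ∈ entryRing Y := fun x => by rw [mem_adjoin_entries_iff, hY']
    refine (isLocalization_iff _ _).2 ⟨?_, ?_, ?_⟩
    · rintro ⟨⟨⟨s, hsL⟩, hs⟩, hsnzd⟩
      have hs' := (hmem _).1 hs
      -- If a component of s vanished, a numerator of e i would be a nonzero element killing s. With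
      -- all components nonzero, their inverses sum to an inverse of s.
      have hne : ∀ i, e i * s ≠ 0 := by
        intro i h
        obtain ⟨b, hb, hbu, heb⟩ := hRL (hd i).1
        have hebL : e i * b ∈ L := le_fractionSubalgebra heb
        have h0 := (mem_nonZeroDivisors_iff.1 hsnzd).1 ⟨⟨e i * b, hebL⟩, (hmem _).2 heb⟩
          (Subtype.ext (Subtype.ext (by
            change s * (e i * b) = 0
            linear_combination b * h)))
        have h1 : e i * b = 0 := congrArg (fun x => ((x : L) : SeqRing k)) (congrArg Subtype.val h0)
        exact (hd i).2.1 (hbu.mul_left_eq_zero.1 h1)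
      choose z hzL hz using fun i => hinv s (hSR hs') i (hne i)
      refine IsUnit.of_mul_eq_one ⟨∑ i, e i * z i, sum_mem fun i _ =>
        mul_mem (hRL (hd i).1) (hzL i)⟩ (Subtype.ext ?_)
      change s * ∑ i, e i * z i = 1
      rw [Finset.mul_sum, ← he.complete]
      refine Finset.sum_congr rfl fun i _ => ?_
      linear_combination hz i
    · rintro ⟨x, hx⟩
      obtain ⟨b, hb, hbu, hxb⟩ := hx
      refine ⟨⟨⟨⟨x * b, le_fractionSubalgebra hxb⟩, (hmem _).2 hxb⟩,
        ⟨⟨⟨b, le_fractionSubalgebra hb⟩, (hmem _).2 hb⟩, ?_⟩⟩, rfl⟩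
      refine mem_nonZeroDivisors_iff_right.2 ?_
      rintro ⟨⟨y, hyL⟩, hy⟩ hyb
      refine Subtype.ext (Subtype.ext ?_)
      have h1 : y * b = 0 := congrArg (fun x => ((x : L) : SeqRing k)) (congrArg Subtype.val hyb)
      exact hbu.mul_left_eq_zero.1 h1
    · intro x y hxy
      exact ⟨1, by rw [Subtype.ext (a1 := x) (a2 := y) hxy]⟩
  · obtain ⟨c, hc⟩ := exists_algebraMap_of_seqShift_eq (congrArg Subtype.val hx)
    exact ⟨algebraMap k (RatFunc k) c, ratShift_algebraMap c, Subtype.ext hc⟩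

/-! ### From the conditions to periodic zeros -/

variable {A : Matrix (Fin n) (Fin n) (RatFunc k)}

/-- In each field component an element is zero or invertible, so the single period l of the pseudo
field serves all elements. -/
theorem ExtensionCondition.exists_fundamental (h : ExtensionCondition A) :
    ∃ Y : GL (Fin n) (SeqRing k), IsFundamentalMatrix (seqShift k) A Y ∧
      ∀ x ∈ pvRing Y, ∃ m, 0 < m ∧ ZerosPeriodic m x := by
  obtain ⟨L, hL, hPV⟩ := h
  obtain ⟨Y', hY', _⟩ := hPV.generated
  refine ⟨_, (IsFundamentalMatrix.restrict hL).1 hY', fun x hx => ?_⟩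
  have hle : pvRing (Matrix.GeneralLinearGroup.map (L.val : L →+* SeqRing k) Y') ≤ L := by
    refine Algebra.adjoin_le ?_
    rw [← image_glGenerators]
    rintro _ ⟨y, _, rfl⟩
    exact y.2
  obtain ⟨l, hl, e, he, hσ, hd⟩ := hPV.pseudoField
  refine ⟨l, hl, zerosPeriodic_of_dichotomy hl (he.map (L.val : L →+* SeqRing k))
    (fun i => congrArg Subtype.val (hσ i)) fun i => ?_⟩
  by_cases h0 : e i * ⟨x, hle hx⟩ = 0
  · exact Or.inl (congrArg Subtype.val h0)
  · obtain ⟨y, hy⟩ := (hd i).2 _ h0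
    exact Or.inr ⟨_, congrArg Subtype.val hy⟩

theorem mk_eval_poly (p : k[X]) : algebraMap (RatFunc k) (SeqRing k)
    (algebraMap k[X] (RatFunc k) p) = SeqRing.mk fun i => p.eval (i : k) := by
  rw [algebraMap_seq]
  congr 1
  funext i
  exact ev_algebraMap p _

/-- The elements of `k(z)[Yᵢⱼ]` are values of polynomials along the orbit, up to denominators. -/
theorem exists_mvPolynomial_of_mem_entryRing {P : ℕ → Point k n} {Y : GL (Fin n) (SeqRing k)}
    (h1 : ∀ᶠ j in atTop, (P j).1 = (j : k))
    (h2 : ∀ i j, (Y : Matrix (Fin n) (Fin n) (SeqRing k)) i j =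
      SeqRing.mk fun t => ((P t).2 : Matrix (Fin n) (Fin n) k) i j)
    {x : SeqRing k} (hx : x ∈ entryRing Y) : ∃ q : k[X], q ≠ 0 ∧
      ∃ p : MvPolynomial (Option (Fin n × Fin n)) k,
        x * algebraMap (RatFunc k) (SeqRing k) (algebraMap k[X] (RatFunc k) q) =
          SeqRing.mk fun j => MvPolynomial.eval (coord (P j)) p := by
  have hpoly : ∀ q : k[X], algebraMap (RatFunc k) (SeqRing k) (algebraMap k[X] (RatFunc k) q) =
      SeqRing.mk fun j => MvPolynomial.eval (coord (P j))
        (Polynomial.aeval (MvPolynomial.X none : MvPolynomial (Option (Fin n × Fin n)) k) q) := by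
    intro q
    rw [mk_eval_poly, SeqRing.mk_eq_mk]
    filter_upwards [h1] with j hj
    rw [← hj, Polynomial.aeval_def, Polynomial.hom_eval₂, MvPolynomial.eval_X, Polynomial.eval,
      MvPolynomial.algebraMap_eq]
    congr 1
    ext c
    simp
  induction hx using Algebra.adjoin_induction with
  | mem x hx =>
    obtain ⟨⟨i, j⟩, rfl⟩ := hx
    refine ⟨1, one_ne_zero, MvPolynomial.X (some (i, j)), ?_⟩
    simp only [map_one, mul_one, h2, MvPolynomial.eval_X]
    rfl
  | algebraMap c =>
    refine ⟨c.denom, c.denom_ne_zero, Polynomial.aeval (MvPolynomial.X none) c.num, ?_⟩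
    rw [← hpoly, ← map_mul]
    congr 1
    have := RatFunc.num_div_denom c
    have hd : algebraMap k[X] (RatFunc k) c.denom ≠ 0 := by
      simpa using c.denom_ne_zero
    nth_rewrite 1 [← this]
    exact div_mul_cancel₀ _ hd
  | add x y _ _ hx hy =>
    obtain ⟨q, hq, p, hp⟩ := hx
    obtain ⟨q', hq', p', hp'⟩ := hy
    refine ⟨q * q', mul_ne_zero hq hq', p * Polynomial.aeval (MvPolynomial.X none) q' +
      p' * Polynomial.aeval (MvPolynomial.X none) q, ?_⟩
    have : (SeqRing.mk fun j => MvPolynomial.eval (coord (P j))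
        (p * Polynomial.aeval (MvPolynomial.X none) q' +
          p' * Polynomial.aeval (MvPolynomial.X none) q)) =
        (SeqRing.mk fun j => MvPolynomial.eval (coord (P j)) p) *
        (SeqRing.mk fun j => MvPolynomial.eval (coord (P j))
          (Polynomial.aeval (MvPolynomial.X none) q')) +
        (SeqRing.mk fun j => MvPolynomial.eval (coord (P j)) p') *
        (SeqRing.mk fun j => MvPolynomial.eval (coord (P j))
          (Polynomial.aeval (MvPolynomial.X none) q)) := by
      simp only [map_add, map_mul]; rfl
    rw [this, ← hpoly, ← hpoly, ← hp, ← hp', map_mul, map_mul]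
    ring
  | mul x y _ _ hx hy =>
    obtain ⟨q, hq, p, hp⟩ := hx
    obtain ⟨q', hq', p', hp'⟩ := hy
    refine ⟨q * q', mul_ne_zero hq hq', p * p', ?_⟩
    have : (SeqRing.mk fun j => MvPolynomial.eval (coord (P j)) (p * p')) =
        (SeqRing.mk fun j => MvPolynomial.eval (coord (P j)) p) *
        (SeqRing.mk fun j => MvPolynomial.eval (coord (P j)) p') := by
      simp only [map_mul]; rfl
    rw [this, ← hp, ← hp', map_mul, map_mul]
    ring

/-- The matrices along the orbit form a fundamental matrix. Up to units, an element of the ring it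
generates is a polynomial p along the orbit, and the condition is applied to the hypersurface p = 0.
-/
theorem OrbitConditionExists.exists_fundamental (h : OrbitConditionExists A) :
    ∃ Y : GL (Fin n) (SeqRing k), IsFundamentalMatrix (seqShift k) A Y ∧
      ∀ x ∈ pvRing Y, ∃ m, 0 < m ∧ ZerosPeriodic m x := by
  obtain ⟨x₀, o, ⟨b, hb⟩, ho, hcond⟩ := h
  -- Reindexed so that the first coordinate at j ≥ b is j. Truncated subtraction repeats the initial
  -- point for j < b, which does not affect germs and keeps every matrix invertible.
  let P : ℕ → Point k n := fun j => o (j - b)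
  let M : Matrix (Fin n) (Fin n) (SeqRing k) := Matrix.of fun i j =>
    SeqRing.mk fun t => ((P t).2 : Matrix (Fin n) (Fin n) k) i j
  let M' : Matrix (Fin n) (Fin n) (SeqRing k) := Matrix.of fun i j =>
    SeqRing.mk fun t => (((P t).2⁻¹ : GL (Fin n) k) : Matrix (Fin n) (Fin n) k) i j
  have hsum : ∀ (f g : Fin n → ℕ → k), ∑ l, SeqRing.mk (f l) * SeqRing.mk (g l) =
      SeqRing.mk fun t => ∑ l, f l t * g l t := by
    intro f g
    have : (fun t => ∑ l, f l t * g l t) = ∑ l, f l * g l := by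
      ext t; simp
    rw [this]
    exact (map_sum (SeqRing.mkHom (k := k)) _ _).symm
  have hMM' : M * M' = 1 := by
    ext i j
    rw [Matrix.mul_apply]
    simp only [M, M', Matrix.of_apply]
    rw [hsum]
    have : ∀ t, ∑ l, ((P t).2 : Matrix (Fin n) (Fin n) k) i l *
        (((P t).2⁻¹ : GL (Fin n) k) : Matrix (Fin n) (Fin n) k) l j =
        (1 : Matrix (Fin n) (Fin n) k) i j := fun t => by
      rw [← Matrix.mul_apply, ← Units.val_mul, mul_inv_cancel, Units.val_one]
    simp only [this, Matrix.one_apply]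
    split_ifs <;> rfl
  have hPfst : ∀ᶠ j in atTop, (P j).1 = (j : k) := eventually_atTop.2 ⟨b, fun j hj => by
    rw [ho.fst hb, Nat.add_sub_cancel' hj]⟩
  let Y : GL (Fin n) (SeqRing k) := ⟨M, M', hMM', mul_eq_one_comm.1 hMM'⟩
  refine ⟨Y, ?_, fun x hx => ?_⟩
  · ext i j
    rw [Matrix.mul_apply]
    change seqShift k (M i j) = ∑ l, algebraMap _ _ (A i l) * M l j
    simp only [M, Matrix.of_apply, algebraMap_seq]
    rw [hsum, seqShift_mk, SeqRing.mk_eq_mk]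
    refine eventually_atTop.2 ⟨b, fun t ht => ?_⟩
    change ((o (t + 1 - b)).2 : Matrix (Fin n) (Fin n) k) i j = _
    rw [Nat.sub_add_comm ht, ho.snd, Matrix.mul_apply, ho.fst hb, Nat.add_sub_cancel' ht]
    rfl
  · obtain ⟨c, hc, hcu, hxc⟩ := pvRing_le_fractionSubalgebra Y hx
    obtain ⟨q, hq, p, hp⟩ := exists_mvPolynomial_of_mem_entryRing hPfst (fun i j => rfl) hxc
    have hqu : IsUnit (algebraMap (RatFunc k) (SeqRing k) (algebraMap k[X] (RatFunc k) q)) := by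
      refine IsUnit.map _ (IsUnit.mk0 _ ?_)
      simpa using hq
    obtain ⟨m, hm, N, hN⟩ := (hcond {x | ∀ p' ∈ ({p} : Set _), MvPolynomial.eval (coord x) p' = 0}
      ⟨_, rfl⟩).exists_isEventuallyPeriodic
    refine ⟨m, hm, ZerosPeriodic.of_mul_isUnit hcu (ZerosPeriodic.of_mul_isUnit hqu ?_)⟩
    rw [hp]
    refine zerosPeriodic_mk ⟨b + N, fun j hj => ?_⟩
    have := hN (j - b) (by omega)
    rw [← Nat.sub_add_comm (by omega)] at this
    simpa using this

/-- The values of the determinant form the image in `SeqRing k` of a unit of k(z). -/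
theorem eventually_det_evMatrix_ne_zero (𝒜 : GL (Fin n) (RatFunc k)) :
    ∃ N : ℕ, ∀ i ≥ N, (evMatrix (𝒜 : Matrix (Fin n) (Fin n) (RatFunc k)) (i : k)).det ≠ 0 := by
  have hu : IsUnit (algebraMap (RatFunc k) (SeqRing k) (𝒜 : Matrix (Fin n) (Fin n) (RatFunc k)).det) :=
    (Matrix.isUnits_det_units 𝒜).map _
  have hdet : algebraMap (RatFunc k) (SeqRing k) (𝒜 : Matrix (Fin n) (Fin n) (RatFunc k)).det =
      SeqRing.mk fun i : ℕ => (evMatrix (𝒜 : Matrix (Fin n) (Fin n) (RatFunc k)) (i : k)).det := by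
    rw [RingHom.map_det]
    let M : Matrix (Fin n) (Fin n) (ℕ → k) := Matrix.of fun i j t =>
      ev ((𝒜 : Matrix (Fin n) (Fin n) (RatFunc k)) i j) (t : k)
    have h1 : (algebraMap (RatFunc k) (SeqRing k)).mapMatrix
        (𝒜 : Matrix (Fin n) (Fin n) (RatFunc k)) = (SeqRing.mkHom (k := k)).mapMatrix M := rfl
    rw [h1, ← RingHom.map_det]
    change SeqRing.mk M.det = _
    congr 1
    funext t
    exact RingHom.map_det (Pi.evalRingHom (fun _ : ℕ => k) t) M
  rw [hdet] at hu
  exact SeqRing.isUnit_mk.1 hu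

/-- Condition 1 would be void without a well-defined orbit. One starts at (b, 1) with b beyond all
integral poles of A and zeros of the determinant. -/
theorem OrbitConditionAll.orbitConditionExists
    (h : OrbitConditionAll (𝒜 : Matrix (Fin n) (Fin n) (RatFunc k))) :
    OrbitConditionExists (𝒜 : Matrix (Fin n) (Fin n) (RatFunc k)) := by
  obtain ⟨N, hN⟩ := eventually_det_evMatrix_ne_zero 𝒜
  have hreg : ∀ᶠ t : ℕ in atTop, ∀ i j,
      RegularAt ((𝒜 : Matrix (Fin n) (Fin n) (RatFunc k)) i j) (t : k) := by
    rw [eventually_all]; intro i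
    rw [eventually_all]; intro j
    exact eventually_regularAt _
  obtain ⟨N', hN'⟩ := eventually_atTop.1 hreg
  obtain ⟨o, ho⟩ := exists_orbit (A := (𝒜 : Matrix (Fin n) (Fin n) (RatFunc k))) (b := max N N')
    fun i => ⟨hN' _ ((le_max_right N N').trans (Nat.le_add_right _ _)),
      hN _ ((le_max_left N N').trans (Nat.le_add_right _ _))⟩
  exact ⟨_, o, ⟨_, rfl⟩, ho, fun Z hZ => h _ o ⟨_, rfl⟩ ho Z hZ⟩

/-! ### Scalar equations -/

/-- The classes of the solutions of a scalar equation lie in the Picard-Vessiot ring. -/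
theorem mk_mem_pvRing_of_isSolution (hn : 0 < n) {h : Fin n → RatFunc k}
    (h𝒜 : (𝒜 : Matrix (Fin n) (Fin n) (RatFunc k)) = systemMatrix h)
    (hY : IsFundamentalMatrix (seqShift k) (𝒜 : Matrix (Fin n) (Fin n) (RatFunc k)) Y)
    {f : ℕ → k} (hf : IsSolution h f) : SeqRing.mk f ∈ pvRing Y := by
  let v : Fin n → SeqRing k := fun i => SeqRing.mk fun t => f (t + i)
  let W : GL (Fin n) (SeqRing k) :=
    Matrix.GeneralLinearGroup.map (algebraMap (RatFunc k) (SeqRing k)) 𝒜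
  have hW : (W : Matrix (Fin n) (Fin n) (SeqRing k)) =
      (systemMatrix h).map (algebraMap (RatFunc k) (SeqRing k)) := by rw [← h𝒜]; rfl
  have hv : (fun i => seqShift k (v i)) = (W : Matrix (Fin n) (Fin n) (SeqRing k)) *ᵥ v := by
    funext i
    rw [hW, Matrix.mulVec, dotProduct]
    simp only [Matrix.map_apply, systemMatrix, Matrix.of_apply]
    by_cases hi : (i : ℕ) + 1 = n
    · simp only [if_pos hi, v, seqShift_mk, algebraMap_seq, map_neg, neg_mul, Finset.sum_neg_distrib]
      have h1 : ∑ j : Fin n, SeqRing.mk (fun t : ℕ => ev (h j) (t : k)) *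
          SeqRing.mk (fun t => f (t + j)) =
          SeqRing.mkHom (∑ j : Fin n, fun t : ℕ => ev (h j) (t : k) * f (t + j)) := by
        rw [map_sum]; rfl
      rw [h1, eq_neg_iff_add_eq_zero]
      change SeqRing.mk ((fun t => f (t + 1 + i)) +
        ∑ j : Fin n, fun t : ℕ => ev (h j) (t : k) * f (t + j)) = 0
      rw [← SeqRing.mk_zero, SeqRing.mk_eq_mk]
      filter_upwards [hf] with t ht
      have hti : t + 1 + (i : ℕ) = t + n := by omega
      rw [Pi.add_apply, Finset.sum_apply, Pi.zero_apply, ← ht]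
      simp only [hti]
    · have hi' : (i : ℕ) + 1 < n := by omega
      simp only [if_neg hi]
      rw [Finset.sum_eq_single ⟨i + 1, hi'⟩]
      · simp only [if_true, map_one, one_mul, v, seqShift_mk]
        congr 1
        funext t
        rw [add_right_comm, add_assoc]
      · intro j _ hj
        rw [if_neg (fun h => hj (Fin.ext h)), map_zero, zero_mul]
      · simp
  -- The coordinates of the solution vector with respect to `Y` are constants, hence lie in k.
  let c : Fin n → SeqRing k := ((Y⁻¹ : GL (Fin n) (SeqRing k)) : Matrix _ _ (SeqRing k)) *ᵥ v
  have hc : ∀ i, seqShift k (c i) = c i := by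
    have h1 : (fun i => seqShift k (c i)) = c := by
      have h2 : (fun i => seqShift k (c i)) =
          ((Matrix.GeneralLinearGroup.map (seqShift k) Y⁻¹ : GL (Fin n) (SeqRing k)) :
            Matrix _ _ (SeqRing k)) *ᵥ fun i => seqShift k (v i) := by
        funext i
        exact RingHom.map_mulVec (seqShift k) _ v i
      rw [h2, hv, map_inv, map_seqShift_eq hY, Matrix.mulVec_mulVec, ← Units.val_mul]
      simp [c, W]
    exact congrFun h1
  have hvc : v = (Y : Matrix (Fin n) (Fin n) (SeqRing k)) *ᵥ c := by
    simp only [c]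
    rw [Matrix.mulVec_mulVec, ← Units.val_mul, mul_inv_cancel, Units.val_one, Matrix.one_mulVec]
  have hf0 : SeqRing.mk f = v ⟨0, hn⟩ := rfl
  rw [hf0, hvc, Matrix.mulVec, dotProduct]
  refine sum_mem fun j _ => mul_mem (glGenerators_subset_pvRing Y (entry_mem_glGenerators Y _ _)) ?_
  obtain ⟨a, ha⟩ := exists_algebraMap_of_seqShift_eq (hc j)
  rw [← ha]
  exact (pvRing Y).algebraMap_mem (algebraMap k (RatFunc k) a)

end PV

end SML

end

/-! ### The proposition -/

theorem mainTheorem7 {k : Type*} [Field k] [CharZero k] (n : ℕ) (hn : 0 < n)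
    (h : Fin n → RatFunc k) (h_zero : h ⟨0, hn⟩ ≠ 0) :
    ((SML.OrbitConditionAll (SML.systemMatrix h) ∨
        SML.OrbitConditionExists (SML.systemMatrix h) ∨
        SML.ExtensionCondition (SML.systemMatrix h)) →
      ∃ R : Subalgebra (RatFunc k) (SML.SeqRing k),
        (∀ R', SML.IsPicardVessiotRingInSeq (SML.systemMatrix h) R' ↔ R' = R) ∧
        ∃ l : ℕ, (∀ l', SML.IsPeriodInSeq R l' ↔ l' = l) ∧
          ∀ f : ℕ → k, SML.IsSolution h f →
            SML.IsFiniteUnionAPOfPeriodLE l {i | f i = 0}) ∧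
    ((∀ j, ∃ p : Polynomial k, h j = algebraMap (Polynomial k) (RatFunc k) p) →
      (∃ c : k, c ≠ 0 ∧ h ⟨0, hn⟩ = RatFunc.C c) →
        SML.OrbitConditionAll (SML.systemMatrix h) ∧
        SML.OrbitConditionExists (SML.systemMatrix h) ∧
        SML.ExtensionCondition (SML.systemMatrix h)) := by
  obtain ⟨𝒜, h𝒜⟩ := SML.exists_coe_eq_systemMatrix hn h h_zero
  constructor
  · intro hcond
    obtain ⟨Y, hY, hP⟩ : ∃ Y : GL (Fin n) (SML.SeqRing k),
        SML.IsFundamentalMatrix (SML.seqShift k) (SML.systemMatrix h) Y ∧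
          ∀ x ∈ SML.pvRing Y, ∃ m, 0 < m ∧ SML.ZerosPeriodic m x := by
      rcases hcond with h1 | h2 | h3
      · rw [← h𝒜] at h1 ⊢
        exact h1.orbitConditionExists.exists_fundamental
      · exact h2.exists_fundamental
      · exact h3.exists_fundamental
    rw [← h𝒜] at hY
    obtain ⟨l, hl⟩ := SML.exists_isPeriodInSeq hY hP
    refine ⟨SML.pvRing Y, fun R' => ⟨fun hR' => ?_, fun hR' => ?_⟩, l, fun l' => ⟨?_, ?_⟩, ?_⟩
    · rw [← h𝒜] at hR'
      exact hR'.eq_pvRing hY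
    · rw [hR', ← h𝒜]
      exact SML.isPicardVessiotRingInSeq_pvRing hY hP
    · rintro ⟨hR', hl'⟩
      obtain ⟨_, hl⟩ := hl
      exact hl'.unique hl
    · rintro rfl
      exact hl
    · intro f hf
      have hmem := SML.mk_mem_pvRing_of_isSolution hn h𝒜 hY hf
      exact (SML.zerosPeriodic_of_isPeriodInSeq hY hP hl hmem f rfl).isFiniteUnionAPOfPeriodLE
        hl.exists_idempotents.1
  · rintro hpoly ⟨c, hc, hc0⟩
    choose p hp using hpoly
    have hp0 : p ⟨0, hn⟩ = Polynomial.C c := by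
      apply RatFunc.algebraMap_injective k
      rw [← hp, hc0, RatFunc.algebraMap_C]
    have hunit : IsUnit (p ⟨0, hn⟩) := by
      rw [hp0]
      exact Polynomial.isUnit_C.2 (IsUnit.mk0 c hc)
    -- The constant h₀ ≠ 0 is a unit of k[z], so the inverse matrix is polynomial as well.
    obtain ⟨B, hB⟩ := SML.exists_companionMatrix_mul_eq_one hn p hunit
    have hA : SML.systemMatrix h = (SML.companionMatrix p).map
        (algebraMap (Polynomial k) (RatFunc k)) := by
      ext1 i j
      simp only [SML.systemMatrix, SML.companionMatrix, Matrix.of_apply, Matrix.map_apply, hp]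
      split_ifs <;> simp
    have h1 := SML.orbitConditionAll_of_polynomial hA hB
    have h2 : SML.OrbitConditionExists (SML.systemMatrix h) := by
      rw [← h𝒜] at h1 ⊢
      exact h1.orbitConditionExists
    refine ⟨h1, h2, ?_⟩
    obtain ⟨Y, hY, hP⟩ := h2.exists_fundamental
    rw [← h𝒜] at hY ⊢
    exact ⟨_, SML.isPicardVessiotExtensionInSeq_fractionSubalgebra hY hP⟩
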